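/- Let $n\ge 2$ be an integer and $Q=n+2\ (\ge 4)$. On $\mathbb R^{n}\times\mathbb R$ with points $(x,t)$, Lebesgue measure $dx\,dt$ and origin $o$, let $$\varrho(x,t)=(|x|^4+4t^2)^{1/4},\qquad \nabla_G u=(\nabla_x u,\ |x|\,\partial_t u),\qquad \mathcal L_G u=\Delta_x u+|x|^2\,\partial_t^2 u .$$ Let $0<R\le\infty$, $B_R=\{\varrho<R\}$, and let $W:(0,R)\to\mathbb R$ be an arbitrary Lebesgue measurable function. Functions in $C_c^\infty$ are real-valued, and a function $u$ on $\mathbb R^{n+1}$ is called radial if it depends on $\varrho(x,t)$ only. Integrals are taken in $[-\infty,\infty]$: $\int g=\int g^+-\int g^-$, with value $-\infty$ if both terms are infinite (which does not happen below if $W$ is locally integrable on $(0,R)$). (i) (Hardy–Rellich) Put $\lambda_1=(Q-1)/4$ and suppose that $$2\int_0^R f'(t)^2\,t^{Q-3}\,dt+2\,(2\lambda_1+Q-4)\int_0^R f(t)^2\,t^{Q-5}\,dt\ \ge\ \int_0^R W(t)f(t)^2\,t^{Q-3}\,dt\qquad\text{for all } f\in C_c^\infty(0,R).$$ Then $$\int_{B_R}\frac{(\mathcal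 L_G u)^2}{|\nabla_G\varrho|^2}\,dx\,dt\ \ge\ \int_{B_R}W(\varrho)\,|\nabla_G u|^2\,dx\,dt$$ holds for all $u\in C_c^\infty(B_R\setminus\{o\})$ if and only if it holds for all radial $u\in C_c^\infty(B_R\setminus\{o\})$. (ii) (Hardy) Without the condition in (i), $$\int_{B_R}|\nabla_G u|^2\,dx\,dt\ \ge\ \int_{B_R}W(\varrho)\,u^2\,|\nabla_G\varrho|^2\,dx\,dt$$ holds for all $u\in C_c^\infty(B_R\setminus\{o\})$ if and only if it holds for all radial $u\in C_c^\infty(B_R\setminus\{o\})$. (iii) (Rellich) Without the condition in (i), $$\int_{B_R}\frac{(\mathcal L_G u)^2}{|\nabla_G\varrho|^2}\,dx\,dt\ \ge\ \int_{B_R}W(\varrho)\,u^2\,|\nabla_G\varrho|^2\,dx\,dt$$ holds for all $u\in C_c^\infty(B_R\setminus\{o\})$ if and only if it holds for all radial $u\in C_c^\infty(B_R\setminus\{o\})$. -/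

import Mathlib

open MeasureTheory

noncomputable section

namespace Grushin

/-- The underlying space `ℝⁿ × ℝ` of the Grushin space, with points `(x, t)`. Its `volume` is the
Lebesgue measure `dx dt`. -/
abbrev Space (n : ℕ) : Type := EuclideanSpace ℝ (Fin n) × ℝ

/-- The homogeneous dimension `Q = n + 2`. -/
def homDim (n : ℕ) : ℕ := n + 2

/-- The homogeneous norm `ϱ(x, t) = (|x|⁴ + 4 t²)^{1/4}`. -/
def rho {n : ℕ} (p : Space n) : ℝ := (‖p.1‖ ^ 4 + 4 * p.2 ^ 2) ^ ((1 : ℝ) / 4)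

/-- The partial derivative `∂u/∂xᵢ`. -/
def dx {n : ℕ} (i : Fin n) (u : Space n → ℝ) (p : Space n) : ℝ :=
  fderiv ℝ u p (EuclideanSpace.single i 1, 0)

/-- The partial derivative `∂u/∂t`. -/
def dt {n : ℕ} (u : Space n → ℝ) (p : Space n) : ℝ :=
  fderiv ℝ u p (0, 1)

/-- `|∇_G u|²`, where `∇_G u = (∂u/∂x₁, …, ∂u/∂xₙ, |x| ∂u/∂t)` is the Grushin gradient. -/
def gradSq {n : ℕ} (u : Space n → ℝ) (p : Space n) : ℝ :=
  (∑ i, (dx i u p) ^ 2) + (‖p.1‖ * dt u p) ^ 2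

/-- The Grushin operator `L_G u = Δ_x u + |x|² ∂²u/∂t²`. -/
def lap {n : ℕ} (u : Space n → ℝ) (p : Space n) : ℝ :=
  (∑ i, dx i (dx i u) p) + ‖p.1‖ ^ 2 * dt (dt u) p

/-- The `ϱ`-gauge ball `B_R(o)`; the whole space for `R = ∞`. -/
def ball (n : ℕ) (R : EReal) : Set (Space n) := {p | ((rho p : ℝ) : EReal) < R}

/-- The interval `(0, R)` of real numbers, where `R = ∞` is allowed. -/
def interval (R : EReal) : Set ℝ := {t | 0 < t ∧ (t : EReal) < R}

/-- `IsTest U u` says that `u ∈ C_c^∞(U)`, the function `u` being extended by zero to the whole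
space. -/
def IsTest {E : Type*} [NormedAddCommGroup E] [NormedSpace ℝ E] (U : Set E) (u : E → ℝ) : Prop :=
  ContDiff ℝ (⊤ : ℕ∞) u ∧ HasCompactSupport u ∧ tsupport u ⊆ U

/-- A function on the Grushin space is radial if it depends on `ϱ(x, t)` only. -/
def IsRadial {n : ℕ} (u : Space n → ℝ) : Prop := ∃ g : ℝ → ℝ, ∀ p, u p = g (rho p)

/-- The extended-real integral `∫_S g dμ = ∫_S g⁺ dμ - ∫_S g⁻ dμ ∈ [-∞, ∞]` of a real function.
It equals the Bochner integral if `g` is integrable on `S`, it is `∞` if only `g⁺` has an infinite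
integral, and `-∞` if `g⁻` has. -/
def extIntegral {X : Type*} [MeasureSpace X] (S : Set X) (g : X → ℝ) : EReal :=
  ((∫⁻ x in S, ENNReal.ofReal (g x) : ENNReal) : EReal) -
    ((∫⁻ x in S, ENNReal.ofReal (-g x) : ENNReal) : EReal)

/-- The first eigenvalue `λ₁ = (Q - 1) / 4`. -/
def lambdaOne (n : ℕ) : ℝ := ((homDim n : ℝ) - 1) / 4

/-- The one-dimensional condition on `W`: for all `f ∈ C_c^∞(0, R)`,
`2 ∫ f'² t^{Q-3} dt + 2 (2 λ₁ + Q - 4) ∫ f² t^{Q-5} dt ≥ ∫ W f² t^{Q-3} dt` over `(0, R)`.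
The integrands on the left are continuous with compact support in `(0, R)`. -/
def OneDimCondition (n : ℕ) (R : EReal) (W : ℝ → ℝ) : Prop :=
  ∀ f : ℝ → ℝ, IsTest (interval R) f →
    extIntegral (interval R) (fun t => W t * f t ^ 2 * t ^ ((homDim n : ℤ) - 3)) ≤
      ((2 * (∫ t in interval R, deriv f t ^ 2 * t ^ ((homDim n : ℤ) - 3)) +
        2 * (2 * lambdaOne n + (homDim n : ℝ) - 4) *
          (∫ t in interval R, f t ^ 2 * t ^ ((homDim n : ℤ) - 5)) : ℝ) : EReal)

/-- `∫_{B_R} (L_G u)² / |∇_G ϱ|² ≥ ∫_{B_R} W(ϱ) |∇_G u|²`. -/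
def HardyRellichIneq {n : ℕ} (R : EReal) (W : ℝ → ℝ) (u : Space n → ℝ) : Prop :=
  extIntegral (ball n R) (fun p => lap u p ^ 2 / gradSq rho p) ≥
    extIntegral (ball n R) (fun p => W (rho p) * gradSq u p)

/-- `∫_{B_R} |∇_G u|² ≥ ∫_{B_R} W(ϱ) |u|² |∇_G ϱ|²`. -/
def HardyIneq {n : ℕ} (R : EReal) (W : ℝ → ℝ) (u : Space n → ℝ) : Prop :=
  extIntegral (ball n R) (fun p => gradSq u p) ≥
    extIntegral (ball n R) (fun p => W (rho p) * u p ^ 2 * gradSq rho p)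

/-- `∫_{B_R} (L_G u)² / |∇_G ϱ|² ≥ ∫_{B_R} W(ϱ) |u|² |∇_G ϱ|²`. -/
def RellichIneq {n : ℕ} (R : EReal) (W : ℝ → ℝ) (u : Space n → ℝ) : Prop :=
  extIntegral (ball n R) (fun p => lap u p ^ 2 / gradSq rho p) ≥
    extIntegral (ball n R) (fun p => W (rho p) * u p ^ 2 * gradSq rho p)

end Grushin

end

/-! Let E = x·∂ₓ + 2t ∂ₜ generate the dilations (x, t) ↦ (r x, r² t), and put ψ = |∇_G ϱ|² = |x|²/ϱ²
and κ = ψ/ϱ² (`kap`). Away from the origin, removing from ∇_G its component along ∇_G ϱ leaves an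
angular carré du champ Γ (`gam`), for which functions of ϱ behave as constants, and |∇_G u|² =
Γ(u,u) + κ (Eu)². Likewise L_G u = ψ A u + Λ u. On each dilation orbit A (`radLap`) is d²/dr² +
((Q-1)/r) d/dr, and Λ (`angLap`) satisfies Green's formula ∫ f Λg = -∫ Γ(f,g).

The weight ψ has degree 0, hence is constant on orbits. For radial u each of the three inequalities
is therefore a one-dimensional inequality for the profile, with weight r^{Q-1}. Conversely, the
restriction of an arbitrary u to an orbit (`fiber`) is an admissible profile. The one-dimensional
inequality on every orbit, integrated over the gauge sphere, bounds the radial parts of the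
energies. For Hardy the term Γ(u,u) ≥ 0 is then simply dropped.

For the second-order energies, expand (L_G u)²/ψ = ψ (Au)² + 2 Au Λu + (Λu)²/ψ. Green's formula and
integration by parts in E give ∫ Au Λu = ∫ ϱ⁻² Γ(Eu,Eu) + (n-2) ∫ ϱ⁻² Γ(u,u)
(`integral_radLap_mul_angLap`). A spectral gap on gauge spheres gives ∫ (Λu)²/ψ ≥ (n+1) ∫ ϱ⁻² Γ(u,u)
(`integral_gam_div_le_angLap`). The coefficients add up to 2(n-2) + (n+1) = 3n-3 = 2(2λ₁ + Q - 4)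
(`lintegral_lap_sq_ge`). For Rellich these angular terms are nonnegative and dropped. For
Hardy–Rellich they must absorb W(ϱ) Γ(u,u). The angular derivatives of u along an orbit are finitely
many test functions f_a with Γ(u,u) = r⁻² Σ f_a² and Γ(Eu,Eu) = Σ (f_a')², so the one-dimensional
condition applied to each f_a is exactly what is needed. No expansion in spherical harmonics is
used.

The gap n+1 = 4λ₁ (`gauge_sphere_poincare`) is obtained in the coordinates |x|² = sin φ, 2t = cos φ
on the gauge sphere. A function splits into its average over ω = x/|x| and a remainder of mean zero
in ω. The sharp Poincaré inequality on the Euclidean sphere turns the remainder into a Hardy problem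
on (0, π) with ground state √(sin φ), while the average satisfies a one-dimensional Poincaré
inequality pinned at the equator. The Euclidean sphere inequality is itself the Gaussian Poincaré
inequality for functions homogeneous of degree one, and the latter follows by tensorisation from the
line. -/

section

open MeasureTheory ProbabilityTheory

/-! ### Tensorisation of the variance -/

section EfronStein

variable {μ : Measure ℝ} [IsProbabilityMeasure μ] {b : ℝ → ℝ}

/-- Measurable functions on `ℝⁿ` dominated by a multiple of `∏ b (yᵢ)`. -/
def ProdBounded (b : ℝ → ℝ) {n : ℕ} (f : (Fin n → ℝ) → ℝ) : Prop :=
  Measurable f ∧ ∃ C, 0 ≤ C ∧ ∀ y, |f y| ≤ C * ∏ i, b (y i)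

theorem integrable_of_memLp_two {b : ℝ → ℝ} (hb : MemLp b 2 μ) : Integrable b μ :=
  hb.integrable (by norm_num)

theorem ProdBounded.integrable {n : ℕ} {f : (Fin n → ℝ) → ℝ} (hb : MemLp b 2 μ)
    (hf : ProdBounded b f) : Integrable f (Measure.pi fun _ : Fin n => μ) := by
  obtain ⟨hm, C, -, hC⟩ := hf
  refine Integrable.mono' (g := fun y => C * ∏ i, b (y i)) ?_ hm.aestronglyMeasurable
    (.of_forall hC)
  exact (Integrable.fintype_prod (fun _ => integrable_of_memLp_two hb)).const_mul C

theorem ProdBounded.integrable_sq {n : ℕ} {f : (Fin n → ℝ) → ℝ} (hb : MemLp b 2 μ)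
    (hf : ProdBounded b f) : Integrable (fun y => f y ^ 2) (Measure.pi fun _ : Fin n => μ) := by
  obtain ⟨hm, C, -, hC⟩ := hf
  refine Integrable.mono' (g := fun y => C ^ 2 * ∏ i, b (y i) ^ 2) ?_
    (hm.pow_const 2).aestronglyMeasurable (.of_forall fun y => ?_)
  · exact (Integrable.fintype_prod (fun _ => hb.integrable_sq)).const_mul _
  · rw [Real.norm_eq_abs, abs_pow, Finset.prod_pow, ← mul_pow]
    exact pow_le_pow_left₀ (abs_nonneg _) (hC y) 2

theorem sq_integral_le_integral_sq {α : Type*} [MeasurableSpace α] {ν : Measure α}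
    [IsProbabilityMeasure ν] {h : α → ℝ} (h1 : Integrable h ν)
    (h2 : Integrable (fun s => h s ^ 2) ν) : (∫ s, h s ∂ν) ^ 2 ≤ ∫ s, h s ^ 2 ∂ν := by
  set m := ∫ s, h s ∂ν
  have : 0 ≤ ∫ s, (h s ^ 2 - 2 * m * h s + m ^ 2) ∂ν :=
    integral_nonneg fun s => by
      have := sq_nonneg (h s - m)
      simp only [Pi.zero_apply]
      nlinarith
  rw [integral_add (f := fun s => h s ^ 2 - 2 * m * h s) (h2.sub (h1.const_mul _))
    (integrable_const _), integral_sub h2 (h1.const_mul _), integral_const_mul] at this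
  simp only [integral_const, probReal_univ, one_smul] at this
  nlinarith

theorem integral_sub_mean_sq {α : Type*} [MeasurableSpace α] {ν : Measure α}
    [IsProbabilityMeasure ν] {h : α → ℝ} (h1 : Integrable h ν)
    (h2 : Integrable (fun s => h s ^ 2) ν) :
    ∫ s, h s ^ 2 ∂ν = ∫ s, (h s - ∫ t, h t ∂ν) ^ 2 ∂ν + (∫ s, h s ∂ν) ^ 2 := by
  set m := ∫ s, h s ∂ν with hm
  have : ∫ s, (h s - m) ^ 2 ∂ν = ∫ s, (h s ^ 2 - 2 * m * h s + m ^ 2) ∂ν := by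
    congr 1; ext s; ring
  rw [this, integral_add (f := fun s => h s ^ 2 - 2 * m * h s) (h2.sub (h1.const_mul _))
    (integrable_const _), integral_sub h2 (h1.const_mul _), integral_const_mul]
  simp only [integral_const, probReal_univ, one_smul, ← hm]
  ring

theorem integral_pi_succ {n : ℕ} {f : (Fin (n + 1) → ℝ) → ℝ}
    (hf : Integrable f (Measure.pi fun _ => μ)) :
    Integrable (fun p : ℝ × (Fin n → ℝ) => f (Fin.cons p.1 p.2))
      (μ.prod (Measure.pi fun _ => μ)) ∧
    ∫ y, f y ∂(Measure.pi fun _ => μ) =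
      ∫ z, ∫ s, f (Fin.cons s z) ∂μ ∂(Measure.pi fun _ : Fin n => μ) := by
  have hp := (measurePreserving_piFinSuccAbove (fun _ : Fin (n + 1) => μ) 0).symm
  have he : ∀ p : ℝ × (Fin n → ℝ),
      (MeasurableEquiv.piFinSuccAbove (fun _ : Fin (n + 1) => ℝ) 0).symm p = Fin.cons p.1 p.2 := by
    intro p; simp [MeasurableEquiv.piFinSuccAbove]; rfl
  have hi : Integrable (fun p : ℝ × (Fin n → ℝ) => f (Fin.cons p.1 p.2))
      (μ.prod (Measure.pi fun _ => μ)) := by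
    have := hp.integrable_comp_emb (MeasurableEquiv.measurableEmbedding _) |>.2 hf
    simpa only [Function.comp_def, he] using this
  refine ⟨hi, ?_⟩
  rw [← hp.integral_comp' f]
  simp_rw [he]
  exact integral_prod_symm _ hi

theorem measurable_cons {n : ℕ} :
    Measurable fun p : ℝ × (Fin n → ℝ) => (Fin.cons p.1 p.2 : Fin (n + 1) → ℝ) := by
  refine measurable_pi_lambda _ fun i => ?_
  refine Fin.cases ?_ (fun j => ?_) i
  · simpa using measurable_fst
  · simpa using measurable_snd.eval

theorem ProdBounded.integral_cons {n : ℕ} {f : (Fin (n + 1) → ℝ) → ℝ} (hb0 : ∀ s, 0 ≤ b s)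
    (hb : MemLp b 2 μ) (hf : ProdBounded b f) :
    ProdBounded b fun z : Fin n → ℝ => ∫ s, f (Fin.cons s z) ∂μ := by
  obtain ⟨hm, C, hC0, hC⟩ := hf
  refine ⟨?_, C * ∫ s, b s ∂μ, mul_nonneg hC0 (integral_nonneg hb0), fun z => ?_⟩
  · exact ((hm.comp measurable_cons).stronglyMeasurable.integral_prod_left' (μ := μ)).measurable
  · have h : ∀ s, ‖f (Fin.cons s z)‖ ≤ (C * ∏ i, b (z i)) * b s := fun s => by
      refine (hC _).trans_eq ?_
      rw [Fin.prod_univ_succ]; simp; ring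
    refine (norm_integral_le_of_norm_le ((integrable_of_memLp_two hb).const_mul _)
      (.of_forall h)).trans_eq ?_
    rw [integral_const_mul]; ring

theorem ProdBounded.sub {n : ℕ} {f g : (Fin n → ℝ) → ℝ} (hf : ProdBounded b f)
    (hg : ProdBounded b g) : ProdBounded b fun y => f y - g y := by
  obtain ⟨hm, C, hC0, hC⟩ := hf
  obtain ⟨hm', D, hD0, hD⟩ := hg
  refine ⟨hm.sub hm', C + D, by positivity, fun y => (abs_sub _ _).trans ?_⟩
  rw [add_mul]
  exact add_le_add (hC y) (hD y)

theorem measurable_update_pair {n : ℕ} (i : Fin n) :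
    Measurable fun p : ℝ × (Fin n → ℝ) => Function.update p.2 i p.1 := by
  refine measurable_pi_lambda _ fun j => ?_
  by_cases h : j = i
  · subst h; simpa using measurable_fst
  · simpa [h] using measurable_snd.eval

theorem ProdBounded.integral_update {n : ℕ} {f : (Fin n → ℝ) → ℝ} (hb1 : ∀ s, 1 ≤ b s)
    (hb : MemLp b 2 μ) (hf : ProdBounded b f) (i : Fin n) :
    ProdBounded b (fun y => ∫ s, f (Function.update y i s) ∂μ) := by
  have hb0 : ∀ s, 0 ≤ b s := fun s => zero_le_one.trans (hb1 s)
  obtain ⟨hm, C, hC0, hC⟩ := hf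
  refine ⟨?_, C * ∫ s, b s ∂μ, mul_nonneg hC0 (integral_nonneg hb0), fun z => ?_⟩
  · exact ((hm.comp (measurable_update_pair i)).stronglyMeasurable.integral_prod_left'
      (μ := μ)).measurable
  · have h : ∀ s, ‖f (Function.update z i s)‖ ≤ (C * ∏ j, b (z j)) * b s := fun s => by
      refine (hC _).trans ?_
      rw [mul_assoc]
      refine mul_le_mul_of_nonneg_left ?_ hC0
      rw [← Finset.mul_prod_erase _ _ (Finset.mem_univ i),
        ← Finset.mul_prod_erase _ (fun j => b (z j)) (Finset.mem_univ i), mul_comm _ (b s)]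
      simp only [Function.update_self]
      refine mul_le_mul_of_nonneg_left ?_ (hb0 s)
      have : ∏ j ∈ Finset.univ.erase i, b (Function.update z i s j) =
          ∏ j ∈ Finset.univ.erase i, b (z j) :=
        Finset.prod_congr rfl fun j hj => by rw [Function.update_of_ne (Finset.ne_of_mem_erase hj)]
      rw [this]
      -- Integration removes the factor `b (z i)` from the bound; `1 ≤ b` allows it to be put back.
      exact le_mul_of_one_le_left (Finset.prod_nonneg fun j _ => hb0 _) (hb1 _)
    refine (norm_integral_le_of_norm_le ((integrable_of_memLp_two hb).const_mul _)
      (.of_forall h)).trans_eq ?_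
    rw [integral_const_mul]; ring

/-- Efron–Stein inequality for centred functions. -/
theorem integral_sq_le_sum_variance (hb1 : ∀ s, 1 ≤ b s) (hb : MemLp b 2 μ) :
    ∀ {n : ℕ} {f : (Fin n → ℝ) → ℝ}, ProdBounded b f →
      ∫ y, f y ∂(Measure.pi fun _ => μ) = 0 →
      ∫ y, f y ^ 2 ∂(Measure.pi fun _ => μ) ≤
        ∑ i, ∫ y, (f y - ∫ s, f (Function.update y i s) ∂μ) ^ 2 ∂(Measure.pi fun _ => μ) := by
  have hb0 : ∀ s, 0 ≤ b s := fun s => zero_le_one.trans (hb1 s)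
  intro n
  induction n with
  | zero =>
    intro f hf h0
    have hc : ∀ y, f y = f 0 := fun y => by rw [Subsingleton.elim y 0]
    simp_rw [hc] at h0 ⊢
    simp at h0
    simp [h0]
  | succ n ih =>
    intro f hf h0
    -- Condition on all coordinates but the first: the second moment of `f` is the mean conditional
    -- variance plus the second moment of `g`, and the induction hypothesis applies to `g`.
    set g : (Fin n → ℝ) → ℝ := fun z => ∫ s, f (Fin.cons s z) ∂μ with hg
    have hgB : ProdBounded b g := hf.integral_cons hb0 hb
    have hg0 : ∫ z, g z ∂(Measure.pi fun _ => μ) = 0 := by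
      rw [← h0, (integral_pi_succ (hf.integrable hb)).2]
    have IH := ih hgB hg0
    have hsec : ∀ {F : (Fin (n + 1) → ℝ) → ℝ}, ProdBounded b F → ∀ z : Fin n → ℝ,
        Integrable (fun s => F (Fin.cons s z)) μ ∧
        Integrable (fun s => F (Fin.cons s z) ^ 2) μ := by
      intro F hF z
      obtain ⟨hm, C, hC0, hC⟩ := hF
      have hms : Measurable fun s => F (Fin.cons s z) :=
        hm.comp (measurable_cons.comp measurable_prodMk_right)
      have hbd : ∀ s, |F (Fin.cons s z)| ≤ (C * ∏ i, b (z i)) * b s := fun s => by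
        refine (hC _).trans_eq ?_
        rw [Fin.prod_univ_succ]; simp; ring
      refine ⟨((integrable_of_memLp_two hb).const_mul _).mono' hms.aestronglyMeasurable
        (.of_forall hbd), (hb.integrable_sq.const_mul ((C * ∏ i, b (z i)) ^ 2)).mono'
        (hms.pow_const 2).aestronglyMeasurable (.of_forall fun s => ?_)⟩
      rw [Real.norm_eq_abs, abs_pow, ← mul_pow]
      exact pow_le_pow_left₀ (abs_nonneg _) (hbd s) 2
    have hD : ∀ i, ProdBounded b (fun y => f y - ∫ s, f (Function.update y i s) ∂μ) := fun i =>
      hf.sub (hf.integral_update hb1 hb i)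
    rw [Fin.sum_univ_succ]
    have e0 : ∫ y, f y ^ 2 ∂(Measure.pi fun _ => μ) =
        ∫ y, (f y - ∫ s, f (Function.update y 0 s) ∂μ) ^ 2 ∂(Measure.pi fun _ => μ) +
          ∫ z, g z ^ 2 ∂(Measure.pi fun _ => μ) := by
      have i1 := integral_pi_succ (hf.integrable_sq hb)
      have i2 := integral_pi_succ ((hD 0).integrable_sq hb)
      rw [i1.2, i2.2, ← integral_add i2.1.integral_prod_right (hgB.integrable_sq hb)]
      refine integral_congr_ae (.of_forall fun z => ?_)
      simp only [Fin.update_cons_zero]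
      exact integral_sub_mean_sq (hsec hf z).1 (hsec hf z).2
    rw [e0]
    refine add_le_add le_rfl (IH.trans (Finset.sum_le_sum fun i _ => ?_))
    have i2 := integral_pi_succ ((hD i.succ).integrable_sq hb)
    rw [i2.2]
    refine integral_mono ((hgB.sub (hgB.integral_update hb1 hb i)).integrable_sq hb)
      i2.1.integral_prod_right fun z => ?_
    -- By Jensen, averaging over the first coordinate cannot increase the variance term of
    -- coordinate `i.succ`. Fubini, used below, identifies the average of that term's integrand with
    -- the one for `g`.
    have hs := hsec (hD i.succ) z
    refine le_trans (le_of_eq ?_) (sq_integral_le_integral_sq hs.1 hs.2)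
    congr 1
    simp only [hg, Fin.cons_update]
    rw [integral_sub (hsec hf z).1 (by
      simpa only [Fin.cons_update] using (hsec (hf.integral_update hb1 hb i.succ) z).1)]
    congr 1
    rw [integral_integral_swap]
    simp only [← Fin.cons_update]
    obtain ⟨hm, C, hC0, hC⟩ := hf
    have hmm : Measurable fun p : ℝ × ℝ => f (Fin.cons p.2 (Function.update z i p.1)) :=
      hm.comp (measurable_cons.comp (measurable_snd.prodMk
        ((measurable_update_pair i).comp (measurable_fst.prodMk measurable_const))))
    have hbi := integrable_of_memLp_two hb
    refine Integrable.mono' (g := fun p : ℝ × ℝ =>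
      (C * ∏ j ∈ Finset.univ.erase i, b (z j)) * (b p.1 * b p.2))
      ((hbi.mul_prod hbi).const_mul _) hmm.aestronglyMeasurable (.of_forall fun p => ?_)
    refine (hC _).trans_eq ?_
    rw [Fin.prod_univ_succ, ← Finset.mul_prod_erase _ _ (Finset.mem_univ i)]
    have : ∏ j ∈ Finset.univ.erase i,
        b ((Fin.cons p.2 (Function.update z i p.1) : Fin (n + 1) → ℝ) j.succ) =
        ∏ j ∈ Finset.univ.erase i, b (z j) :=
      Finset.prod_congr rfl fun j hj => by
        rw [Fin.cons_succ, Function.update_of_ne (Finset.ne_of_mem_erase hj)]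
    rw [this]
    simp; ring

end EfronStein

end

section

open MeasureTheory ProbabilityTheory Set Filter Topology

/-! ### Nonnegative integrals from a barrier function -/

section Barrier

/-- The common engine of all the one-dimensional inequalities below: `Q` minus the derivative of `T`
will be nonnegative after completing a square, and the boundary values of `T` cancel in the limit.
Integrability is required of `Q` alone, so `T'` may be singular at the ends. -/
theorem setIntegral_nonneg_of_deriv_le_of_aecover {ι : Type*} {l : Filter ι} [l.NeBot]
    [l.IsCountablyGenerated] {a b : ι → ℝ} {s : Set ℝ} {Q T T' : ℝ → ℝ}
    (hc : AECover (volume.restrict s) l fun i => Ioc (a i) (b i))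
    (hab : ∀ᶠ i in l, a i ≤ b i ∧ Icc (a i) (b i) ⊆ s) (hQ : IntegrableOn Q s)
    (hT : ∀ x ∈ s, HasDerivAt T (T' x) x) (hle : ∀ x ∈ s, T' x ≤ Q x)
    (h0 : Tendsto (fun i => T (b i) - T (a i)) l (𝓝 0)) : 0 ≤ ∫ x in s, Q x := by
  refine le_of_tendsto_of_tendsto h0 (hc.integral_tendsto_of_countably_generated hQ) ?_
  filter_upwards [hab] with i ⟨hi, hs⟩
  have hms : Ioc (a i) (b i) ⊆ s := Ioc_subset_Icc_self.trans hs
  rw [Measure.restrict_restrict measurableSet_Ioc, inter_eq_left.2 hms,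
    ← intervalIntegral.integral_of_le hi]
  refine intervalIntegral.sub_le_integral_of_hasDeriv_right_of_le hi
    (fun x hx => (hT x (hs hx)).continuousAt.continuousWithinAt)
    (fun x hx => (hT x (hs (Ioo_subset_Icc_self hx))).hasDerivWithinAt) (hQ.mono_set hs)
    fun x hx => hle x (hs (Ioo_subset_Icc_self hx))

theorem setIntegral_Ioo_nonneg_of_deriv_le {α β : ℝ} (hαβ : α < β) {Q T T' : ℝ → ℝ}
    (hQ : IntegrableOn Q (Ioo α β)) (hT : ∀ x ∈ Ioo α β, HasDerivAt T (T' x) x)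
    (hle : ∀ x ∈ Ioo α β, T' x ≤ Q x) (hα : Tendsto T (𝓝[>] α) (𝓝 0))
    (hβ : Tendsto T (𝓝[<] β) (𝓝 0)) : 0 ≤ ∫ x in Ioo α β, Q x := by
  have h1 : Tendsto (Prod.fst : ℝ × ℝ → ℝ) (𝓝[>] α ×ˢ 𝓝[<] β) (𝓝 α) :=
    tendsto_fst.mono_right nhdsWithin_le_nhds
  have h2 : Tendsto (Prod.snd : ℝ × ℝ → ℝ) (𝓝[>] α ×ˢ 𝓝[<] β) (𝓝 β) :=
    tendsto_snd.mono_right nhdsWithin_le_nhds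
  refine setIntegral_nonneg_of_deriv_le_of_aecover (aecover_Ioo_of_Ioc h1 h2) ?_ hQ hT hle
    (by simpa using (hβ.comp tendsto_snd).sub (hα.comp tendsto_fst))
  filter_upwards [h1.eventually_lt h2 hαβ,
    (eventually_mem_nhdsWithin (a := α) (s := Ioi α)).prod_mk
      (eventually_mem_nhdsWithin (a := β) (s := Iio β))] with p hp hp'
  exact ⟨hp.le, fun x hx => ⟨lt_of_lt_of_le hp'.1 hx.1, lt_of_le_of_lt hx.2 hp'.2⟩⟩

theorem setIntegral_Ioi_nonneg_of_deriv_le {α : ℝ} {Q T T' : ℝ → ℝ}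
    (hQ : IntegrableOn Q (Ioi α)) (hT : ∀ x ∈ Ioi α, HasDerivAt T (T' x) x)
    (hle : ∀ x ∈ Ioi α, T' x ≤ Q x) (hα : Tendsto T (𝓝[>] α) (𝓝 0))
    (hβ : Tendsto T atTop (𝓝 0)) : 0 ≤ ∫ x in Ioi α, Q x := by
  have h1 : Tendsto (Prod.fst : ℝ × ℝ → ℝ) (𝓝[>] α ×ˢ atTop) (𝓝 α) :=
    tendsto_fst.mono_right nhdsWithin_le_nhds
  have h2 : Tendsto (Prod.snd : ℝ × ℝ → ℝ) (𝓝[>] α ×ˢ atTop) atTop := tendsto_snd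
  refine setIntegral_nonneg_of_deriv_le_of_aecover (l := 𝓝[>] α ×ˢ atTop)
    (a := Prod.fst) (b := Prod.snd)
    ((aecover_Ioi_of_Ioi h1).inter ((aecover_Iic h2).mono Measure.restrict_le_self)) ?_ hQ hT hle
    (by simpa using (hβ.comp tendsto_snd).sub (hα.comp tendsto_fst))
  filter_upwards [h1.eventually (eventually_lt_nhds (lt_add_one α)),
    h2.eventually (eventually_ge_atTop (α + 1)),
    (eventually_mem_nhdsWithin (a := α) (s := Ioi α)).prod_inl (atTop : Filter ℝ)]
    with p hp hp' hp''
  exact ⟨hp.le.trans hp', fun x hx => lt_of_lt_of_le hp'' hx.1⟩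

end Barrier

/-! ### Gaussian Poincaré inequality on the line -/

section Gaussian

theorem integrable_of_sq_bound {f : ℝ → ℝ} {C : ℝ} (hf : Measurable f)
    (h : ∀ s, |f s| ≤ C * (1 + |s|) ^ 2) :
    Integrable fun s => f s * Real.exp (-(s ^ 2 / 2)) := by
  have e0 : Integrable fun s : ℝ => Real.exp (-(1 / 2) * s ^ 2) :=
    integrable_exp_neg_mul_sq (by norm_num)
  have e2 : Integrable fun s : ℝ => s ^ (2 : ℝ) * Real.exp (-(1 / 2) * s ^ 2) :=
    integrable_rpow_mul_exp_neg_mul_sq (by norm_num) (by norm_num)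
  refine Integrable.mono' (((e0.add e2).const_mul (2 * C)))
    (by fun_prop) (.of_forall fun s => ?_)
  have he : -(1 / 2) * s ^ 2 = -(s ^ 2 / 2) := by ring
  have hp := Real.exp_pos (-(s ^ 2 / 2))
  have hC : 0 ≤ C := by
    have := (abs_nonneg _).trans (h 0); simpa using this
  simp only [Pi.add_apply, Real.rpow_two, he]
  rw [Real.norm_eq_abs, abs_mul, abs_of_pos hp]
  have h1 : |f s| ≤ 2 * C * (1 + s ^ 2) := by
    refine (h s).trans ?_
    have := sq_abs s
    nlinarith [sq_nonneg (1 - |s|)]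
  calc _ ≤ 2 * C * (1 + s ^ 2) * Real.exp (-(s ^ 2 / 2)) := by gcongr
    _ = _ := by ring

/-- The function s vanishes at 0 and solves -(e^{-s²/2} y')' = e^{-s²/2} y. With g = f - f 0 the
corresponding barrier is T = g² e^{-s²/2}/s, and integrand minus T' equals e^{-s²/2} (g' - g/s)².
The Lipschitz bound |g| ≤ C s makes T vanish at both ends. -/
theorem gaussian_hardy_Ioi {f f' : ℝ → ℝ} {C : ℝ} (hf : ∀ s, HasDerivAt f (f' s) s)
    (hf' : Measurable f') (hC : ∀ s, |f' s| ≤ C) :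
    ∫ s in Ioi 0, (f s - f 0) ^ 2 * Real.exp (-(s ^ 2 / 2)) ≤
      ∫ s in Ioi 0, f' s ^ 2 * Real.exp (-(s ^ 2 / 2)) := by
  have hC0 : 0 ≤ C := (abs_nonneg _).trans (hC 0)
  have hfc : Continuous f := continuous_iff_continuousAt.2 fun s => (hf s).continuousAt
  have hlip : ∀ s, |f s - f 0| ≤ C * |s| := fun s => by
    have := Convex.norm_image_sub_le_of_norm_hasDerivWithin_le (f := f) (f' := f') (C := C)
      (s := univ) (x := 0) (y := s) (fun x _ => (hf x).hasDerivWithinAt) (fun x _ => hC x)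
      convex_univ (mem_univ _) (mem_univ _)
    simpa using this
  have i1 : Integrable fun s => f' s ^ 2 * Real.exp (-(s ^ 2 / 2)) :=
    integrable_of_sq_bound (C := C ^ 2) (hf'.pow_const 2) fun s => by
      rw [abs_pow]
      calc |f' s| ^ 2 ≤ C ^ 2 * 1 := by rw [mul_one]; exact pow_le_pow_left₀ (abs_nonneg _) (hC s) 2
        _ ≤ _ := by gcongr; exact one_le_pow₀ (by linarith [abs_nonneg s])
  have i2 : Integrable fun s => (f s - f 0) ^ 2 * Real.exp (-(s ^ 2 / 2)) :=
    integrable_of_sq_bound (C := C ^ 2) ((hfc.measurable.sub_const _).pow_const 2) fun s => by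
      rw [abs_pow, ← mul_pow]
      exact pow_le_pow_left₀ (abs_nonneg _) ((hlip s).trans (by gcongr; linarith)) 2
  have key := setIntegral_Ioi_nonneg_of_deriv_le (α := 0)
    (Q := fun s => f' s ^ 2 * Real.exp (-(s ^ 2 / 2)) - (f s - f 0) ^ 2 * Real.exp (-(s ^ 2 / 2)))
    (T := fun s => (f s - f 0) ^ 2 * Real.exp (-(s ^ 2 / 2)) / s)
    (T' := fun s => ((2 * (f s - f 0) * f' s * Real.exp (-(s ^ 2 / 2)) +
      (f s - f 0) ^ 2 * (Real.exp (-(s ^ 2 / 2)) * (-s))) * s -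
      (f s - f 0) ^ 2 * Real.exp (-(s ^ 2 / 2))) / s ^ 2)
    (i1.sub i2).integrableOn ?_ ?_ ?_ ?_
  · rw [integral_sub i1.integrableOn i2.integrableOn] at key
    linarith
  · intro s hs
    have h1 : HasDerivAt (fun s => (f s - f 0) ^ 2) (2 * (f s - f 0) * f' s) s := by
      simpa using ((hf s).sub_const (f 0)).fun_pow 2
    have h2 : HasDerivAt (fun s : ℝ => Real.exp (-(s ^ 2 / 2)))
        (Real.exp (-(s ^ 2 / 2)) * (-s)) s := by
      refine ((((hasDerivAt_id' s).fun_pow 2).div_const 2).fun_neg).exp.congr_deriv ?_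
      simp
    refine ((h1.fun_mul h2).fun_div (hasDerivAt_id' s) (ne_of_gt hs)).congr_deriv ?_
    simp only [mul_one]
  · intro s hs
    have hs' : (0 : ℝ) < s := hs
    have hp := Real.exp_pos (-(s ^ 2 / 2))
    set e := Real.exp (-(s ^ 2 / 2))
    rw [div_le_iff₀ (by positivity)]
    have : 0 ≤ e * (f' s * s - (f s - f 0)) ^ 2 := by positivity
    nlinarith
  · have hb : ∀ s ∈ Ioi (0 : ℝ), ‖(f s - f 0) ^ 2 * Real.exp (-(s ^ 2 / 2)) / s‖ ≤ C ^ 2 * s := by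
      intro s hs
      have hs' : (0 : ℝ) < s := hs
      have h1 : Real.exp (-(s ^ 2 / 2)) ≤ 1 := Real.exp_le_one_iff.2 (by nlinarith)
      rw [Real.norm_eq_abs, abs_of_nonneg (by positivity), div_le_iff₀ hs']
      calc (f s - f 0) ^ 2 * Real.exp (-(s ^ 2 / 2)) ≤ (C * |s|) ^ 2 * 1 := by
            rw [← sq_abs]; gcongr; exact hlip s
        _ = _ := by rw [mul_pow, sq_abs]; ring
    refine squeeze_zero_norm' (eventually_mem_nhdsWithin.mono hb) ?_
    have : Tendsto (fun s : ℝ => C ^ 2 * s) (𝓝 0) (𝓝 (C ^ 2 * 0)) :=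
      (continuous_const.mul continuous_id).tendsto _
    rw [mul_zero] at this
    exact this.mono_left nhdsWithin_le_nhds
  · have hb : ∀ s ∈ Ioi (0 : ℝ), ‖(f s - f 0) ^ 2 * Real.exp (-(s ^ 2 / 2)) / s‖ ≤
        2 * C ^ 2 * s⁻¹ := by
      intro s hs
      have hs' : (0 : ℝ) < s := hs
      have h1 : Real.exp (-(s ^ 2 / 2)) * s ^ 2 ≤ 2 := by
        have h2 := Real.add_one_le_exp (s ^ 2 / 2)
        have h3 : Real.exp (-(s ^ 2 / 2)) * Real.exp (s ^ 2 / 2) = 1 := by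
          rw [← Real.exp_add]; simp
        have hp := Real.exp_pos (-(s ^ 2 / 2))
        nlinarith
      rw [Real.norm_eq_abs, abs_of_nonneg (by positivity), ← div_eq_mul_inv]
      refine div_le_div_of_nonneg_right ?_ hs'.le
      calc (f s - f 0) ^ 2 * Real.exp (-(s ^ 2 / 2)) ≤ (C * |s|) ^ 2 * Real.exp (-(s ^ 2 / 2)) := by
            rw [← sq_abs]; gcongr; exact hlip s
        _ = C ^ 2 * (Real.exp (-(s ^ 2 / 2)) * s ^ 2) := by rw [mul_pow, sq_abs]; ring
        _ ≤ C ^ 2 * 2 := by gcongr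
        _ = _ := by ring
    refine squeeze_zero_norm' ((eventually_gt_atTop 0).mono hb) ?_
    have : Tendsto (fun s : ℝ => 2 * C ^ 2 * s⁻¹) atTop (𝓝 (2 * C ^ 2 * 0)) :=
      tendsto_const_nhds.mul tendsto_inv_atTop_zero
    simpa using this

/-- One-dimensional Gaussian Poincaré inequality. -/
theorem gaussianReal_poincare {f f' : ℝ → ℝ} {C : ℝ} (hf : ∀ s, HasDerivAt f (f' s) s)
    (hf' : Measurable f') (hC : ∀ s, |f' s| ≤ C) :
    ∫ s, (f s - ∫ t, f t ∂gaussianReal 0 1) ^ 2 ∂gaussianReal 0 1 ≤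
      ∫ s, f' s ^ 2 ∂gaussianReal 0 1 := by
  have hC0 : 0 ≤ C := (abs_nonneg _).trans (hC 0)
  have hfc : Continuous f := continuous_iff_continuousAt.2 fun s => (hf s).continuousAt
  have hlip : ∀ s, |f s - f 0| ≤ C * |s| := fun s => by
    have := Convex.norm_image_sub_le_of_norm_hasDerivWithin_le (f := f) (f' := f') (C := C)
      (s := univ) (x := 0) (y := s) (fun x _ => (hf x).hasDerivWithinAt) (fun x _ => hC x)
      convex_univ (mem_univ _) (mem_univ _)
    simpa using this
  have hpdf : ∀ s, gaussianPDFReal 0 1 s = (√(2 * Real.pi))⁻¹ * Real.exp (-(s ^ 2 / 2)) := by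
    intro s; simp [gaussianPDFReal, neg_div]
  have hconv : ∀ g : ℝ → ℝ, ∫ s, g s ∂gaussianReal 0 1 =
      (√(2 * Real.pi))⁻¹ * ∫ s, g s * Real.exp (-(s ^ 2 / 2)) := by
    intro g
    rw [integral_gaussianReal_eq_integral_smul one_ne_zero, ← integral_const_mul]
    congr 1; ext s; rw [hpdf, smul_eq_mul]; ring
  have hint : ∀ {g : ℝ → ℝ}, Integrable (fun s => g s * Real.exp (-(s ^ 2 / 2))) →
      Integrable g (gaussianReal 0 1) := by
    intro g hg
    rw [gaussianReal_of_var_ne_zero _ one_ne_zero]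
    rw [integrable_withDensity_iff_integrable_smul' (measurable_gaussianPDF _ _)
      (.of_forall fun _ => gaussianPDF_lt_top)]
    refine (hg.const_mul (√(2 * Real.pi))⁻¹).congr (.of_forall fun s => ?_)
    simp only [toReal_gaussianPDF, hpdf, smul_eq_mul]; ring
  have i1 : Integrable fun s => f' s ^ 2 * Real.exp (-(s ^ 2 / 2)) :=
    integrable_of_sq_bound (C := C ^ 2) (hf'.pow_const 2) fun s => by
      rw [abs_pow]
      calc |f' s| ^ 2 ≤ C ^ 2 * 1 := by rw [mul_one]; exact pow_le_pow_left₀ (abs_nonneg _) (hC s) 2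
        _ ≤ _ := by gcongr; exact one_le_pow₀ (by linarith [abs_nonneg s])
  have i2 : Integrable fun s => (f s - f 0) ^ 2 * Real.exp (-(s ^ 2 / 2)) :=
    integrable_of_sq_bound (C := C ^ 2) ((hfc.measurable.sub_const _).pow_const 2) fun s => by
      rw [abs_pow, ← mul_pow]
      exact pow_le_pow_left₀ (abs_nonneg _) ((hlip s).trans (by gcongr; linarith)) 2
  have i3 : Integrable fun s => (f s - f 0) * Real.exp (-(s ^ 2 / 2)) :=
    integrable_of_sq_bound (C := C) (hfc.measurable.sub_const _) fun s =>
      (hlip s).trans (by gcongr; nlinarith [abs_nonneg s])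
  have split : ∀ {g : ℝ → ℝ}, Integrable g → ∫ s, g s = (∫ s in Ioi 0, g (-s)) + ∫ s in Ioi 0, g s := by
    intro g hg
    rw [integral_comp_neg_Ioi, neg_zero]
    exact (intervalIntegral.integral_Iic_add_Ioi hg.integrableOn hg.integrableOn).symm
  -- Centring at `f 0` instead of the mean decouples the two half-lines. The mean minimises the
  -- second moment, so passing back to it at the end only helps.
  have hmain : ∫ s, (f s - f 0) ^ 2 ∂gaussianReal 0 1 ≤ ∫ s, f' s ^ 2 ∂gaussianReal 0 1 := by
    rw [hconv, hconv]
    refine mul_le_mul_of_nonneg_left ?_ (by positivity)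
    rw [split i1, split i2]
    refine add_le_add ?_ (gaussian_hardy_Ioi hf hf' hC)
    have hneg : ∀ s, HasDerivAt (fun s => f (-s)) (-f' (-s)) s := fun s => by
      simpa [Function.comp_def] using (hf (-s)).comp s (hasDerivAt_neg s)
    have := gaussian_hardy_Ioi hneg (hf'.comp measurable_neg).neg (C := C)
      (fun s => by rw [abs_neg]; exact hC _)
    simpa using this
  have hshift := integral_sub_mean_sq (hint i3) (hint i2)
  have hfi : Integrable f (gaussianReal 0 1) := by
    refine ((hint i3).add (integrable_const (f 0))).congr (.of_forall fun s => ?_)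
    simp
  have hmean : ∫ t, (f t - f 0) ∂gaussianReal 0 1 = (∫ t, f t ∂gaussianReal 0 1) - f 0 := by
    rw [integral_sub hfi (integrable_const _)]; simp
  simp only [hmean, sub_sub_sub_cancel_right] at hshift
  nlinarith [sq_nonneg ((∫ t, f t ∂gaussianReal 0 1) - f 0)]

end Gaussian

end

section

open MeasureTheory ProbabilityTheory Set Filter Topology

/-! ### Euclidean polar coordinates -/

section PolarEuclidean

/-- The measure `s ^ k ds` on `(0, ∞)`. -/
noncomputable def radPow (k : ℕ) : Measure ℝ :=
  (volume.restrict (Ioi 0)).withDensity fun s => ENNReal.ofReal (s ^ k)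

instance (k : ℕ) : SFinite (radPow k) := by unfold radPow; infer_instance

theorem lintegral_radPow (k : ℕ) (g : ℝ → ENNReal) :
    ∫⁻ s, g s ∂radPow k = ∫⁻ s in Ioi 0, ENNReal.ofReal (s ^ k) * g s := by
  rw [radPow, lintegral_withDensity_eq_lintegral_mul_non_measurable]
  · rfl
  · fun_prop
  · simp

theorem integral_radPow (k : ℕ) (g : ℝ → ℝ) :
    ∫ s, g s ∂radPow k = ∫ s in Ioi 0, s ^ k * g s := by
  rw [radPow, integral_withDensity_eq_integral_toReal_smul₀ (by fun_prop) (by simp)]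
  refine setIntegral_congr_fun measurableSet_Ioi fun s hs => ?_
  have hs' : (0 : ℝ) < s := hs
  simp only [smul_eq_mul]
  rw [ENNReal.toReal_ofReal (by positivity)]

theorem ae_radPow_pos (k : ℕ) : ∀ᵐ s ∂radPow k, 0 < s :=
  (withDensity_absolutelyContinuous _ _).ae_le (ae_restrict_mem measurableSet_Ioi)

theorem measurePreserving_val_volumeIoiPow (k : ℕ) :
    MeasurePreserving (Subtype.val : Ioi (0 : ℝ) → ℝ) (Measure.volumeIoiPow k) (radPow k) := by
  refine ⟨measurable_subtype_coe, ?_⟩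
  ext s hs
  rw [Measure.map_apply measurable_subtype_coe hs, Measure.volumeIoiPow, radPow,
    withDensity_apply _ (measurable_subtype_coe hs), withDensity_apply _ hs,
    ← lintegral_indicator (measurable_subtype_coe hs), ← lintegral_indicator hs]
  have : ((Subtype.val : Ioi (0 : ℝ) → ℝ) ⁻¹' s).indicator
      (fun r : Ioi (0 : ℝ) => ENNReal.ofReal (r.1 ^ k)) =
      fun r : Ioi (0 : ℝ) => s.indicator (fun r => ENNReal.ofReal (r ^ k)) r.1 := by
    ext r; by_cases h : r.1 ∈ s <;> simp [h]
  rw [this, lintegral_subtype_comap measurableSet_Ioi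
    (f := fun r => s.indicator (fun r => ENNReal.ofReal (r ^ k)) r)]

variable {n : ℕ}

theorem measurePreserving_polar (hn : 0 < n) :
    MeasurePreserving (fun p : Metric.sphere (0 : EuclideanSpace ℝ (Fin n)) 1 × ℝ =>
      p.2 • (p.1 : EuclideanSpace ℝ (Fin n)))
      ((volume : Measure (EuclideanSpace ℝ (Fin n))).toSphere.prod (radPow (n - 1))) volume := by
  have : Nonempty (Fin n) := ⟨⟨0, hn⟩⟩
  set μ : Measure (EuclideanSpace ℝ (Fin n)) := volume
  have h1 := (μ.measurePreserving_homeomorphUnitSphereProd.symm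
    (homeomorphUnitSphereProd _).toMeasurableEquiv)
  have h2 : MeasurePreserving
      (Subtype.val : ({0}ᶜ : Set (EuclideanSpace ℝ (Fin n))) → _) (μ.comap (↑)) μ := by
    have := measurePreserving_subtype_coe (μa := μ)
      (s := ({0}ᶜ : Set (EuclideanSpace ℝ (Fin n)))) (measurableSet_singleton _).compl
    rwa [restrict_compl_singleton] at this
  have h3 := (MeasurePreserving.id μ.toSphere).prod (measurePreserving_val_volumeIoiPow (n - 1))
  have hd : Module.finrank ℝ (EuclideanSpace ℝ (Fin n)) = n := by simp
  rw [hd] at h1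
  have h4 := h2.comp h1
  refine ⟨by fun_prop, ?_⟩
  rw [← h3.map_eq, Measure.map_map (by fun_prop) h3.measurable]
  exact Eq.trans rfl h4.map_eq

end PolarEuclidean

/-! ### Gaussian Poincaré inequality in several variables -/

section GaussianPi

theorem pi_gaussianReal_eq_withDensity (n : ℕ) :
    (Measure.pi fun _ : Fin n => gaussianReal 0 1) =
      (volume : Measure (Fin n → ℝ)).withDensity
        fun y => ENNReal.ofReal (∏ i, gaussianPDFReal 0 1 (y i)) := by
  refine Measure.pi_eq fun s hs => ?_
  rw [withDensity_apply _ (MeasurableSet.univ_pi hs), volume_pi, Measure.restrict_pi_pi,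
    ← ofReal_integral_eq_lintegral_ofReal, integral_fintype_prod_eq_prod,
    ENNReal.ofReal_prod_of_nonneg]
  · refine Finset.prod_congr rfl fun i _ => ?_
    rw [gaussianReal_apply_eq_integral _ one_ne_zero]
  · exact fun i _ => integral_nonneg fun _ => gaussianPDFReal_nonneg _ _ _
  · exact Integrable.fintype_prod fun i => (integrable_gaussianPDFReal 0 1).integrableOn
  · exact .of_forall fun y => Finset.prod_nonneg fun i _ => gaussianPDFReal_nonneg _ _ _

/-- Replacing one coordinate by an independent copy does not change the law. It disintegrates an
integral along coordinate lines without reindexing. -/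
theorem measurePreserving_update {n : ℕ} {μ : Measure ℝ} [IsProbabilityMeasure μ] (i : Fin n) :
    MeasurePreserving (fun p : ℝ × (Fin n → ℝ) => Function.update p.2 i p.1)
      (μ.prod (Measure.pi fun _ => μ)) (Measure.pi fun _ => μ) := by
  refine ⟨measurable_update_pair i, (Measure.pi_eq fun s hs => ?_).symm⟩
  rw [Measure.map_apply (measurable_update_pair i) (MeasurableSet.univ_pi hs)]
  have : (fun p : ℝ × (Fin n → ℝ) => Function.update p.2 i p.1) ⁻¹' univ.pi s =
      s i ×ˢ univ.pi (Function.update s i univ) := by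
    ext p
    simp only [mem_preimage, mem_univ_pi, mem_prod]
    constructor
    · refine fun h => ⟨by simpa using h i, fun j => ?_⟩
      by_cases hj : j = i
      · subst hj; simp
      · simpa [hj] using h j
    · rintro ⟨h1, h2⟩ j
      by_cases hj : j = i
      · subst hj; simpa using h1
      · simpa [hj] using h2 j
  rw [this, Measure.prod_prod, Measure.pi_pi, ← Finset.mul_prod_erase _ _ (Finset.mem_univ i),
    ← Finset.mul_prod_erase _ (fun j => μ (s j)) (Finset.mem_univ i)]
  simp only [Function.update_self, measure_univ, one_mul]
  congr 1
  exact Finset.prod_congr rfl fun j hj => by rw [Function.update_of_ne (Finset.ne_of_mem_erase hj)]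

theorem integral_eq_integral_update {n : ℕ} {μ : Measure ℝ} [IsProbabilityMeasure μ] (i : Fin n)
    {G : (Fin n → ℝ) → ℝ} (hG : Integrable G (Measure.pi fun _ => μ)) :
    Integrable (fun y => ∫ s, G (Function.update y i s) ∂μ) (Measure.pi fun _ => μ) ∧
    ∫ y, G y ∂(Measure.pi fun _ => μ) =
      ∫ y, ∫ s, G (Function.update y i s) ∂μ ∂(Measure.pi fun _ => μ) := by
  have h := measurePreserving_update (μ := μ) i
  have hi : Integrable (fun p : ℝ × (Fin n → ℝ) => G (Function.update p.2 i p.1))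
      (μ.prod (Measure.pi fun _ => μ)) := h.integrable_comp_of_integrable hG
  refine ⟨hi.integral_prod_right, ?_⟩
  rw [← integral_prod_symm _ hi]
  conv_lhs => rw [← h.map_eq]
  rw [integral_map h.measurable.aemeasurable]
  rw [h.map_eq]; exact hG.aestronglyMeasurable

/-- Gaussian Poincaré inequality for centred functions which are `C¹` along almost all coordinate
lines. -/
theorem gaussian_poincare_pi {n : ℕ} {f : (Fin n → ℝ) → ℝ} {D : Fin n → (Fin n → ℝ) → ℝ} {C : ℝ}
    (hf : ProdBounded (fun s => 1 + |s|) f) (hD : ∀ i, Measurable (D i))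
    (hDC : ∀ i y, |D i y| ≤ C)
    (hderiv : ∀ i, ∀ᵐ y ∂(Measure.pi fun _ : Fin n => gaussianReal 0 1), ∀ s,
      HasDerivAt (fun s => f (Function.update y i s)) (D i (Function.update y i s)) s)
    (h0 : ∫ y, f y ∂(Measure.pi fun _ => gaussianReal 0 1) = 0) :
    ∫ y, f y ^ 2 ∂(Measure.pi fun _ => gaussianReal 0 1) ≤
      ∫ y, ∑ i, D i y ^ 2 ∂(Measure.pi fun _ => gaussianReal 0 1) := by
  have hb : MemLp (fun s : ℝ => 1 + |s|) 2 (gaussianReal 0 1) := by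
    have h : MemLp (id : ℝ → ℝ) 2 (gaussianReal 0 1) := by
      exact_mod_cast memLp_id_gaussianReal (μ := 0) (v := 1) 2
    exact (memLp_const (1 : ℝ)).add h.norm
  have hb1 : ∀ s : ℝ, 1 ≤ 1 + |s| := fun s => by linarith [abs_nonneg s]
  have hDi : ∀ i, Integrable (fun y => D i y ^ 2) (Measure.pi fun _ => gaussianReal 0 1) :=
    fun i => Integrable.of_bound ((hD i).pow_const 2).aestronglyMeasurable (C ^ 2)
      (.of_forall fun y => by
        rw [Real.norm_eq_abs, abs_pow]; exact pow_le_pow_left₀ (abs_nonneg _) (hDC i y) 2)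
  refine (integral_sq_le_sum_variance hb1 hb hf h0).trans ?_
  rw [integral_finsetSum _ fun i _ => hDi i]
  refine Finset.sum_le_sum fun i _ => ?_
  -- On a line in direction `i` the Efron–Stein term is the variance of a function of one variable,
  -- to which the inequality on the line applies.
  have r1 := integral_eq_integral_update i ((hf.sub (hf.integral_update hb1 hb i)).integrable_sq hb)
  have r2 := integral_eq_integral_update i (hDi i)
  rw [r1.2, r2.2]
  refine integral_mono_ae r1.1 r2.1 ?_
  filter_upwards [hderiv i] with y hy
  simp only [Function.update_idem]
  exact gaussianReal_poincare hy ((hD i).comp (measurable_update y)) (fun s => hDC i _)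

end GaussianPi

end

section

open MeasureTheory ProbabilityTheory Set Filter Topology

/-! ### Sharp Poincaré inequality on the Euclidean sphere -/

section SpherePoincare

variable {n : ℕ}

theorem one_add_sum_le_prod_one_add {ι : Type*} (s : Finset ι) {a : ι → ℝ} (h : ∀ i, 0 ≤ a i) :
    1 + ∑ i ∈ s, a i ≤ ∏ i ∈ s, (1 + a i) := by
  classical
  induction s using Finset.induction_on with
  | empty => simp
  | insert i s hi ih =>
    rw [Finset.sum_insert hi, Finset.prod_insert hi]
    have h1 := h i
    have h2 : 0 ≤ ∑ i ∈ s, a i := Finset.sum_nonneg fun i _ => h i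
    nlinarith

/-- Places functions of linear growth in the class `ProdBounded` with `b s = 1 + |s|`. -/
theorem norm_le_prod_one_add (x : EuclideanSpace ℝ (Fin n)) : ‖x‖ ≤ ∏ i, (1 + |x i|) := by
  have h0 : 0 ≤ ∏ i, (1 + |x i|) := Finset.prod_nonneg fun i _ => by positivity
  refine abs_le_of_sq_le_sq' ?_ h0 |>.2
  rw [EuclideanSpace.norm_sq_eq, ← Finset.prod_pow]
  simp only [Real.norm_eq_abs]
  have := one_add_sum_le_prod_one_add Finset.univ (a := fun i => |x i| ^ 2) fun i => by positivity
  have h2 : ∏ i, (1 + |x i| ^ 2) ≤ ∏ i, (1 + |x i|) ^ 2 :=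
    Finset.prod_le_prod (fun i _ => by positivity) fun i _ => by nlinarith [abs_nonneg (x i)]
  linarith

/-- Integration in polar coordinates against the standard Gaussian measure. -/
theorem integral_pi_gaussianReal_polar (hn : 0 < n) :
    ∃ c : ℝ, 0 < c ∧ ∀ (g : EuclideanSpace ℝ (Fin n) → ℝ), Measurable g →
      ∀ (a : ℝ → ℝ) (H : Metric.sphere (0 : EuclideanSpace ℝ (Fin n)) 1 → ℝ),
      (∀ ω : Metric.sphere (0 : EuclideanSpace ℝ (Fin n)) 1, ∀ s : ℝ, 0 < s →
        g (s • (ω : EuclideanSpace ℝ (Fin n))) = a s * H ω) →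
      ∫ y, g (WithLp.toLp 2 y) ∂(Measure.pi fun _ : Fin n => gaussianReal 0 1) =
        c * ((∫ ω, H ω ∂(volume : Measure (EuclideanSpace ℝ (Fin n))).toSphere) *
          ∫ s in Ioi 0, s ^ (n - 1) * (a s * Real.exp (-(s ^ 2 / 2)))) := by
  -- The constant is the Gaussian normalisation. It does not depend on `g`, `a`, `H`, hence cancels
  -- when two such integrals are compared.
  refine ⟨((√(2 * Real.pi))⁻¹) ^ n, by positivity, fun g hg a H hgH => ?_⟩
  have hpdf : ∀ y : Fin n → ℝ, ∏ i, gaussianPDFReal 0 1 (y i) =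
      ((√(2 * Real.pi))⁻¹) ^ n * Real.exp (-(‖WithLp.toLp 2 y‖ ^ 2 / 2)) := by
    intro y
    have : ∀ s, gaussianPDFReal 0 1 s = (√(2 * Real.pi))⁻¹ * Real.exp (-(s ^ 2 / 2)) := by
      intro s; simp [gaussianPDFReal, neg_div]
    simp_rw [this]
    rw [Finset.prod_mul_distrib, ← Real.exp_sum, EuclideanSpace.norm_sq_eq]
    simp [Finset.sum_div]
  rw [pi_gaussianReal_eq_withDensity, integral_withDensity_eq_integral_toReal_smul₀]
  rotate_left
  · refine Measurable.aemeasurable (Measurable.ennreal_ofReal ?_)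
    exact Finset.measurable_prod _ fun i _ =>
      (measurable_gaussianPDFReal 0 1).comp (measurable_pi_apply i)
  · simp
  have e1 : ∀ y : Fin n → ℝ,
      (ENNReal.ofReal (∏ i, gaussianPDFReal 0 1 (y i))).toReal • g (WithLp.toLp 2 y) =
      (fun x : EuclideanSpace ℝ (Fin n) =>
        ((√(2 * Real.pi))⁻¹) ^ n * (g x * Real.exp (-(‖x‖ ^ 2 / 2)))) (WithLp.toLp 2 y) := by
    intro y
    rw [ENNReal.toReal_ofReal (Finset.prod_nonneg fun i _ => gaussianPDFReal_nonneg _ _ _), hpdf,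
      smul_eq_mul]
    ring
  rw [integral_congr_ae (.of_forall e1), (PiLp.volume_preserving_toLp (Fin n)).integral_comp
    (MeasurableEquiv.toLp 2 (Fin n → ℝ)).measurableEmbedding (fun x : EuclideanSpace ℝ (Fin n) =>
        ((√(2 * Real.pi))⁻¹) ^ n * (g x * Real.exp (-(‖x‖ ^ 2 / 2)))), integral_const_mul]
  congr 1
  have hmp := measurePreserving_polar hn
  conv_lhs => rw [← hmp.map_eq]
  rw [integral_map hmp.measurable.aemeasurable
    (by exact Measurable.aestronglyMeasurable (by fun_prop)), ← integral_radPow,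
    ← integral_prod_mul]
  refine integral_congr_ae ?_
  have hp : ∀ᵐ p ∂((volume : Measure (EuclideanSpace ℝ (Fin n))).toSphere.prod (radPow (n - 1))),
      0 < p.2 := Measure.quasiMeasurePreserving_snd.ae (ae_radPow_pos _)
  filter_upwards [hp] with p hp
  rw [hgH _ _ hp, norm_smul, Real.norm_of_nonneg hp.le, norm_eq_of_mem_sphere, mul_one]
  ring

/-- The mean of |x|² under the Gaussian measure is n, read off from Γ(n/2 + 1) = (n/2) Γ(n/2). This
factor n turns the Gaussian constant 1 into the spherical constant n - 1. -/
theorem integral_radial_gaussian_succ (hn : 0 < n) :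
    0 < ∫ s in Ioi (0 : ℝ), s ^ (n - 1) * (1 * Real.exp (-(s ^ 2 / 2))) ∧
    ∫ s in Ioi (0 : ℝ), s ^ (n - 1) * (s ^ 2 * Real.exp (-(s ^ 2 / 2))) =
      n * ∫ s in Ioi (0 : ℝ), s ^ (n - 1) * (1 * Real.exp (-(s ^ 2 / 2))) := by
  have key : ∀ q : ℝ, -1 < q → ∫ s in Ioi (0 : ℝ), s ^ q * Real.exp (-(1 / 2) * s ^ (2 : ℝ)) =
      (1 / 2 : ℝ) ^ (-(q + 1) / 2) * (1 / 2) * Real.Gamma ((q + 1) / 2) := fun q hq =>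
    integral_rpow_mul_exp_neg_mul_rpow (by norm_num) hq (by norm_num)
  have hn' : (0 : ℝ) < n := by exact_mod_cast hn
  have e1 : ∫ s in Ioi (0 : ℝ), s ^ (n - 1) * (1 * Real.exp (-(s ^ 2 / 2))) =
      (1 / 2 : ℝ) ^ (-(n : ℝ) / 2) * (1 / 2) * Real.Gamma ((n : ℝ) / 2) := by
    have := key ((n : ℝ) - 1) (by linarith)
    rw [sub_add_cancel] at this
    rw [← this]
    refine setIntegral_congr_fun measurableSet_Ioi fun s hs => ?_
    rw [one_mul, Real.rpow_two, ← Real.rpow_natCast s (n - 1), Nat.cast_sub hn, Nat.cast_one]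
    congr 2; ring
  have e2 : ∫ s in Ioi (0 : ℝ), s ^ (n - 1) * (s ^ 2 * Real.exp (-(s ^ 2 / 2))) =
      (1 / 2 : ℝ) ^ (-((n : ℝ) + 2) / 2) * (1 / 2) * Real.Gamma (((n : ℝ) + 2) / 2) := by
    have := key ((n : ℝ) + 1) (by linarith)
    rw [add_assoc, one_add_one_eq_two] at this
    rw [← this]
    refine setIntegral_congr_fun measurableSet_Ioi fun s hs => ?_
    rw [← mul_assoc, ← pow_add, Real.rpow_two, ← Real.rpow_natCast s, Nat.cast_add,
      Nat.cast_sub hn]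
    congr 2
    · push_cast; ring
    · ring
  have e3 : Real.Gamma (((n : ℝ) + 2) / 2) = (n : ℝ) / 2 * Real.Gamma ((n : ℝ) / 2) := by
    rw [← Real.Gamma_add_one (by positivity)]; congr 1; ring
  have e4 : (1 / 2 : ℝ) ^ (-((n : ℝ) + 2) / 2) = 2 * (1 / 2 : ℝ) ^ (-(n : ℝ) / 2) := by
    rw [show -((n : ℝ) + 2) / 2 = -(n : ℝ) / 2 + (-1) by ring, Real.rpow_add (by norm_num)]
    rw [Real.rpow_neg_one]; norm_num; ring
  rw [e1, e2, e3, e4]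
  refine ⟨?_, by ring⟩
  have := Real.Gamma_pos_of_pos (show 0 < (n : ℝ) / 2 by positivity)
  positivity

/-- Orthogonal splitting, at a unit vector, of the gradient of a function homogeneous of degree one:
its value `V` is the radial derivative, and the rest is the tangential part of `L`. -/
theorem sum_sq_sub_mul_coord (x : EuclideanSpace ℝ (Fin n)) (hx : ‖x‖ = 1)
    (L : EuclideanSpace ℝ (Fin n) →L[ℝ] ℝ) (V : ℝ) :
    ∑ i, (x i * V + L (EuclideanSpace.single i 1 - x i • x)) ^ 2 =
      V ^ 2 + (∑ i, L (EuclideanSpace.single i 1) ^ 2 - L x ^ 2) := by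
  have h1 : ∑ i, x i ^ 2 = 1 := by
    have := EuclideanSpace.norm_sq_eq x
    simp only [Real.norm_eq_abs, sq_abs, hx] at this
    linarith
  have h2 : ∑ i, x i * L (EuclideanSpace.single i 1) = L x := by
    have hs : x = ∑ i, x i • EuclideanSpace.single i (1 : ℝ) := by
      have := ((EuclideanSpace.basisFun (Fin n) ℝ).sum_repr x).symm
      simpa using this
    conv_rhs => rw [hs, map_sum]
    simp
  have : ∀ i, (x i * V + L (EuclideanSpace.single i 1 - x i • x)) ^ 2 =
      (V - L x) ^ 2 * x i ^ 2 + 2 * (V - L x) * (x i * L (EuclideanSpace.single i 1)) +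
        L (EuclideanSpace.single i 1) ^ 2 := by
    intro i; rw [map_sub, map_smul, smul_eq_mul]; ring
  simp_rw [this]
  rw [Finset.sum_add_distrib, Finset.sum_add_distrib, ← Finset.mul_sum, ← Finset.mul_sum, h1, h2]
  ring

theorem hasDerivAt_norm_mul_comp_normalize {h : EuclideanSpace ℝ (Fin n) → ℝ}
    (hh : Differentiable ℝ h) (A : ℝ) {x : ℝ → EuclideanSpace ℝ (Fin n)}
    {e : EuclideanSpace ℝ (Fin n)} {s : ℝ} (hx : HasDerivAt x e s) (h0 : x s ≠ 0) :
    HasDerivAt (fun s => ‖x s‖ * (h (‖x s‖⁻¹ • x s) - A))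
      (inner ℝ (‖x s‖⁻¹ • x s) e * (h (‖x s‖⁻¹ • x s) - A) +
        fderiv ℝ h (‖x s‖⁻¹ • x s) (e - inner ℝ (‖x s‖⁻¹ • x s) e • (‖x s‖⁻¹ • x s))) s := by
  have hN : ‖x s‖ ≠ 0 := norm_ne_zero_iff.2 h0
  have h1 : HasDerivAt (fun s => ‖x s‖) (inner ℝ (‖x s‖⁻¹ • x s) e) s := by
    have := hx.norm_sq.sqrt (pow_ne_zero 2 hN)
    simp only [Real.sqrt_sq (norm_nonneg _)] at this
    refine this.congr_deriv ?_
    rw [real_inner_smul_left]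
    field_simp
  have h2 : HasDerivAt (fun s => ‖x s‖⁻¹ • x s)
      (‖x s‖⁻¹ • (e - inner ℝ (‖x s‖⁻¹ • x s) e • (‖x s‖⁻¹ • x s))) s := by
    refine ((h1.fun_inv hN).fun_smul hx).congr_deriv ?_
    rw [smul_sub, smul_smul, smul_smul]
    have : -inner ℝ (‖x s‖⁻¹ • x s) e / ‖x s‖ ^ 2 =
      -(‖x s‖⁻¹ * (inner ℝ (‖x s‖⁻¹ • x s) e * ‖x s‖⁻¹)) := by field_simp
    rw [this, neg_smul, sub_eq_add_neg, mul_assoc]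
  have h3 := ((hh _).hasFDerivAt.comp_hasDerivAt s h2).sub_const A
  refine (h1.fun_mul h3).congr_deriv ?_
  rw [map_smul, smul_eq_mul]
  simp only [Function.comp_def]
  field_simp

/-- Sharp Poincaré inequality on the unit sphere of `ℝⁿ`. -/
theorem sphere_poincare (hn : 2 ≤ n) {h : EuclideanSpace ℝ (Fin n) → ℝ} (hh : ContDiff ℝ 1 h)
    {A : ℝ} (hA : ∫ ω : Metric.sphere (0 : EuclideanSpace ℝ (Fin n)) 1, (h ω - A)
      ∂(volume : Measure (EuclideanSpace ℝ (Fin n))).toSphere = 0) :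
    ((n : ℝ) - 1) * ∫ ω : Metric.sphere (0 : EuclideanSpace ℝ (Fin n)) 1, (h ω - A) ^ 2
      ∂(volume : Measure (EuclideanSpace ℝ (Fin n))).toSphere ≤
    ∫ ω : Metric.sphere (0 : EuclideanSpace ℝ (Fin n)) 1,
      (∑ i, fderiv ℝ h ω (EuclideanSpace.single i 1) ^ 2 - fderiv ℝ h ω ω ^ 2)
      ∂(volume : Measure (EuclideanSpace ℝ (Fin n))).toSphere := by
  have hn0 : 0 < n := by omega
  have hd : Differentiable ℝ h := hh.differentiable (by norm_num)
  have hc : Continuous h := hh.continuous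
  have hdc : Continuous (fderiv ℝ h) := hh.continuous_fderiv (by norm_num)
  -- The extension of h - A homogeneous of degree one. Gaussian Poincaré for it reads n ∫ (h - A)² ≤
  -- ∫ (h - A)² + ∫ |∇_S h|² over the sphere. Nothing is lost, since linear functions are extremal
  -- for both inequalities.
  set F : EuclideanSpace ℝ (Fin n) → ℝ := fun x => ‖x‖ * (h (‖x‖⁻¹ • x) - A) with hF
  set D : Fin n → EuclideanSpace ℝ (Fin n) → ℝ := fun i x =>
    (‖x‖⁻¹ • x) i * (h (‖x‖⁻¹ • x) - A) +
      fderiv ℝ h (‖x‖⁻¹ • x) (EuclideanSpace.single i 1 - (‖x‖⁻¹ • x) i • (‖x‖⁻¹ • x)) with hD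
  have hball : ∀ x : EuclideanSpace ℝ (Fin n), ‖x‖⁻¹ • x ∈ Metric.closedBall 0 1 := by
    intro x
    rw [mem_closedBall_zero_iff, norm_smul, norm_inv, norm_norm]
    exact inv_mul_le_one
  have hmu : Measurable fun x : EuclideanSpace ℝ (Fin n) => ‖x‖⁻¹ • x := by fun_prop
  obtain ⟨K, hK⟩ := (isCompact_closedBall (0 : EuclideanSpace ℝ (Fin n)) 1).exists_bound_of_continuousOn
    (f := fun x => h x - A) (by fun_prop)
  have hDcont : ∀ i, Continuous fun x : EuclideanSpace ℝ (Fin n) => x i * (h x - A) +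
      fderiv ℝ h x (EuclideanSpace.single i 1 - x i • x) := by
    intro i
    refine Continuous.add (by fun_prop) (hdc.clm_apply (by fun_prop))
  have hDb : ∀ i, ∃ C, ∀ x ∈ Metric.closedBall (0 : EuclideanSpace ℝ (Fin n)) 1,
      ‖x i * (h x - A) + fderiv ℝ h x (EuclideanSpace.single i 1 - x i • x)‖ ≤ C := fun i =>
    (isCompact_closedBall _ _).exists_bound_of_continuousOn (hDcont i).continuousOn
  choose C hC using hDb
  have hFm : Measurable F := by
    have : Measurable fun x : EuclideanSpace ℝ (Fin n) => h (‖x‖⁻¹ • x) := hc.measurable.comp hmu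
    exact measurable_norm.mul (this.sub_const A)
  have hDm : ∀ i, Measurable (D i) := fun i => (hDcont i).measurable.comp hmu
  have hto : Measurable (WithLp.toLp 2 : (Fin n → ℝ) → EuclideanSpace ℝ (Fin n)) :=
    (MeasurableEquiv.toLp 2 (Fin n → ℝ)).measurable
  obtain ⟨c, hc0, hpol⟩ := integral_pi_gaussianReal_polar hn0
  have hnorm : ∀ (ω : Metric.sphere (0 : EuclideanSpace ℝ (Fin n)) 1) (s : ℝ), 0 < s →
      ‖s • (ω : EuclideanSpace ℝ (Fin n))‖ = s ∧
      ‖s • (ω : EuclideanSpace ℝ (Fin n))‖⁻¹ • (s • (ω : EuclideanSpace ℝ (Fin n))) = ω := by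
    intro ω s hs
    have : ‖s • (ω : EuclideanSpace ℝ (Fin n))‖ = s := by
      rw [norm_smul, norm_eq_of_mem_sphere, mul_one, Real.norm_of_nonneg hs.le]
    refine ⟨this, ?_⟩
    rw [this, smul_smul, inv_mul_cancel₀ hs.ne', one_smul]
  have k1 := hpol (fun x => F x ^ 2) (hFm.pow_const 2) (fun s => s ^ 2)
    (fun ω => (h ω - A) ^ 2) (fun ω s hs => by
      simp only [hF]; rw [(hnorm ω s hs).2, (hnorm ω s hs).1]; ring)
  have k2 := hpol (fun x => ∑ i, D i x ^ 2)
    (Finset.measurable_sum _ fun i _ => (hDm i).pow_const 2) (fun _ => 1)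
    (fun ω => (h ω - A) ^ 2 +
      (∑ i, fderiv ℝ h ω (EuclideanSpace.single i 1) ^ 2 - fderiv ℝ h ω ω ^ 2))
    (fun ω s hs => by
      simp only [hD]
      rw [(hnorm ω s hs).2, sum_sq_sub_mul_coord _ (norm_eq_of_mem_sphere ω), one_mul])
  have key := gaussian_poincare_pi (f := fun y => F (WithLp.toLp 2 y))
    (D := fun i y => D i (WithLp.toLp 2 y)) (C := ∑ i, |C i|)
    ⟨hFm.comp hto, |K|, abs_nonneg _, fun y => ?_⟩ (fun i => (hDm i).comp hto)
    (fun i y => ?_) (fun i => ?_) ?_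
  · rw [k1, k2, (integral_radial_gaussian_succ hn0).2] at key
    have hp := (integral_radial_gaussian_succ hn0).1
    set I := ∫ s in Ioi (0 : ℝ), s ^ (n - 1) * (1 * Real.exp (-(s ^ 2 / 2)))
    rw [integral_add] at key
    · have := le_of_mul_le_mul_left key hc0
      rw [← mul_assoc] at this
      have := le_of_mul_le_mul_right this hp
      linarith
    · exact (Continuous.integrable_of_hasCompactSupport (by fun_prop)
        (HasCompactSupport.of_compactSpace _))
    · refine (Continuous.integrable_of_hasCompactSupport ?_ (HasCompactSupport.of_compactSpace _))
      refine (continuous_finsetSum _ fun i _ => ?_).sub ?_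
      · exact ((hdc.comp continuous_subtype_val).clm_apply continuous_const).pow 2
      · exact ((hdc.comp continuous_subtype_val).clm_apply continuous_subtype_val).pow 2
  · simp only [hF]
    rw [abs_mul, abs_of_nonneg (norm_nonneg _), mul_comm]
    refine mul_le_mul ((hK _ (hball _)).trans (le_abs_self _)) ?_ (norm_nonneg _) (abs_nonneg _)
    exact norm_le_prod_one_add _
  · refine ((hC i _ (hball _)).trans (le_abs_self _)).trans ?_
    exact Finset.single_le_sum (f := fun i => |C i|) (fun i _ => abs_nonneg _) (Finset.mem_univ i)
  -- `F` need not be differentiable at the origin, but a line in direction `i` avoids the origin as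
  -- soon as some other coordinate `y j` is nonzero. Here n ≥ 2 enters.
  · have : Nontrivial (Fin n) := Fin.nontrivial_iff_two_le.2 hn
    obtain ⟨j, hj⟩ := exists_ne i
    have hne : ∀ᵐ y ∂(Measure.pi fun _ : Fin n => gaussianReal 0 1), y j ≠ 0 := by
      have : NullSingletonClass (gaussianReal 0 1) := nullSingletonClass_gaussianReal one_ne_zero
      exact (Measure.quasiMeasurePreserving_eval (fun _ => gaussianReal 0 1) j).ae
        (p := fun s => s ≠ 0) (by rw [ae_iff]; simp)
    filter_upwards [hne] with y hy s
    have hx : HasDerivAt (fun s => WithLp.toLp 2 (Function.update y i s))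
        (EuclideanSpace.single i (1 : ℝ)) s := by
      have h1 : HasDerivAt (fun s => Function.update y i s) (Pi.single i (1 : ℝ)) s :=
        hasDerivAt_update y i s
      exact (PiLp.continuousLinearEquiv 2 ℝ (fun _ : Fin n => ℝ)).symm.toContinuousLinearMap.hasFDerivAt.comp_hasDerivAt s h1
    have h0 : WithLp.toLp 2 (Function.update y i s) ≠ 0 := by
      intro h
      have := congrArg (fun x : EuclideanSpace ℝ (Fin n) => x j) h
      simp [Function.update_of_ne hj] at this
      exact hy this
    refine (hasDerivAt_norm_mul_comp_normalize hd A hx h0).congr_deriv ?_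
    simp only [hD, EuclideanSpace.inner_single_right]
    simp
  · rw [hpol F hFm (fun s => s) (fun ω => h ω - A) (fun ω s hs => by
      simp only [hF]; rw [(hnorm ω s hs).2, (hnorm ω s hs).1]), hA]
    simp

end SpherePoincare

end

section

open MeasureTheory ProbabilityTheory Set Filter Topology

namespace Grushin

/-! ### Polar coordinates adapted to the gauge -/

section PolarSpace

variable {n : ℕ}

/-- The anisotropic dilation `(x, t) ↦ (r x, r² t)`. -/
def dil (r : ℝ) (p : Space n) : Space n := (r • p.1, r ^ 2 * p.2)

/-- Angular variables `(ω, φ)`. -/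
abbrev Ang (n : ℕ) : Type := Metric.sphere (0 : EuclideanSpace ℝ (Fin n)) 1 × ℝ

/-- The point of the gauge sphere with angular variables `(ω, φ)`. -/
noncomputable def pol (θ : Ang n) : Space n :=
  (√(Real.sin θ.2) • (θ.1 : EuclideanSpace ℝ (Fin n)), Real.cos θ.2 / 2)

/-- The measure `sin(φ)^{(n - 2) / 2} / 2 dφ` on `(0, π)`. -/
noncomputable def polarAngle (n : ℕ) : Measure ℝ :=
  (volume.restrict (Ioo 0 Real.pi)).withDensity fun φ => ENNReal.ofReal (√(Real.sin φ) ^ (n - 2) / 2)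

noncomputable def angMeasure (n : ℕ) : Measure (Ang n) :=
  (volume : Measure (EuclideanSpace ℝ (Fin n))).toSphere.prod (polarAngle n)

theorem measurable_sqrt_sin_pow (k : ℕ) : Measurable fun φ : ℝ => √(Real.sin φ) ^ k :=
  ((Real.continuous_sqrt.comp Real.continuous_sin).pow k).measurable

theorem lintegral_polarAngle (g : ℝ → ENNReal) :
    ∫⁻ φ, g φ ∂polarAngle n =
      ∫⁻ φ in Ioo 0 Real.pi, ENNReal.ofReal (√(Real.sin φ) ^ (n - 2) / 2) * g φ := by
  rw [polarAngle, lintegral_withDensity_eq_lintegral_mul_non_measurable]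
  · rfl
  · exact ((measurable_sqrt_sin_pow _).div_const 2).ennreal_ofReal
  · simp

theorem integral_polarAngle (g : ℝ → ℝ) :
    ∫ φ, g φ ∂polarAngle n = ∫ φ in Ioo 0 Real.pi, √(Real.sin φ) ^ (n - 2) / 2 * g φ := by
  rw [polarAngle, integral_withDensity_eq_integral_toReal_smul₀
    ((measurable_sqrt_sin_pow _).div_const 2).ennreal_ofReal.aemeasurable (by simp)]
  refine setIntegral_congr_fun measurableSet_Ioo fun s hs => ?_
  simp only [smul_eq_mul]
  rw [ENNReal.toReal_ofReal (by positivity)]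

theorem ae_polarAngle_mem : ∀ᵐ φ ∂polarAngle n, φ ∈ Ioo 0 Real.pi :=
  (withDensity_absolutelyContinuous _ _).ae_le (ae_restrict_mem measurableSet_Ioo)

instance : IsFiniteMeasure (polarAngle n) := by
  refine isFiniteMeasure_withDensity_ofReal (Integrable.hasFiniteIntegral ?_)
  refine Integrable.of_bound (C := 1)
    ((measurable_sqrt_sin_pow _).div_const 2).aestronglyMeasurable (.of_forall fun φ => ?_)
  have h1 : √(Real.sin φ) ≤ 1 :=
    Real.sqrt_le_one.2 (Real.sin_le_one φ)
  have h2 := pow_le_one₀ (n := n - 2) (Real.sqrt_nonneg _) h1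
  rw [Real.norm_of_nonneg (by positivity)]
  linarith

instance : IsFiniteMeasure (angMeasure n) := by unfold angMeasure; infer_instance

theorem hasFDerivAt_polar_halfplane {p : ℝ × ℝ} (h : 0 < Real.sin p.1) :
    HasFDerivAt (fun p : ℝ × ℝ => (p.2 * √(Real.sin p.1), p.2 ^ 2 * (Real.cos p.1 / 2)))
      (Matrix.toLin (.finTwoProd ℝ) (.finTwoProd ℝ)
        !![p.2 * (Real.cos p.1 / (2 * √(Real.sin p.1))), √(Real.sin p.1);
          p.2 ^ 2 * (-Real.sin p.1 / 2), 2 * p.2 * (Real.cos p.1 / 2)]).toContinuousLinearMap p := by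
  rw [Matrix.toLin_finTwoProd_toContinuousLinearMap]
  have h1 := ((Real.hasDerivAt_sin p.1).sqrt h.ne').comp_hasFDerivAt p
    (hasFDerivAt_fst (𝕜 := ℝ) (p := p))
  have h2 := ((Real.hasDerivAt_cos p.1).div_const 2).comp_hasFDerivAt p
    (hasFDerivAt_fst (𝕜 := ℝ) (p := p))
  have h3 := (hasFDerivAt_snd (𝕜 := ℝ) (p := p) (E := ℝ) (F := ℝ)).pow 2
  refine ((hasFDerivAt_snd.mul h1).prodMk (h3.mul h2)).congr_fderiv ?_
  ext <;> simp [mul_comm, mul_left_comm]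

/-- Change of variables s = r √(sin φ), t = r² cos φ / 2 in the half-plane of (|x|, t): then s⁴ +
4t² = r⁴, and the Jacobian has modulus r² / (2 √(sin φ)). -/
theorem lintegral_halfplane (G : ℝ × ℝ → ENNReal) :
    ∫⁻ q in Ioi (0 : ℝ) ×ˢ univ, G q = ∫⁻ p in Ioo 0 Real.pi ×ˢ Ioi (0 : ℝ),
      ENNReal.ofReal (p.2 ^ 2 / (2 * √(Real.sin p.1))) *
        G (p.2 * √(Real.sin p.1), p.2 ^ 2 * (Real.cos p.1 / 2)) := by
  set Φ : ℝ × ℝ → ℝ × ℝ := fun p => (p.2 * √(Real.sin p.1), p.2 ^ 2 * (Real.cos p.1 / 2))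
  have hsin : ∀ p ∈ Ioo 0 Real.pi ×ˢ Ioi (0 : ℝ), 0 < Real.sin p.1 := fun p hp =>
    Real.sin_pos_of_pos_of_lt_pi hp.1.1 hp.1.2
  have hrad : ∀ p ∈ Ioo 0 Real.pi ×ˢ Ioi (0 : ℝ),
      (Φ p).1 ^ 4 + 4 * (Φ p).2 ^ 2 = p.2 ^ 4 := by
    intro p hp
    have h1 := Real.sq_sqrt (hsin p hp).le
    have h2 := Real.sin_sq_add_cos_sq p.1
    calc (p.2 * √(Real.sin p.1)) ^ 4 + 4 * (p.2 ^ 2 * (Real.cos p.1 / 2)) ^ 2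
        = p.2 ^ 4 * ((√(Real.sin p.1) ^ 2) ^ 2 + Real.cos p.1 ^ 2) := by ring
      _ = p.2 ^ 4 := by rw [h1, h2, mul_one]
  have himg : Φ '' (Ioo 0 Real.pi ×ˢ Ioi (0 : ℝ)) = Ioi (0 : ℝ) ×ˢ univ := by
    ext ⟨s, t⟩
    constructor
    · rintro ⟨p, hp, h⟩
      have := hsin p hp
      have h2 : (0 : ℝ) < p.2 := hp.2
      rw [← h]
      exact ⟨mul_pos h2 (Real.sqrt_pos.2 this), mem_univ _⟩
    · rintro ⟨hs, -⟩
      have hs' : (0 : ℝ) < s := hs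
      -- `N` is r⁴, so the preimage has r = √√N and cos φ = 2t/r².
      set N := s ^ 4 + 4 * t ^ 2 with hN
      have hN0 : 0 < N := by positivity
      have hq : (√N) ^ 2 = N := Real.sq_sqrt hN0.le
      have hq0 : 0 < √N := Real.sqrt_pos.2 hN0
      have hc1 : (2 * t / √N) ^ 2 < 1 := by
        rw [div_pow, hq, div_lt_one hN0, hN]
        have : 0 < s ^ 4 := by positivity
        nlinarith
      have hc := abs_lt.1 ((sq_lt_one_iff_abs_lt_one _).1 hc1)
      have hcos := Real.cos_arccos hc.1.le hc.2.le
      have hsn : Real.sin (Real.arccos (2 * t / √N)) = s ^ 2 / √N := by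
        rw [Real.sin_arccos, div_pow, hq]
        rw [show 1 - (2 * t) ^ 2 / N = (s ^ 2) ^ 2 / N by rw [eq_div_iff hN0.ne']; field_simp; rw [hN]; ring]
        rw [Real.sqrt_div (by positivity), Real.sqrt_sq (by positivity)]
      refine ⟨(Real.arccos (2 * t / √N), √√N), ⟨⟨Real.arccos_pos.2 hc.2, ?_⟩,
        Real.sqrt_pos.2 hq0⟩, ?_⟩
      · rw [Real.arccos_lt_pi]; exact hc.1
      · simp only [Φ, hcos, hsn]
        rw [Real.sq_sqrt hq0.le, Real.sqrt_div (by positivity), Real.sqrt_sq hs'.le]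
        have : √√N ≠ 0 := (Real.sqrt_pos.2 hq0).ne'
        ext <;> simp only [] <;> field_simp
  have hinj : InjOn Φ (Ioo 0 Real.pi ×ˢ Ioi (0 : ℝ)) := by
    intro p hp q hq h
    have h1 := hrad p hp
    have h2 := hrad q hq
    rw [h, h2] at h1
    have hp2 : (0 : ℝ) < p.2 := hp.2
    have hq2 : (0 : ℝ) < q.2 := hq.2
    have h3 : p.2 = q.2 := (pow_left_inj₀ hp2.le hq2.le (by norm_num)).1 h1.symm
    have h4 : p.2 ^ 2 * (Real.cos p.1 / 2) = q.2 ^ 2 * (Real.cos q.1 / 2) := congrArg Prod.snd h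
    rw [h3] at h4
    have h5 : Real.cos p.1 = Real.cos q.1 := by
      have := mul_left_cancel₀ (by positivity) h4
      linarith
    exact Prod.ext (Real.injOn_cos ⟨hp.1.1.le, hp.1.2.le⟩ ⟨hq.1.1.le, hq.1.2.le⟩ h5) h3
  rw [← himg, lintegral_image_eq_lintegral_abs_det_fderiv_mul volume
    (measurableSet_Ioo.prod measurableSet_Ioi)
    (fun p hp => (hasFDerivAt_polar_halfplane (hsin p hp)).hasFDerivWithinAt) hinj]
  refine setLIntegral_congr_fun (measurableSet_Ioo.prod measurableSet_Ioi) fun p hp => ?_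
  have hS := Real.sqrt_pos.2 (hsin p hp)
  have h1 := Real.sq_sqrt (hsin p hp).le
  have h2 := Real.sin_sq_add_cos_sq p.1
  congr 2
  simp only [LinearMap.det_toContinuousLinearMap, LinearMap.det_toLin, Matrix.det_fin_two_of]
  rw [← abs_of_nonneg (show 0 ≤ p.2 ^ 2 / (2 * √(Real.sin p.1)) by positivity)]
  congr 1
  rw [eq_div_iff (by positivity)]
  have : p.2 * (Real.cos p.1 / (2 * √(Real.sin p.1))) * (2 * √(Real.sin p.1)) = p.2 * Real.cos p.1 := by
    field_simp
  calc _ = (p.2 * (Real.cos p.1 / (2 * √(Real.sin p.1))) * (2 * √(Real.sin p.1))) *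
        (p.2 * Real.cos p.1) + p.2 ^ 2 * (√(Real.sin p.1) ^ 2 * Real.sin p.1) := by ring
    _ = p.2 ^ 2 * (Real.sin p.1 ^ 2 + Real.cos p.1 ^ 2) := by rw [this, h1]; ring
    _ = _ := by rw [h2, mul_one]

theorem measurable_dil_pol : Measurable fun q : Ang n × ℝ => dil q.2 (pol q.1) := by
  have : Continuous fun q : Ang n × ℝ => dil q.2 (pol q.1) := by
    unfold dil pol
    fun_prop
  exact this.measurable

/-- With S = √(sin φ) the weights combine as (r S)^{n-1} · r²/(2S) = r^{n+1} · S^{n-2}/2, the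
densities of `radPow (n + 1)` and `polarAngle n`. Since n ≥ 2, the natural-number subtraction n - 2
is exact. -/
theorem lintegral_polar_plane (hn : 2 ≤ n) {G : ℝ × ℝ → ENNReal} (hG : Measurable G) :
    ∫⁻ s, (∫⁻ t, G (s, t)) ∂radPow (n - 1) = ∫⁻ φ, ∫⁻ r,
      G (r * √(Real.sin φ), r ^ 2 * (Real.cos φ / 2)) ∂radPow (n + 1) ∂polarAngle n := by
  have hm : Measurable fun p : ℝ × ℝ => (p.2 * √(Real.sin p.1), p.2 ^ 2 * (Real.cos p.1 / 2)) := by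
    fun_prop
  have e1 : ∫⁻ s, (∫⁻ t, G (s, t)) ∂radPow (n - 1) =
      ∫⁻ q in Ioi (0 : ℝ) ×ˢ univ, ENNReal.ofReal (q.1 ^ (n - 1)) * G q := by
    rw [lintegral_radPow, Measure.volume_eq_prod, ← Measure.prod_restrict, Measure.restrict_univ,
      lintegral_prod _ (by fun_prop)]
    refine lintegral_congr fun s => ?_
    exact (lintegral_const_mul _ (by fun_prop)).symm
  rw [e1, lintegral_halfplane, Measure.volume_eq_prod, ← Measure.prod_restrict,
    lintegral_prod _ (by fun_prop), lintegral_polarAngle]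
  refine setLIntegral_congr_fun measurableSet_Ioo fun φ hφ => ?_
  simp only [lintegral_radPow]
  rw [← lintegral_const_mul _ (by fun_prop)]
  refine setLIntegral_congr_fun measurableSet_Ioi fun r hr => ?_
  have hr' : (0 : ℝ) < r := hr
  have hS := Real.sqrt_pos.2 (Real.sin_pos_of_pos_of_lt_pi hφ.1 hφ.2)
  simp only [← mul_assoc]
  rw [← ENNReal.ofReal_mul (by positivity), ← ENNReal.ofReal_mul (by positivity)]
  congr 2
  obtain ⟨m, rfl⟩ : ∃ m, n = m + 2 := ⟨n - 2, by omega⟩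
  simp only [Nat.add_sub_cancel, show m + 2 - 1 = m + 1 by omega]
  rw [div_mul_eq_mul_div, div_mul_eq_mul_div, div_eq_div_iff (by positivity) (by positivity)]
  ring

/-- Euclidean polar coordinates in x, followed by gauge polar coordinates in the half-plane of (|x|,
t). -/
theorem measurePreserving_dil_pol (hn : 2 ≤ n) :
    MeasurePreserving (fun q : Ang n × ℝ => dil q.2 (pol q.1))
      ((angMeasure n).prod (radPow (n + 1))) volume := by
  refine ⟨measurable_dil_pol, Measure.ext_of_lintegral _ fun F hF => ?_⟩
  have hmp := (measurePreserving_polar (n := n) (by omega)).prod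
    (MeasurePreserving.id (volume : Measure ℝ))
  have hG : ∀ ω : Metric.sphere (0 : EuclideanSpace ℝ (Fin n)) 1, Measurable fun q : ℝ × ℝ =>
      F (q.1 • (ω : EuclideanSpace ℝ (Fin n)), q.2) := fun ω => hF.comp (by fun_prop)
  have hF2 : Measurable fun q : Ang n × ℝ => F (dil q.2 (pol q.1)) := hF.comp measurable_dil_pol
  have hF1 : Measurable fun q : (Metric.sphere (0 : EuclideanSpace ℝ (Fin n)) 1 × ℝ) × ℝ =>
      F (Prod.map (fun p : Metric.sphere (0 : EuclideanSpace ℝ (Fin n)) 1 × ℝ =>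
        p.2 • (p.1 : EuclideanSpace ℝ (Fin n))) id q) := hF.comp hmp.measurable
  rw [lintegral_map hF measurable_dil_pol, Measure.volume_eq_prod, ← hmp.map_eq,
    lintegral_map hF hmp.measurable, lintegral_prod _ hF1.aemeasurable,
    lintegral_prod _ (Measurable.lintegral_prod_right' hF1).aemeasurable,
    lintegral_prod _ hF2.aemeasurable, angMeasure,
    lintegral_prod _ (Measurable.lintegral_prod_right' hF2).aemeasurable]
  refine lintegral_congr fun ω => ?_
  have := lintegral_polar_plane hn (hG ω)
  simp only [Prod.map, id] at this ⊢
  rw [this]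
  simp only [dil, pol, smul_smul]

end PolarSpace

end Grushin

end

section

open MeasureTheory ProbabilityTheory Set Filter Topology

namespace Grushin

/-! ### Radial and angular first derivatives -/

section Gauge

variable {n : ℕ}

theorem gauge_nonneg (p : Space n) : 0 ≤ ‖p.1‖ ^ 4 + 4 * p.2 ^ 2 := by positivity

theorem gauge_pos {p : Space n} (hp : p ≠ 0) : 0 < ‖p.1‖ ^ 4 + 4 * p.2 ^ 2 := by
  rcases eq_or_ne p.1 0 with h | h
  · have h2 : p.2 ≠ 0 := fun h2 => hp (Prod.ext h h2)
    positivity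
  · positivity

theorem rho_nonneg (p : Space n) : 0 ≤ rho p := Real.rpow_nonneg (gauge_nonneg p) _

theorem rho_pow_four (p : Space n) : rho p ^ 4 = ‖p.1‖ ^ 4 + 4 * p.2 ^ 2 := by
  rw [rho, ← Real.rpow_natCast, ← Real.rpow_mul (gauge_nonneg p)]
  norm_num

theorem rho_pos {p : Space n} (hp : p ≠ 0) : 0 < rho p := Real.rpow_pos_of_pos (gauge_pos hp) _

theorem rho_zero : rho (0 : Space n) = 0 := by simp [rho]

theorem rho_eq_of_pow_four {p : Space n} {r : ℝ} (hr : 0 ≤ r)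
    (h : ‖p.1‖ ^ 4 + 4 * p.2 ^ 2 = r ^ 4) : rho p = r :=
  (pow_left_inj₀ (rho_nonneg p) hr (by norm_num)).1 ((rho_pow_four p).trans h)

theorem rho_dil {r : ℝ} (hr : 0 ≤ r) (p : Space n) : rho (dil r p) = r * rho p := by
  refine rho_eq_of_pow_four (mul_nonneg hr (rho_nonneg p)) ?_
  rw [mul_pow, rho_pow_four, dil]
  simp only [norm_smul, Real.norm_of_nonneg hr]
  ring

theorem continuous_rho : Continuous (rho : Space n → ℝ) := by
  unfold rho
  exact Continuous.rpow_const (by fun_prop) fun _ => Or.inr (by norm_num)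

theorem contDiff_gauge : ContDiff ℝ (⊤ : ℕ∞) fun p : Space n => ‖p.1‖ ^ 4 + 4 * p.2 ^ 2 := by
  have h : ContDiff ℝ (⊤ : ℕ∞) fun p : Space n => (‖p.1‖ ^ 2) ^ 2 + 4 * p.2 ^ 2 :=
    ((contDiff_fst.norm_sq ℝ).pow 2).add (contDiff_const.mul (contDiff_snd.pow 2))
  convert h using 2 with p
  ring

theorem contDiffAt_rho {p : Space n} (hp : p ≠ 0) : ContDiffAt ℝ (⊤ : ℕ∞) rho p :=
  contDiff_gauge.contDiffAt.rpow_const_of_ne (gauge_pos hp).ne'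

/-- Obtained by differentiating ϱ⁴ = |x|⁴ + 4t² in two ways. -/
theorem fderiv_rho_apply {p : Space n} (hp : p ≠ 0) (v : Space n) :
    fderiv ℝ rho p v = (‖p.1‖ ^ 2 * inner ℝ p.1 v.1 + 2 * p.2 * v.2) / rho p ^ 3 := by
  have hd : HasFDerivAt (rho : Space n → ℝ) (fderiv ℝ rho p) p :=
    ((contDiffAt_rho hp).differentiableAt (by simp)).hasFDerivAt
  have h1 : HasFDerivAt (fun q : Space n => ‖q.1‖ ^ 2)
      (2 • (innerSL ℝ p.1).comp (ContinuousLinearMap.fst ℝ _ ℝ)) p :=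
    (hasFDerivAt_fst (𝕜 := ℝ) (p := p)).norm_sq
  have h2 := (h1.pow 2).add (((hasFDerivAt_snd (𝕜 := ℝ) (p := p)).pow 2).const_mul (4 : ℝ))
  have h3 := hd.pow 4
  have h4 : (fun q : Space n => rho q ^ 4) = fun q => (‖q.1‖ ^ 2) ^ 2 + 4 * q.2 ^ 2 := by
    ext q; rw [rho_pow_four]; ring
  have h5 := congrArg (fun L : Space n →L[ℝ] ℝ => L v)
    ((h3.congr_of_eventuallyEq (f₁ := fun q => (‖q.1‖ ^ 2) ^ 2 + 4 * q.2 ^ 2)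
      (.of_forall fun q => (congrFun h4 q).symm)).unique h2)
  have hr := rho_pos hp
  rw [eq_div_iff (by positivity)]
  simp at h5
  nlinarith

/-- The generator of the dilations. -/
def eul (p : Space n) : Space n := (p.1, 2 * p.2)

/-- The Euler operator `x · ∇ₓ u + 2 t ∂ₜ u`. -/
noncomputable def euler (u : Space n → ℝ) (p : Space n) : ℝ := fderiv ℝ u p (eul p)

/-- The weight `|x|² / ϱ⁴`. -/
noncomputable def kap (p : Space n) : ℝ := ‖p.1‖ ^ 2 / rho p ^ 4

theorem kap_nonneg (p : Space n) : 0 ≤ kap p := by unfold kap; positivity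

theorem kap_dil {r : ℝ} (hr : 0 < r) (p : Space n) : kap (dil r p) = kap p / r ^ 2 := by
  rw [kap, kap, rho_dil hr.le, dil]
  simp only [norm_smul, Real.norm_of_nonneg hr.le]
  rcases eq_or_ne (rho p) 0 with h | h
  · simp [h]
  · field_simp

/-- In this form the weight is visibly of degree 0, since `kap` has degree -2. Constancy along
dilation orbits is what makes a reduction orbit by orbit possible. -/
theorem gradSq_rho {p : Space n} (hp : p ≠ 0) : gradSq rho p = rho p ^ 2 * kap p := by
  have hr := rho_pos hp
  have h4 := rho_pow_four p
  have hs : ∑ i, p.1 i ^ 2 = ‖p.1‖ ^ 2 := by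
    rw [EuclideanSpace.norm_sq_eq]; simp
  simp only [gradSq, dx, dt, fderiv_rho_apply hp, EuclideanSpace.inner_single_right]
  simp only [one_mul, mul_zero, add_zero, inner_zero_right, zero_add, mul_one, kap,
    conj_trivial]
  have : ∀ i, (‖p.1‖ ^ 2 * p.1 i / rho p ^ 3) ^ 2 = ‖p.1‖ ^ 4 / rho p ^ 6 * p.1 i ^ 2 := by
    intro i; field_simp
  simp_rw [this]
  rw [← Finset.mul_sum, hs]
  field_simp
  rw [h4]; ring

/-- The projection of the Grushin frame to the directions tangent to the gauge spheres. -/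
noncomputable def angField : Option (Fin n) → Space n → Space n
  | some i, p => (EuclideanSpace.single i 1, 0) - (p.1 i * kap p) • eul p
  | none, p => (0, ‖p.1‖) - (2 * p.2 * ‖p.1‖ / rho p ^ 4) • eul p

/-- The angular part of the carré du champ of the Grushin operator. -/
noncomputable def gam (f g : Space n → ℝ) (p : Space n) : ℝ :=
  ∑ a, fderiv ℝ f p (angField a p) * fderiv ℝ g p (angField a p)

theorem gam_self_nonneg (f : Space n → ℝ) (p : Space n) : 0 ≤ gam f f p :=
  Finset.sum_nonneg fun _ _ => mul_self_nonneg _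

theorem sum_coord_mul_apply (p : Space n) (L : Space n →L[ℝ] ℝ) :
    ∑ i, p.1 i * L (EuclideanSpace.single i 1, 0) + 2 * p.2 * L (0, 1) = L (eul p) := by
  have hs : p.1 = ∑ i, p.1 i • EuclideanSpace.single i (1 : ℝ) := by
    have := ((EuclideanSpace.basisFun (Fin n) ℝ).sum_repr p.1).symm
    simpa using this
  have h2 : eul p = ∑ i, p.1 i • ((EuclideanSpace.single i (1 : ℝ), (0 : ℝ)) : Space n) +
      (2 * p.2) • ((0, 1) : Space n) := by
    refine Prod.ext ?_ ?_
    · simp only [eul, Prod.fst_add, Prod.fst_sum, Prod.smul_fst, smul_zero, add_zero]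
      exact hs
    · simp [eul, Prod.snd_sum]
  rw [h2, map_add, map_sum, map_smul]
  simp only [map_smul, smul_eq_mul]

/-- Pythagoras: the Grushin inner product of ∇_G ϱ and ∇_G f is ϱ κ Ef, and |∇_G ϱ|² = ϱ² κ, so the
component along ∇_G ϱ accounts for κ Ef Eg. The right side contains only |x|², not |x|, hence
displays the smoothness of `gam`. -/
theorem gam_eq {p : Space n} (hp : p ≠ 0) (f g : Space n → ℝ) :
    gam f g p = ∑ i, dx i f p * dx i g p + ‖p.1‖ ^ 2 * (dt f p * dt g p) -
      kap p * (euler f p * euler g p) := by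
  have hr := rho_pos hp
  have h4 := rho_pow_four p
  have hs : ∑ i, p.1 i ^ 2 = ‖p.1‖ ^ 2 := by
    rw [EuclideanSpace.norm_sq_eq]; simp
  have hf := sum_coord_mul_apply p (fderiv ℝ f p)
  have hg := sum_coord_mul_apply p (fderiv ℝ g p)
  have ht : ∀ L : Space n →L[ℝ] ℝ, L (0, ‖p.1‖) = ‖p.1‖ * L (0, 1) := by
    intro L
    have : ((0, ‖p.1‖) : Space n) = ‖p.1‖ • (0, 1) := by simp
    rw [this, map_smul, smul_eq_mul]
  simp only [gam, Fintype.sum_option, angField, map_sub, map_smul, smul_eq_mul, ht]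
  simp only [dx, dt, euler]
  set Lf := fderiv ℝ f p
  set Lg := fderiv ℝ g p
  have e : ∀ i, (Lf (EuclideanSpace.single i 1, 0) - p.1 i * kap p * Lf (eul p)) *
      (Lg (EuclideanSpace.single i 1, 0) - p.1 i * kap p * Lg (eul p)) =
      Lf (EuclideanSpace.single i 1, 0) * Lg (EuclideanSpace.single i 1, 0) -
      kap p * Lf (eul p) * (p.1 i * Lg (EuclideanSpace.single i 1, 0)) -
      kap p * Lg (eul p) * (p.1 i * Lf (EuclideanSpace.single i 1, 0)) +
      kap p ^ 2 * Lf (eul p) * Lg (eul p) * p.1 i ^ 2 := fun i => by ring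
  simp_rw [e]
  rw [Finset.sum_add_distrib, Finset.sum_sub_distrib, Finset.sum_sub_distrib, ← Finset.mul_sum,
    ← Finset.mul_sum, ← Finset.mul_sum, hs, eq_sub_of_add_eq hf, eq_sub_of_add_eq hg]
  have hk : ‖p.1‖ ^ 2 * kap p ^ 2 + (2 * p.2 * ‖p.1‖ / rho p ^ 4) ^ 2 = kap p := by
    rw [kap]; field_simp; rw [h4]; ring
  have hk2 : 2 * p.2 * ‖p.1‖ / rho p ^ 4 * ‖p.1‖ = 2 * p.2 * kap p := by
    rw [kap]; ring
  set c := 2 * p.2 * ‖p.1‖ / rho p ^ 4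
  linear_combination Lf (eul p) * Lg (eul p) * hk -
    (Lf (0, 1) * Lg (eul p) + Lg (0, 1) * Lf (eul p)) * hk2

theorem gradSq_eq {p : Space n} (hp : p ≠ 0) (u : Space n → ℝ) :
    gradSq u p = gam u u p + kap p * euler u p ^ 2 := by
  rw [gam_eq hp, gradSq]
  have : ∀ i, dx i u p ^ 2 = dx i u p * dx i u p := fun i => sq _
  simp_rw [this]; ring

theorem euler_rho {p : Space n} (hp : p ≠ 0) : euler rho p = rho p := by
  have hr := rho_pos hp
  rw [euler, fderiv_rho_apply hp, div_eq_iff (by positivity), eul, real_inner_self_eq_norm_sq]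
  have := rho_pow_four p
  linear_combination -this

/-- Tangency to the gauge spheres. Consequently functions of ϱ pass through `gam` like constants. -/
theorem fderiv_rho_angField {p : Space n} (hp : p ≠ 0) (a : Option (Fin n)) :
    fderiv ℝ rho p (angField a p) = 0 := by
  have hr := rho_pos hp
  have he := euler_rho hp
  rw [euler] at he
  cases a with
  | some i =>
    rw [angField, map_sub, map_smul, he, fderiv_rho_apply hp, EuclideanSpace.inner_single_right]
    simp only [one_mul, mul_zero, add_zero, conj_trivial, kap, smul_eq_mul]
    field_simp; ring
  | none =>
    rw [angField, map_sub, map_smul, he, fderiv_rho_apply hp]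
    simp only [inner_zero_right, mul_zero, zero_add, smul_eq_mul]
    field_simp; ring

theorem fderiv_comp_rho_mul_angField {p : Space n} (hp : p ≠ 0) {c : ℝ → ℝ} {f : Space n → ℝ}
    (hc : DifferentiableAt ℝ c (rho p)) (hf : DifferentiableAt ℝ f p) (a : Option (Fin n)) :
    fderiv ℝ (fun q => c (rho q) * f q) p (angField a p) =
      c (rho p) * fderiv ℝ f p (angField a p) := by
  have h1 : HasFDerivAt (fun q => c (rho q)) (deriv c (rho p) • fderiv ℝ rho p) p :=
    hc.hasDerivAt.comp_hasFDerivAt p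
      ((contDiffAt_rho hp).differentiableAt (by simp)).hasFDerivAt
  rw [(h1.fun_mul hf.hasFDerivAt).fderiv]
  simp [fderiv_rho_angField hp]

theorem gam_comp_rho_mul {p : Space n} (hp : p ≠ 0) {c : ℝ → ℝ} {f : Space n → ℝ}
    (hc : DifferentiableAt ℝ c (rho p)) (hf : DifferentiableAt ℝ f p) (g : Space n → ℝ) :
    gam (fun q => c (rho q) * f q) g p = c (rho p) * gam f g p := by
  simp only [gam, fderiv_comp_rho_mul_angField hp hc hf, Finset.mul_sum, mul_assoc]

theorem gam_comp_rho {p : Space n} (hp : p ≠ 0) {c : ℝ → ℝ}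
    (hc : DifferentiableAt ℝ c (rho p)) (g : Space n → ℝ) :
    gam (fun q => c (rho q)) g p = 0 := by
  have := gam_comp_rho_mul hp hc (differentiableAt_const (1 : ℝ)) g
  simpa [gam] using this

theorem gam_comm (f g : Space n → ℝ) (p : Space n) : gam f g p = gam g f p := by
  simp only [gam, mul_comm]

theorem euler_comp_rho {p : Space n} (hp : p ≠ 0) {c : ℝ → ℝ}
    (hc : DifferentiableAt ℝ c (rho p)) :
    euler (fun q => c (rho q)) p = rho p * deriv c (rho p) := by
  have h1 : HasFDerivAt (fun q => c (rho q)) (deriv c (rho p) • fderiv ℝ rho p) p :=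
    hc.hasDerivAt.comp_hasFDerivAt p
      ((contDiffAt_rho hp).differentiableAt (by simp)).hasFDerivAt
  have h2 := euler_rho hp
  rw [euler] at h2 ⊢
  rw [h1.fderiv]
  simp [h2, mul_comm]

end Gauge

/-! ### Dilations and angular derivatives -/

section Dilation

variable {n : ℕ}

theorem dil_one (p : Space n) : dil 1 p = p := by simp [dil]

theorem eul_dil (r : ℝ) (p : Space n) : eul (dil r p) = dil r (eul p) := by
  simp only [eul, dil]; ext <;> simp; ring

/-- The angular fields are homogeneous of degree -1. Transporting one frame by dilation thus
describes `gam` along a whole orbit by functions of r. -/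
theorem dil_angField {r : ℝ} (hr : 0 < r) (a : Option (Fin n)) (p : Space n) :
    dil r (angField a p) = r • angField a (dil r p) := by
  cases a with
  | some i =>
    simp only [angField, kap_dil hr, eul_dil]
    simp only [dil, eul]
    refine Prod.ext ?_ ?_
    · simp only [Prod.fst_sub, Prod.smul_fst, smul_sub, smul_smul, PiLp.smul_apply, smul_eq_mul]
      congr 2; field_simp
    · simp only [Prod.snd_sub, Prod.smul_snd, smul_eq_mul, PiLp.smul_apply]
      field_simp; ring
  | none =>
    simp only [angField, rho_dil hr.le, eul_dil]
    simp only [dil, eul, norm_smul, Real.norm_of_nonneg hr.le]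
    refine Prod.ext ?_ ?_
    · simp only [Prod.fst_sub, Prod.smul_fst, smul_sub, smul_smul, smul_zero]
      congr 2
      rcases eq_or_ne (rho p) 0 with h | h
      · simp [h]
      · field_simp
    · simp only [Prod.snd_sub, Prod.smul_snd, smul_eq_mul]
      rcases eq_or_ne (rho p) 0 with h | h
      · simp [h]; ring
      · field_simp

theorem hasDerivAt_dil {r : ℝ} (hr : r ≠ 0) (p : Space n) :
    HasDerivAt (fun r => dil r p) (r⁻¹ • eul (dil r p)) r := by
  have h1 : HasDerivAt (fun r : ℝ => r • p.1) ((1 : ℝ) • p.1) r := (hasDerivAt_id' r).smul_const p.1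
  have h2 : HasDerivAt (fun r : ℝ => r ^ 2 * p.2) (2 * r * p.2) r := by
    simpa using ((hasDerivAt_id' r).fun_pow 2).mul_const p.2
  refine (h1.prodMk h2).congr_deriv ?_
  simp only [eul, dil]
  refine Prod.ext ?_ ?_
  · simp [smul_smul, hr]
  · simp only [Prod.smul_snd, smul_eq_mul]; field_simp

theorem hasDerivAt_comp_dil {u : Space n → ℝ} {r : ℝ} (hr : r ≠ 0) {p : Space n}
    (hu : DifferentiableAt ℝ u (dil r p)) :
    HasDerivAt (fun r => u (dil r p)) (r⁻¹ * euler u (dil r p)) r := by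
  refine (hu.hasFDerivAt.comp_hasDerivAt r (hasDerivAt_dil hr p)).congr_deriv ?_
  rw [map_smul, smul_eq_mul, euler]

/-- `eul` as a continuous linear map. -/
noncomputable def eulL (n : ℕ) : Space n →L[ℝ] Space n :=
  (ContinuousLinearMap.fst ℝ _ ℝ).prod ((2 : ℝ) • ContinuousLinearMap.snd ℝ _ ℝ)

theorem eulL_apply (p : Space n) : eulL n p = eul p := rfl

/-- By symmetry of the second derivative, r d/dr of a transported directional derivative of u is the
same transported derivative of Eu. -/
theorem hasDerivAt_fderiv_dil {u : Space n → ℝ} (hu : ContDiff ℝ 2 u) {r : ℝ} (hr : r ≠ 0)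
    (p X : Space n) :
    HasDerivAt (fun r => fderiv ℝ u (dil r p) (dil r X))
      (r⁻¹ * fderiv ℝ (euler u) (dil r p) (dil r X)) r := by
  have hd : Differentiable ℝ (fderiv ℝ u) :=
    (hu.fderiv_right (m := 1) (by norm_num)).differentiable (by norm_num)
  have h1 : HasDerivAt (fun r => fderiv ℝ u (dil r p))
      (fderiv ℝ (fderiv ℝ u) (dil r p) (r⁻¹ • eul (dil r p))) r :=
    (hd _).hasFDerivAt.comp_hasDerivAt r (hasDerivAt_dil hr p)
  refine (h1.clm_apply (hasDerivAt_dil hr X)).congr_deriv ?_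
  have h2 : HasFDerivAt (euler u) ((fderiv ℝ u (dil r p)).comp (eulL n) +
      (fderiv ℝ (fderiv ℝ u) (dil r p)).flip (eulL n (dil r p))) (dil r p) :=
    (hd _).hasFDerivAt.clm_apply (eulL n).hasFDerivAt
  rw [h2.fderiv]
  have hsymm : IsSymmSndFDerivAt ℝ u (dil r p) :=
    hu.contDiffAt.isSymmSndFDerivAt (by simp)
  simp only [add_apply, ContinuousLinearMap.comp_apply,
    ContinuousLinearMap.flip_apply, eulL_apply, map_smul, smul_apply,
    smul_eq_mul]
  rw [hsymm.eq]; ring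

end Dilation

end Grushin

end

section

open MeasureTheory ProbabilityTheory Set Filter Topology

namespace Grushin

/-! ### Operations on test functions -/

section Test

variable {E : Type*} [NormedAddCommGroup E] [NormedSpace ℝ E] {U : Set E} {u v : E → ℝ}

theorem IsTest.mono {V : Set E} (h : IsTest U u) (hUV : U ⊆ V) : IsTest V u :=
  ⟨h.1, h.2.1, h.2.2.trans hUV⟩

theorem isTest_of_subset_tsupport (hu : IsTest U u) (hv : ContDiff ℝ (⊤ : ℕ∞) v)
    (hs : tsupport v ⊆ tsupport u) : IsTest U v :=
  ⟨hv, hu.2.1.of_isClosed_subset (isClosed_tsupport _) hs, hs.trans hu.2.2⟩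

theorem IsTest.sub (hu : IsTest U u) (hv : IsTest U v) : IsTest U fun p => u p - v p :=
  ⟨hu.1.sub hv.1, hu.2.1.sub hv.2.1,
    (tsupport_sub u v).trans (union_subset hu.2.2 hv.2.2)⟩

theorem IsTest.add (hu : IsTest U u) (hv : IsTest U v) : IsTest U fun p => u p + v p :=
  ⟨hu.1.add hv.1, hu.2.1.add hv.2.1,
    (tsupport_add u v).trans (union_subset hu.2.2 hv.2.2)⟩

theorem IsTest.sum {ι : Type*} {s : Finset ι} {f : ι → E → ℝ} (h : ∀ i ∈ s, IsTest U (f i)) :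
    IsTest U fun p => ∑ i ∈ s, f i p := by
  classical
  induction s using Finset.induction_on with
  | empty =>
    refine ⟨by simpa using contDiff_const, ?_, ?_⟩
    · simpa using! HasCompactSupport.zero
    · simp [tsupport]
  | insert i s hi ih =>
    simp only [Finset.sum_insert hi]
    exact (h i (Finset.mem_insert_self _ _)).add
      (ih fun j hj => h j (Finset.mem_insert_of_mem hj))

/-- Smoothness of `k` on `U` suffices, which admits the weights κ and ϱ⁻², singular at the origin.
-/
theorem IsTest.mul_left {k : E → ℝ} (hu : IsTest U u)
    (hk : ∀ p ∈ U, ContDiffAt ℝ (⊤ : ℕ∞) k p) : IsTest U fun p => k p * u p := by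
  refine isTest_of_subset_tsupport hu ?_ (tsupport_mul_subset_right (f := k) (g := u))
  refine contDiff_iff_contDiffAt.2 fun p => ?_
  by_cases hp : p ∈ tsupport u
  · exact (hk p (hu.2.2 hp)).mul hu.1.contDiffAt
  · have : (fun q => k q * u q) =ᶠ[𝓝 p] fun _ => 0 := by
      filter_upwards [notMem_tsupport_iff_eventuallyEq.1 hp] with q hq
      simp [hq]
    exact contDiffAt_const.congr_of_eventuallyEq this

theorem IsTest.mul (hu : IsTest U u) (hv : IsTest U v) : IsTest U fun p => u p * v p :=
  hv.mul_left fun _ _ => hu.1.contDiffAt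

theorem IsTest.fderiv_apply (hu : IsTest U u) {X : E → E} (hX : ContDiff ℝ (⊤ : ℕ∞) X) :
    IsTest U fun p => fderiv ℝ u p (X p) := by
  refine isTest_of_subset_tsupport hu ?_ ?_
  · exact (hu.1.fderiv_right (m := (⊤ : ℕ∞)) (by norm_cast)).clm_apply hX
  · refine closure_minimal (fun p hp => ?_) (isClosed_tsupport _)
    refine tsupport_fderiv_subset ℝ (subset_tsupport _ ?_)
    intro h
    exact hp (by simp [h])

theorem IsTest.continuous (hu : IsTest U u) : Continuous u := hu.1.continuous

theorem IsTest.differentiable (hu : IsTest U u) : Differentiable ℝ u :=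
  hu.1.differentiable (by simp)

theorem IsTest.integrable [MeasurableSpace E] [BorelSpace E] {μ : Measure E}
    [IsFiniteMeasureOnCompacts μ] (hu : IsTest U u) : Integrable u μ :=
  hu.continuous.integrable_of_hasCompactSupport hu.2.1

theorem IsTest.eq_zero_of_notMem (hu : IsTest U u) {p : E} (hp : p ∉ U) : u p = 0 :=
  image_eq_zero_of_notMem_tsupport fun h => hp (hu.2.2 h)

end Test

/-! ### Integration by parts and the angular operator -/

section Parts

variable {n : ℕ} {U : Set (Space n)} {u f g : Space n → ℝ}

instance : (volume : Measure (Space n)).IsAddHaarMeasure :=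
  Measure.prod.instIsAddHaarMeasure _ _

theorem ae_ne_zero : ∀ᵐ p : Space n, p ≠ 0 := by
  have : Nontrivial (Space n) := ⟨⟨0, (0, 1), fun h => zero_ne_one (congrArg Prod.snd h)⟩⟩
  have : NullSingletonClass (volume : Measure (Space n)) := inferInstance
  rw [ae_iff]
  simp only [ne_eq, not_not, Set.ofPred_eq_eq_singleton]
  exact measure_singleton _

theorem IsTest.dx (hu : IsTest U u) (i : Fin n) : IsTest U (dx i u) :=
  hu.fderiv_apply contDiff_const

theorem IsTest.dt (hu : IsTest U u) : IsTest U (dt u) := hu.fderiv_apply contDiff_const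

theorem IsTest.euler (hu : IsTest U u) : IsTest U (euler u) :=
  hu.fderiv_apply (eulL n).contDiff

theorem contDiff_norm_fst_sq : ContDiff ℝ (⊤ : ℕ∞) fun p : Space n => ‖p.1‖ ^ 2 :=
  contDiff_fst.norm_sq ℝ

theorem IsTest.lap (hu : IsTest U u) : IsTest U (lap u) :=
  (IsTest.sum fun i _ => (hu.dx i).dx i).add
    (hu.dt.dt.mul_left fun _ _ => contDiff_norm_fst_sq.contDiffAt)

theorem contDiffAt_kap {p : Space n} (hp : p ≠ 0) : ContDiffAt ℝ (⊤ : ℕ∞) kap p :=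
  contDiff_norm_fst_sq.contDiffAt.div ((contDiffAt_rho hp).pow 4) (pow_pos (rho_pos hp) 4).ne'

theorem contDiffAt_inv_rho_sq {p : Space n} (hp : p ≠ 0) :
    ContDiffAt ℝ (⊤ : ℕ∞) (fun q => (rho q ^ 2)⁻¹) p :=
  ((contDiffAt_rho hp).pow 2).inv (pow_pos (rho_pos hp) 2).ne'

theorem isTest_gam (hf : IsTest {0}ᶜ f) (hg : IsTest {0}ᶜ g) : IsTest {0}ᶜ (gam f g) := by
  -- The field `angField none` carries the non-smooth factor |x|, so smoothness is read off from the
  -- formula of `gam_eq`; at the origin all terms vanish.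
  have h1 : IsTest {0}ᶜ fun p => ∑ i, Grushin.dx i f p * Grushin.dx i g p +
      ‖p.1‖ ^ 2 * (Grushin.dt f p * Grushin.dt g p) -
      kap p * (Grushin.euler f p * Grushin.euler g p) :=
    ((IsTest.sum fun i _ => (hf.dx i).mul (hg.dx i)).add
      ((hf.dt.mul hg.dt).mul_left fun _ _ => contDiff_norm_fst_sq.contDiffAt)).sub
      ((hf.euler.mul hg.euler).mul_left fun p hp => contDiffAt_kap hp)
  convert! h1 using 1
  ext p
  rcases eq_or_ne p 0 with rfl | hp
  · have h0 : fderiv ℝ f 0 = 0 := by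
      have : (0 : Space n) ∉ tsupport (fderiv ℝ f) := fun h =>
        hf.2.2 (tsupport_fderiv_subset ℝ h) rfl
      exact image_eq_zero_of_notMem_tsupport this
    simp [gam, Grushin.dx, Grushin.dt, Grushin.euler, h0]
  · exact gam_eq hp f g

theorem integral_mul_fderiv_test (hf : IsTest U f) (hg : IsTest U g) (v : Space n) :
    ∫ p, f p * fderiv ℝ g p v = -∫ p, fderiv ℝ f p v * g p := by
  refine integral_mul_fderiv_eq_neg_fderiv_mul_of_integrable ?_ ?_ ?_
    (fun _ _ => hf.differentiable _) (fun _ _ => hg.differentiable _)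
  · exact ((hf.fderiv_apply (X := fun _ => v) contDiff_const).mul hg).integrable
  · exact (hf.mul (hg.fderiv_apply (X := fun _ => v) contDiff_const)).integrable
  · exact (hf.mul hg).integrable

theorem integral_mul_lap (hf : IsTest U f) (hg : IsTest U g) :
    ∫ p, f p * lap g p = -∫ p, (∑ i, dx i f p * dx i g p + ‖p.1‖ ^ 2 * (dt f p * dt g p)) := by
  have hr : IsTest U fun p : Space n => ‖p.1‖ ^ 2 * f p :=
    hf.mul_left fun _ _ => contDiff_norm_fst_sq.contDiffAt
  have e1 : ∀ p, f p * lap g p = ∑ i, f p * dx i (dx i g) p + (‖p.1‖ ^ 2 * f p) * dt (dt g) p := by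
    intro p; rw [lap, mul_add, Finset.mul_sum]; ring
  have i1 : ∀ i, Integrable (fun p => f p * dx i (dx i g) p) := fun i =>
    (hf.mul ((hg.dx i).dx i)).integrable
  have i2 : Integrable (fun p => (‖p.1‖ ^ 2 * f p) * dt (dt g) p) := (hr.mul hg.dt.dt).integrable
  have i3 : ∀ i, Integrable (fun p => dx i f p * dx i g p) := fun i =>
    ((hf.dx i).mul (hg.dx i)).integrable
  have i4 : Integrable (fun p : Space n => ‖p.1‖ ^ 2 * (dt f p * dt g p)) :=
    ((hf.dt.mul hg.dt).mul_left (U := U) fun _ _ => contDiff_norm_fst_sq.contDiffAt).integrable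
  have h1 : ∀ i, ∫ p, f p * dx i (dx i g) p = -∫ p, dx i f p * dx i g p := fun i =>
    integral_mul_fderiv_test hf (hg.dx i) _
  have h2 : ∫ p, (‖p.1‖ ^ 2 * f p) * dt (dt g) p = -∫ p : Space n, ‖p.1‖ ^ 2 * (dt f p * dt g p) := by
    have := integral_mul_fderiv_test hr hg.dt (0, 1)
    rw [show (∫ p, (‖p.1‖ ^ 2 * f p) * dt (dt g) p) =
      ∫ p, (‖p.1‖ ^ 2 * f p) * fderiv ℝ (dt g) p (0, 1) from rfl, this]
    congr 1
    refine integral_congr_ae (.of_forall fun p => ?_)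
    have hd : HasFDerivAt (fun q : Space n => ‖q.1‖ ^ 2)
        (2 • (innerSL ℝ p.1).comp (ContinuousLinearMap.fst ℝ _ ℝ)) p :=
      (hasFDerivAt_fst (𝕜 := ℝ) (p := p)).norm_sq
    beta_reduce
    rw [(hd.fun_mul (hf.differentiable p).hasFDerivAt).fderiv]
    simp [dt, mul_assoc]
  simp_rw [e1]
  rw [integral_add (integrable_finsetSum _ fun i _ => i1 i) i2, h2,
    integral_finsetSum _ fun i _ => i1 i, integral_add (integrable_finsetSum _ fun i _ => i3 i) i4,
    integral_finsetSum _ fun i _ => i3 i]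
  simp_rw [h1]
  rw [Finset.sum_neg_distrib]; ring

theorem integral_coord_mul_fderiv (hf : IsTest U f) (L : Space n →L[ℝ] ℝ) (v : Space n) :
    ∫ p, L p * fderiv ℝ f p v = -(L v * ∫ p, f p) := by
  have hL : ∀ p, ContDiffAt ℝ (⊤ : ℕ∞) (fun p => L p) p := fun p => L.contDiff.contDiffAt
  have h := integral_mul_fderiv_eq_neg_fderiv_mul_of_integrable (μ := (volume : Measure (Space n)))
    (f := fun p => L p) (g := f) (v := v) ?_ ?_ ?_ (fun _ _ => L.differentiableAt)
    (fun _ _ => hf.differentiable _)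
  · rw [h, ← integral_const_mul]
    simp
  · simpa using hf.integrable.const_mul (L v)
  · exact ((hf.fderiv_apply (X := fun _ => v) contDiff_const).mul_left fun p _ => hL p).integrable
  · exact (hf.mul_left fun p _ => hL p).integrable

/-- The divergence of the field x·∂ₓ + 2t ∂ₜ is n + 2 = Q. -/
theorem integral_euler (hf : IsTest U f) :
    ∫ p, euler f p = -(((n : ℝ) + 2) * ∫ p, f p) := by
  set Lx : Fin n → Space n →L[ℝ] ℝ := fun i =>
    (EuclideanSpace.proj i).comp (ContinuousLinearMap.fst ℝ (EuclideanSpace ℝ (Fin n)) ℝ)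
  set Lt : Space n →L[ℝ] ℝ := ContinuousLinearMap.snd ℝ (EuclideanSpace ℝ (Fin n)) ℝ
  have e : ∀ p, euler f p = ∑ i, Lx i p * fderiv ℝ f p (EuclideanSpace.single i 1, 0) +
      2 * (Lt p * fderiv ℝ f p (0, 1)) := by
    intro p
    rw [euler, ← sum_coord_mul_apply]
    simp [Lx, Lt, mul_assoc]
  have hI : ∀ (L : Space n →L[ℝ] ℝ) (v : Space n), Integrable fun p => L p * fderiv ℝ f p v :=
    fun L v => ((hf.fderiv_apply (X := fun _ => v) contDiff_const).mul_left
      fun p _ => L.contDiff.contDiffAt).integrable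
  simp_rw [e]
  rw [integral_add (integrable_finsetSum _ fun i _ => hI _ _) ((hI _ _).const_mul 2),
    integral_finsetSum _ fun i _ => hI _ _, integral_const_mul]
  simp_rw [integral_coord_mul_fderiv hf]
  simp [Lx, Lt]
  ring

/-- The angular part of the Grushin operator. -/
noncomputable def angLap (u : Space n → ℝ) (p : Space n) : ℝ :=
  lap u p - kap p * (euler (euler u) p + n * euler u p)

theorem IsTest.angLap (hu : IsTest {0}ᶜ u) : IsTest {0}ᶜ (angLap u) :=
  hu.lap.sub ((hu.euler.euler.add
    (hu.euler.mul_left fun _ _ => contDiffAt_const)).mul_left fun _ hp => contDiffAt_kap hp)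

theorem euler_eq_of_hasDerivAt (hf : Differentiable ℝ f) {p : Space n} {c : ℝ}
    (h : HasDerivAt (fun r => f (dil r p)) c 1) : euler f p = c := by
  have := (hasDerivAt_comp_dil (u := f) one_ne_zero (p := p) (hf _)).unique h
  simpa [dil_one] using this

theorem hasDerivAt_comp_dil_one (hf : Differentiable ℝ f) (p : Space n) :
    HasDerivAt (fun r => f (dil r p)) (euler f p) 1 := by
  simpa [dil_one] using hasDerivAt_comp_dil (u := f) one_ne_zero (p := p) (hf _)

/-- `integral_euler` is applied to κ f Eg. As κ has degree -2, Eκ = -2κ, which leaves Q - 2 = n as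
the coefficient of E in the radial operator. -/
theorem integral_mul_kap_euler (hf : IsTest {0}ᶜ f) (hg : IsTest {0}ᶜ g) :
    ∫ p, f p * (kap p * (euler (euler g) p + n * euler g p)) =
      -∫ p, kap p * (euler f p * euler g p) := by
  have hF : IsTest {0}ᶜ fun p => kap p * (f p * euler g p) :=
    (hf.mul hg.euler).mul_left fun _ hp => contDiffAt_kap hp
  have e : ∀ p, euler (fun p => kap p * (f p * euler g p)) p =
      kap p * (euler f p * euler g p) + f p * (kap p * (euler (euler g) p + n * euler g p)) -
        ((n : ℝ) + 2) * (kap p * (f p * euler g p)) := by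
    intro p
    refine euler_eq_of_hasDerivAt hF.differentiable ?_
    have h1 := hasDerivAt_comp_dil_one hf.differentiable p
    have h2 := hasDerivAt_comp_dil_one hg.euler.differentiable p
    have h3 : HasDerivAt (fun r => kap p / r ^ 2) (-2 * kap p) 1 := by
      refine ((hasDerivAt_const (1 : ℝ) (kap p)).fun_div ((hasDerivAt_id' (1 : ℝ)).fun_pow 2)
        (by norm_num)).congr_deriv ?_
      norm_num
      ring
    have h4 : HasDerivAt (fun r => kap (dil r p) * (f (dil r p) * euler g (dil r p)))
        _ 1 := (h3.fun_mul (h1.fun_mul h2)).congr_of_eventuallyEq (by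
          filter_upwards [lt_mem_nhds one_pos] with r hr
          rw [kap_dil hr])
    refine h4.congr_deriv ?_
    simp only [dil_one]
    ring
  have hi := integral_euler hF
  simp_rw [e] at hi
  have i1 : Integrable fun p => kap p * (euler f p * euler g p) :=
    ((hf.euler.mul hg.euler).mul_left fun _ hp => contDiffAt_kap hp).integrable
  have i2 : Integrable fun p => f p * (kap p * (euler (euler g) p + n * euler g p)) :=
    (hf.mul ((hg.euler.euler.add
    (hg.euler.mul_left fun _ _ => contDiffAt_const)).mul_left
      fun _ hp => contDiffAt_kap hp)).integrable
  rw [integral_sub (f := fun p => kap p * (euler f p * euler g p) +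
    f p * (kap p * (euler (euler g) p + n * euler g p))) (i1.add i2) (hF.integrable.const_mul _), integral_add i1 i2,
    integral_const_mul] at hi
  linarith

/-- Green's formula for the angular part of the Grushin operator. -/
theorem integral_mul_angLap (hf : IsTest {0}ᶜ f) (hg : IsTest {0}ᶜ g) :
    ∫ p, f p * angLap g p = -∫ p, gam f g p := by
  have i1 : Integrable fun p => f p * lap g p := (hf.mul hg.lap).integrable
  have i2 : Integrable fun p => f p * (kap p * (euler (euler g) p + n * euler g p)) :=
    (hf.mul ((hg.euler.euler.add
    (hg.euler.mul_left fun _ _ => contDiffAt_const)).mul_left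
      fun _ hp => contDiffAt_kap hp)).integrable
  have i3 : Integrable fun p => ∑ i, dx i f p * dx i g p + ‖p.1‖ ^ 2 * (dt f p * dt g p) :=
    ((IsTest.sum fun i _ => (hf.dx i).mul (hg.dx i)).add
      ((hf.dt.mul hg.dt).mul_left fun _ _ => contDiff_norm_fst_sq.contDiffAt)).integrable
  have i4 : Integrable fun p => kap p * (euler f p * euler g p) :=
    ((hf.euler.mul hg.euler).mul_left fun _ hp => contDiffAt_kap hp).integrable
  have e : ∀ᵐ p : Space n, gam f g p = (∑ i, dx i f p * dx i g p +
      ‖p.1‖ ^ 2 * (dt f p * dt g p)) - kap p * (euler f p * euler g p) := by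
    filter_upwards [ae_ne_zero] with p hp using gam_eq hp f g
  rw [integral_congr_ae e, integral_sub i3 i4]
  simp only [angLap, mul_sub]
  rw [integral_sub i1 i2, integral_mul_lap hf hg, integral_mul_kap_euler hf hg]
  ring

end Parts

end Grushin

end

section

open MeasureTheory ProbabilityTheory Set Filter Topology

namespace Grushin

/-! ### The mixed radial–angular term -/

section Mixed

variable {n : ℕ} {u f g : Space n → ℝ}

/-- The radial part of the Grushin operator divided by `|∇ϱ|²`. -/
noncomputable def radLap (u : Space n → ℝ) (p : Space n) : ℝ :=
  (rho p ^ 2)⁻¹ * (euler (euler u) p + n * euler u p)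

theorem IsTest.radLap (hu : IsTest {0}ᶜ u) : IsTest {0}ᶜ (radLap u) :=
  (hu.euler.euler.add (hu.euler.mul_left fun _ _ => contDiffAt_const)).mul_left
    fun _ hp => contDiffAt_inv_rho_sq hp

theorem lap_eq {p : Space n} (hp : p ≠ 0) (u : Space n → ℝ) :
    lap u p = rho p ^ 2 * kap p * radLap u p + angLap u p := by
  have := rho_pos hp
  rw [angLap, radLap]; field_simp; ring

theorem isTest_gam_div (hf : IsTest {0}ᶜ f) (hg : IsTest {0}ᶜ g) :
    IsTest {0}ᶜ fun p => (rho p ^ 2)⁻¹ * gam f g p :=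
  (isTest_gam hf hg).mul_left fun _ hp => contDiffAt_inv_rho_sq hp

theorem gam_dil (f g : Space n → ℝ) {r : ℝ} (hr : 0 < r) (p : Space n) :
    gam f g (dil r p) = (r ^ 2)⁻¹ * ∑ a, fderiv ℝ f (dil r p) (dil r (angField a p)) *
      fderiv ℝ g (dil r p) (dil r (angField a p)) := by
  simp only [gam, dil_angField hr, map_smul, smul_eq_mul, Finset.mul_sum]
  refine Finset.sum_congr rfl fun a _ => ?_
  field_simp

/-- The factor ϱ⁻² and the pair of angular fields contribute degree -2 each, hence the -4. Otherwise
E passes through the angular derivatives onto f and g. -/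
theorem euler_gam_div (hf : IsTest {0}ᶜ f) (hg : IsTest {0}ᶜ g) (p : Space n) :
    euler (fun p => (rho p ^ 2)⁻¹ * gam f g p) p =
      (rho p ^ 2)⁻¹ * gam (euler f) g p + (rho p ^ 2)⁻¹ * gam f (euler g) p -
        4 * ((rho p ^ 2)⁻¹ * gam f g p) := by
  refine euler_eq_of_hasDerivAt (isTest_gam_div hf hg).differentiable ?_
  have h1 : ∀ a, HasDerivAt (fun r => fderiv ℝ f (dil r p) (dil r (angField a p)) *
      fderiv ℝ g (dil r p) (dil r (angField a p))) _ 1 := fun a =>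
    (hasDerivAt_fderiv_dil (hf.1.of_le (by norm_cast)) one_ne_zero p _).fun_mul
      (hasDerivAt_fderiv_dil (hg.1.of_le (by norm_cast)) one_ne_zero p _)
  have h2 := HasDerivAt.fun_sum (u := Finset.univ) fun a (_ : a ∈ Finset.univ) => h1 a
  have h3 : HasDerivAt (fun r : ℝ => (rho p ^ 2)⁻¹ * (r ^ 4)⁻¹) ((rho p ^ 2)⁻¹ * (-4)) 1 := by
    refine HasDerivAt.const_mul _ ?_
    refine (((hasDerivAt_id' (1 : ℝ)).fun_pow 4).fun_inv (by norm_num)).congr_deriv ?_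
    norm_num
  have h4 := (h3.fun_mul h2).congr_of_eventuallyEq
    (f₁ := fun r => (rho (dil r p) ^ 2)⁻¹ * gam f g (dil r p)) (by
      filter_upwards [lt_mem_nhds one_pos] with r hr
      rw [rho_dil hr.le, gam_dil _ _ hr, mul_pow, mul_inv]
      field_simp)
  refine h4.congr_deriv ?_
  simp only [dil_one, gam, inv_one, one_mul, one_pow, Finset.sum_add_distrib]
  ring

theorem integral_gam_div_euler (hf : IsTest {0}ᶜ f) (hg : IsTest {0}ᶜ g) :
    (∫ p, (rho p ^ 2)⁻¹ * gam (euler f) g p) + ∫ p, (rho p ^ 2)⁻¹ * gam f (euler g) p =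
      (2 - (n : ℝ)) * ∫ p, (rho p ^ 2)⁻¹ * gam f g p := by
  have hi := integral_euler (isTest_gam_div hf hg)
  simp_rw [euler_gam_div hf hg] at hi
  have i1 := (isTest_gam_div hf.euler hg).integrable (μ := volume)
  have i2 := (isTest_gam_div hf hg.euler).integrable (μ := volume)
  have i3 := (isTest_gam_div hf hg).integrable (μ := volume)
  rw [integral_sub (f := fun p => (rho p ^ 2)⁻¹ * gam (euler f) g p +
    (rho p ^ 2)⁻¹ * gam f (euler g) p) (i1.add i2) (i3.const_mul _), integral_add i1 i2,
    integral_const_mul] at hi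
  linarith

/-- Green's formula gives -∫ ϱ⁻² Γ(E²u + nEu, u). Integrating by parts in E twice, on Γ(Eu,u) and on
Γ(u,u), leaves the two symmetric terms. This is an identity, and its right side is nonnegative for n
≥ 2. -/
theorem integral_radLap_mul_angLap (hu : IsTest {0}ᶜ u) :
    ∫ p, radLap u p * angLap u p = (∫ p, (rho p ^ 2)⁻¹ * gam (euler u) (euler u) p) +
      ((n : ℝ) - 2) * ∫ p, (rho p ^ 2)⁻¹ * gam u u p := by
  rw [integral_mul_angLap hu.radLap hu]
  have e : ∀ᵐ p : Space n, gam (radLap u) u p = (rho p ^ 2)⁻¹ * gam (euler (euler u)) u p +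
      n * ((rho p ^ 2)⁻¹ * gam (euler u) u p) := by
    filter_upwards [ae_ne_zero] with p hp
    have hd1 := hu.euler.euler.differentiable p
    have hd2 := hu.euler.differentiable p
    have hc : DifferentiableAt ℝ (fun r : ℝ => (r ^ 2)⁻¹) (rho p) :=
      (differentiableAt_id.pow 2).inv (pow_pos (rho_pos hp) 2).ne'
    have h1 := gam_comp_rho_mul hp hc (hd1.add (hd2.const_mul (n : ℝ))) u
    have h2 : gam (fun q => euler (euler u) q + n * euler u q) u p =
        gam (euler (euler u)) u p + n * gam (euler u) u p := by
      have : fderiv ℝ (fun q => euler (euler u) q + n * euler u q) p =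
          fderiv ℝ (euler (euler u)) p + (n : ℝ) • fderiv ℝ (euler u) p := by
        rw [fderiv_fun_add hd1 (hd2.const_mul _), fderiv_const_mul hd2]
      simp only [gam, this, add_apply, smul_apply, smul_eq_mul, add_mul, Finset.sum_add_distrib,
        Finset.mul_sum, mul_assoc]
    calc gam (radLap u) u p = (rho p ^ 2)⁻¹ * gam (fun q => euler (euler u) q + n * euler u q) u p :=
          h1
      _ = _ := by rw [h2]; ring
  have i1 := (isTest_gam_div hu.euler.euler hu).integrable (μ := volume)
  have i2 := (isTest_gam_div hu.euler hu).integrable (μ := volume)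
  have h1 := integral_gam_div_euler hu.euler hu
  have h2 := integral_gam_div_euler hu hu
  have h3 : ∀ p, gam u (euler u) p = gam (euler u) u p := fun p => gam_comm _ _ p
  simp_rw [h3] at h2
  rw [integral_congr_ae e, integral_add i1 (i2.const_mul _), integral_const_mul]
  linear_combination (-1 : ℝ) * h1 - h2

end Mixed

end Grushin

end

section

open MeasureTheory ProbabilityTheory Set Filter Topology

/-! ### Two weighted inequalities on (0, π) -/

section WeightedInterval

variable {n : ℕ}

theorem sin_pos_of_mem {φ : ℝ} (h : φ ∈ Ioo 0 Real.pi) : 0 < Real.sin φ :=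
  Real.sin_pos_of_pos_of_lt_pi h.1 h.2

theorem sqrt_sin_pos {φ : ℝ} (h : φ ∈ Ioo 0 Real.pi) : 0 < √(Real.sin φ) :=
  Real.sqrt_pos.2 (sin_pos_of_mem h)

theorem sqrt_sin_le_one (φ : ℝ) : √(Real.sin φ) ≤ 1 := Real.sqrt_le_one.2 (Real.sin_le_one φ)

theorem hasDerivAt_sqrt_sin_pow {φ : ℝ} (h : φ ∈ Ioo 0 Real.pi) (k : ℕ) :
    HasDerivAt (fun φ => √(Real.sin φ) ^ k)
      ((k : ℝ) / 2 * Real.cos φ / Real.sin φ * √(Real.sin φ) ^ k) φ := by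
  have hS := sqrt_sin_pos h
  have h2 := Real.sq_sqrt (sin_pos_of_mem h).le
  refine (((Real.hasDerivAt_sin φ).sqrt (sin_pos_of_mem h).ne').fun_pow k).congr_deriv ?_
  rw [show (k : ℝ) / 2 * Real.cos φ / Real.sin φ = (k : ℝ) / 2 * Real.cos φ / √(Real.sin φ) ^ 2 by
    rw [h2]]
  cases k with
  | zero => simp
  | succ k => simp only [Nat.add_sub_cancel]; field_simp; ring

theorem tendsto_sqrt_sin_pow {c : ℝ} (hc : Real.sin c = 0) {k : ℕ} (hk : k ≠ 0) (C : ℝ) :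
    Tendsto (fun φ => C * √(Real.sin φ) ^ k) (𝓝 c) (𝓝 0) := by
  have : Continuous fun φ => C * √(Real.sin φ) ^ k := by fun_prop
  have h := this.tendsto c
  simpa [hc, hk] using h

theorem integrableOn_Ioo_of_bound {Q : ℝ → ℝ} (hQ : Measurable Q) {a b C : ℝ}
    (h : ∀ φ ∈ Ioo a b, |Q φ| ≤ C) : IntegrableOn Q (Ioo a b) :=
  Measure.integrableOn_of_bounded (by simp) hQ.aestronglyMeasurable
    ((ae_restrict_mem measurableSet_Ioo).mono fun φ hφ => h φ hφ)

/-- Hardy-type inequality on `(0, π)` with ground state `√(sin φ)`. -/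
theorem weighted_hardy_sqrt_sin (hn : 2 ≤ n) {g g' : ℝ → ℝ} {C : ℝ} (hg : Measurable g)
    (hg' : Measurable g') (hd : ∀ φ ∈ Ioo 0 Real.pi, HasDerivAt g (g' φ) φ)
    (hC : ∀ φ ∈ Ioo 0 Real.pi, |g φ| ≤ C * √(Real.sin φ))
    (hC' : ∀ φ ∈ Ioo 0 Real.pi, |√(Real.sin φ) * g' φ| ≤ C) :
    0 ≤ ∫ φ in Ioo 0 Real.pi, (√(Real.sin φ) ^ (n - 2) * (√(Real.sin φ) * g' φ) ^ 2 +
      ((n : ℝ) - 1) / 4 * (√(Real.sin φ) ^ (n - 2) * (g φ / √(Real.sin φ)) ^ 2) -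
      ((n : ℝ) + 1) / 4 * (√(Real.sin φ) ^ n * g φ ^ 2)) := by
  have hn' : (2 : ℝ) ≤ n := by exact_mod_cast hn
  have hC2 : ∀ φ ∈ Ioo 0 Real.pi, g φ ^ 2 ≤ C ^ 2 * √(Real.sin φ) ^ 2 := fun φ hφ => by
    rw [← mul_pow, ← sq_abs]; exact pow_le_pow_left₀ (abs_nonneg _) (hC φ hφ) 2
  have hCd : ∀ φ ∈ Ioo 0 Real.pi, (√(Real.sin φ) * g' φ) ^ 2 ≤ C ^ 2 := fun φ hφ => by
    rw [← sq_abs]; exact pow_le_pow_left₀ (abs_nonneg _) (hC' φ hφ) 2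
  have hsplit : ∀ φ, √(Real.sin φ) ^ n = √(Real.sin φ) ^ (n - 2) * √(Real.sin φ) ^ 2 := fun φ => by
    rw [← pow_add, Nat.sub_add_cancel hn]
  have hTb : ∀ φ ∈ Ioo 0 Real.pi,
      ‖Real.cos φ / 2 * √(Real.sin φ) ^ (n - 2) * g φ ^ 2‖ ≤ C ^ 2 * √(Real.sin φ) ^ n := by
    intro φ hφ
    have h1 := Real.abs_cos_le_one φ
    rw [Real.norm_eq_abs, abs_mul, abs_mul, abs_div, abs_of_nonneg (sq_nonneg (g φ)),
      abs_of_nonneg (show 0 ≤ √(Real.sin φ) ^ (n - 2) by positivity), hsplit, abs_two]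
    calc |Real.cos φ| / 2 * √(Real.sin φ) ^ (n - 2) * g φ ^ 2
        ≤ 1 * √(Real.sin φ) ^ (n - 2) * (C ^ 2 * √(Real.sin φ) ^ 2) := by
          gcongr
          · linarith
          · exact hC2 φ hφ
      _ = _ := by ring
  -- With S = √(sin φ) the barrier is S^n g² times cos φ/(2 sin φ), the logarithmic derivative of
  -- the ground state S. The remaining square is S^{n-2} (S g' - cos φ g/(2S))².
  refine setIntegral_Ioo_nonneg_of_deriv_le Real.pi_pos
    (T := fun φ => Real.cos φ / 2 * √(Real.sin φ) ^ (n - 2) * g φ ^ 2)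
    (T' := fun φ => (-Real.sin φ / 2 * √(Real.sin φ) ^ (n - 2) + Real.cos φ / 2 *
      (((n - 2 : ℕ) : ℝ) / 2 * Real.cos φ / Real.sin φ * √(Real.sin φ) ^ (n - 2))) * g φ ^ 2 +
      Real.cos φ / 2 * √(Real.sin φ) ^ (n - 2) * (2 * g φ * g' φ)) ?_ ?_ ?_ ?_ ?_
  · refine integrableOn_Ioo_of_bound (C := C ^ 2 + n * C ^ 2 + n * C ^ 2) ?_ ?_
    · fun_prop
    · intro φ hφ
      have hS := sqrt_sin_pos hφ
      have hS1 := sqrt_sin_le_one φ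
      have p1 : √(Real.sin φ) ^ (n - 2) ≤ 1 := pow_le_one₀ hS.le hS1
      have p2 : √(Real.sin φ) ^ n ≤ 1 := pow_le_one₀ hS.le hS1
      have q1 : (g φ / √(Real.sin φ)) ^ 2 ≤ C ^ 2 := by
        rw [div_pow, div_le_iff₀ (by positivity)]; exact hC2 φ hφ
      have q2 : g φ ^ 2 ≤ C ^ 2 := (hC2 φ hφ).trans
        (mul_le_of_le_one_right (sq_nonneg _) (pow_le_one₀ hS.le hS1))
      have b1 : √(Real.sin φ) ^ (n - 2) * (√(Real.sin φ) * g' φ) ^ 2 ≤ 1 * C ^ 2 :=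
        mul_le_mul p1 (hCd φ hφ) (sq_nonneg _) zero_le_one
      have b2 : √(Real.sin φ) ^ (n - 2) * (g φ / √(Real.sin φ)) ^ 2 ≤ 1 * C ^ 2 :=
        mul_le_mul p1 q1 (sq_nonneg _) zero_le_one
      have b3 : √(Real.sin φ) ^ n * g φ ^ 2 ≤ 1 * C ^ 2 :=
        mul_le_mul p2 q2 (sq_nonneg _) zero_le_one
      have c1 : 0 ≤ √(Real.sin φ) ^ (n - 2) * (√(Real.sin φ) * g' φ) ^ 2 := by positivity
      have c2 : 0 ≤ √(Real.sin φ) ^ (n - 2) * (g φ / √(Real.sin φ)) ^ 2 := by positivity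
      have c3 : 0 ≤ √(Real.sin φ) ^ n * g φ ^ 2 := by positivity
      have d2 : ((n : ℝ) - 1) / 4 * (√(Real.sin φ) ^ (n - 2) * (g φ / √(Real.sin φ)) ^ 2) ≤
          n * (1 * C ^ 2) := mul_le_mul (by linarith) b2 c2 (by linarith)
      have d3 : ((n : ℝ) + 1) / 4 * (√(Real.sin φ) ^ n * g φ ^ 2) ≤ n * (1 * C ^ 2) :=
        mul_le_mul (by linarith) b3 c3 (by linarith)
      have e2 : 0 ≤ ((n : ℝ) - 1) / 4 * (√(Real.sin φ) ^ (n - 2) * (g φ / √(Real.sin φ)) ^ 2) :=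
        mul_nonneg (by linarith) c2
      have e3 : 0 ≤ ((n : ℝ) + 1) / 4 * (√(Real.sin φ) ^ n * g φ ^ 2) :=
        mul_nonneg (by linarith) c3
      rw [abs_le]
      constructor <;> nlinarith
  · intro φ hφ
    have h1 := ((Real.hasDerivAt_cos φ).div_const 2).fun_mul (hasDerivAt_sqrt_sin_pow hφ (n - 2))
    refine (h1.fun_mul ((hd φ hφ).fun_pow 2)).congr_deriv ?_
    simp
  · intro φ hφ
    have hs := sin_pos_of_mem hφ
    have hS := sqrt_sin_pos hφ
    have h2 := Real.sq_sqrt hs.le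
    have hcs := Real.sin_sq_add_cos_sq φ
    rw [hsplit, Nat.cast_sub hn]
    push_cast
    set S := √(Real.sin φ) with hSdef
    have hP : 0 ≤ S ^ (n - 2) := by positivity
    have key : (S ^ (n - 2) * (S * g' φ) ^ 2 + ((n : ℝ) - 1) / 4 * (S ^ (n - 2) * (g φ / S) ^ 2) -
        ((n : ℝ) + 1) / 4 * (S ^ (n - 2) * S ^ 2 * g φ ^ 2)) -
        ((-Real.sin φ / 2 * S ^ (n - 2) + Real.cos φ / 2 *
          (((n : ℝ) - 2) / 2 * Real.cos φ / Real.sin φ * S ^ (n - 2))) * g φ ^ 2 +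
          Real.cos φ / 2 * S ^ (n - 2) * (2 * g φ * g' φ)) =
        S ^ (n - 2) * (S * g' φ - Real.cos φ / (2 * S) * g φ) ^ 2 := by
      rw [← h2] at hcs ⊢
      have hc2 : Real.cos φ ^ 2 = 1 - (S ^ 2) ^ 2 := by linarith
      field_simp
      ring_nf
      simp only [hc2]
      ring
    have : 0 ≤ S ^ (n - 2) * (S * g' φ - Real.cos φ / (2 * S) * g φ) ^ 2 := by positivity
    linarith
  · refine squeeze_zero_norm' (a := fun φ => C ^ 2 * √(Real.sin φ) ^ n) ?_ ?_
    · filter_upwards [Ioo_mem_nhdsGT Real.pi_pos] with φ hφ using hTb φ hφ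
    · exact (tendsto_sqrt_sin_pow Real.sin_zero (by omega) _).mono_left nhdsWithin_le_nhds
  · refine squeeze_zero_norm' (a := fun φ => C ^ 2 * √(Real.sin φ) ^ n) ?_ ?_
    · filter_upwards [Ioo_mem_nhdsLT Real.pi_pos] with φ hφ using hTb φ hφ
    · exact (tendsto_sqrt_sin_pow Real.sin_pi (by omega) _).mono_left nhdsWithin_le_nhds

/-- The ground state is cos φ, with logarithmic derivative -tan φ and eigenvalue n/2 + 1 for the
weight (sin φ)^{n/2}. This exceeds (n+1)/4, so the inequality has room to spare. The zero of cos φ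
at π/2 is why the interval is cut there. -/
theorem weighted_poincare_sqrt_sin_half (hn : 2 ≤ n) {a a' : ℝ → ℝ} {B α β : ℝ}
    (hαβ : α < β) (hsub : Ioo α β ⊆ Ioo 0 Real.pi) (hcos : ∀ φ ∈ Ioo α β, Real.cos φ ≠ 0)
    (hd : ∀ φ ∈ Ioo 0 Real.pi, HasDerivAt a (a' φ) φ)
    (hint : IntegrableOn (fun φ => √(Real.sin φ) ^ (n - 2) * (√(Real.sin φ) * a' φ) ^ 2 -
      ((n : ℝ) + 1) / 4 * (√(Real.sin φ) ^ n * (a φ - B) ^ 2)) (Ioo α β))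
    (hα : Tendsto (fun φ => -(Real.sin φ / Real.cos φ * √(Real.sin φ) ^ n * (a φ - B) ^ 2))
      (𝓝[>] α) (𝓝 0))
    (hβ : Tendsto (fun φ => -(Real.sin φ / Real.cos φ * √(Real.sin φ) ^ n * (a φ - B) ^ 2))
      (𝓝[<] β) (𝓝 0)) :
    0 ≤ ∫ φ in Ioo α β, (√(Real.sin φ) ^ (n - 2) * (√(Real.sin φ) * a' φ) ^ 2 -
      ((n : ℝ) + 1) / 4 * (√(Real.sin φ) ^ n * (a φ - B) ^ 2)) := by
  have hn' : (2 : ℝ) ≤ n := by exact_mod_cast hn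
  refine setIntegral_Ioo_nonneg_of_deriv_le hαβ hint (fun φ hφ => ?_) (fun φ hφ => ?_) hα hβ
    (T' := fun φ => -(((Real.cos φ * Real.cos φ - Real.sin φ * -Real.sin φ) / Real.cos φ ^ 2 *
      √(Real.sin φ) ^ n + Real.sin φ / Real.cos φ * ((n : ℝ) / 2 * Real.cos φ / Real.sin φ *
        √(Real.sin φ) ^ n)) * (a φ - B) ^ 2 +
      Real.sin φ / Real.cos φ * √(Real.sin φ) ^ n * (2 * (a φ - B) * a' φ)))
  · have h1 := ((Real.hasDerivAt_sin φ).fun_div (Real.hasDerivAt_cos φ) (hcos φ hφ)).fun_mul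
      (hasDerivAt_sqrt_sin_pow (hsub hφ) n)
    refine (h1.fun_mul (((hd φ (hsub hφ)).sub_const B).fun_pow 2)).fun_neg.congr_deriv ?_
    simp
  · have hs := sin_pos_of_mem (hsub hφ)
    have hS := sqrt_sin_pos (hsub hφ)
    have hc := hcos φ hφ
    have hcs := Real.sin_sq_add_cos_sq φ
    have e1 : √(Real.sin φ) ^ (n - 2) * (√(Real.sin φ) * a' φ) ^ 2 =
        √(Real.sin φ) ^ n * a' φ ^ 2 := by
      rw [mul_pow, ← mul_assoc, ← pow_add, Nat.sub_add_cancel hn]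
    simp only [e1]
    have hP : 0 ≤ √(Real.sin φ) ^ n := by positivity
    generalize √(Real.sin φ) ^ n = P at hP ⊢
    generalize a φ - B = g
    have e2 : (Real.cos φ * Real.cos φ - Real.sin φ * -Real.sin φ) / Real.cos φ ^ 2 =
        1 + (Real.sin φ / Real.cos φ) ^ 2 := by field_simp; ring
    have e3 : Real.sin φ / Real.cos φ * ((n : ℝ) / 2 * Real.cos φ / Real.sin φ * P) = n / 2 * P := by
      field_simp
    rw [e2, e3]
    generalize Real.sin φ / Real.cos φ = τ
    have k1 : 0 ≤ P * (a' φ + τ * g) ^ 2 := by positivity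
    have k2 : 0 ≤ (1 + (n : ℝ) / 2 - (n + 1) / 4) * (P * g ^ 2) :=
      mul_nonneg (by linarith) (by positivity)
    nlinarith

/-- Poincaré-type inequality on `(0, π)` pinned at the midpoint. -/
theorem weighted_poincare_sqrt_sin (hn : 2 ≤ n) {a a' : ℝ → ℝ} {C : ℝ} (ha : Measurable a)
    (ha' : Measurable a') (hd : ∀ φ ∈ Ioo 0 Real.pi, HasDerivAt a (a' φ) φ)
    (hC : ∀ φ, |a φ| ≤ C) (hC' : ∀ φ ∈ Ioo 0 Real.pi, |√(Real.sin φ) * a' φ| ≤ C) :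
    IntegrableOn (fun φ => √(Real.sin φ) ^ (n - 2) * (√(Real.sin φ) * a' φ) ^ 2 -
      ((n : ℝ) + 1) / 4 * (√(Real.sin φ) ^ n * (a φ - a (Real.pi / 2)) ^ 2)) (Ioo 0 Real.pi) ∧
    0 ≤ ∫ φ in Ioo 0 Real.pi, (√(Real.sin φ) ^ (n - 2) * (√(Real.sin φ) * a' φ) ^ 2 -
      ((n : ℝ) + 1) / 4 * (√(Real.sin φ) ^ n * (a φ - a (Real.pi / 2)) ^ 2)) := by
  have hn' : (2 : ℝ) ≤ n := by exact_mod_cast hn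
  have hpi := Real.pi_pos
  have hC0 : 0 ≤ C := (abs_nonneg _).trans (hC 0)
  have hB : ∀ φ, (a φ - a (Real.pi / 2)) ^ 2 ≤ (2 * C) ^ 2 := fun φ => by
    rw [← sq_abs (a φ - _)]
    refine pow_le_pow_left₀ (abs_nonneg _) ?_ 2
    have := abs_sub (a φ) (a (Real.pi / 2))
    linarith [hC φ, hC (Real.pi / 2)]
  have hint : IntegrableOn (fun φ => √(Real.sin φ) ^ (n - 2) * (√(Real.sin φ) * a' φ) ^ 2 -
      ((n : ℝ) + 1) / 4 * (√(Real.sin φ) ^ n * (a φ - a (Real.pi / 2)) ^ 2)) (Ioo 0 Real.pi) := by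
    refine integrableOn_Ioo_of_bound (C := C ^ 2 + n * (2 * C) ^ 2) (by fun_prop) ?_
    intro φ hφ
    have hS := sqrt_sin_pos hφ
    have hS1 := sqrt_sin_le_one φ
    have p1 : √(Real.sin φ) ^ (n - 2) ≤ 1 := pow_le_one₀ hS.le hS1
    have p2 : √(Real.sin φ) ^ n ≤ 1 := pow_le_one₀ hS.le hS1
    have q : (√(Real.sin φ) * a' φ) ^ 2 ≤ C ^ 2 := by
      rw [← sq_abs]; exact pow_le_pow_left₀ (abs_nonneg _) (hC' φ hφ) 2
    have b1 : √(Real.sin φ) ^ (n - 2) * (√(Real.sin φ) * a' φ) ^ 2 ≤ 1 * C ^ 2 :=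
      mul_le_mul p1 q (sq_nonneg _) zero_le_one
    have b3 : √(Real.sin φ) ^ n * (a φ - a (Real.pi / 2)) ^ 2 ≤ 1 * (2 * C) ^ 2 :=
      mul_le_mul p2 (hB φ) (sq_nonneg _) zero_le_one
    have c1 : 0 ≤ √(Real.sin φ) ^ (n - 2) * (√(Real.sin φ) * a' φ) ^ 2 := by positivity
    have c3 : 0 ≤ √(Real.sin φ) ^ n * (a φ - a (Real.pi / 2)) ^ 2 := by positivity
    have d3 : ((n : ℝ) + 1) / 4 * (√(Real.sin φ) ^ n * (a φ - a (Real.pi / 2)) ^ 2) ≤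
        n * (1 * (2 * C) ^ 2) := mul_le_mul (by linarith) b3 c3 (by linarith)
    have e3 : 0 ≤ ((n : ℝ) + 1) / 4 * (√(Real.sin φ) ^ n * (a φ - a (Real.pi / 2)) ^ 2) :=
      mul_nonneg (by linarith) c3
    rw [abs_le]
    constructor <;> nlinarith
  have hend : ∀ c : ℝ, Real.sin c = 0 → Real.cos c ≠ 0 → Tendsto (fun φ =>
      -(Real.sin φ / Real.cos φ * √(Real.sin φ) ^ n * (a φ - a (Real.pi / 2)) ^ 2)) (𝓝 c) (𝓝 0) := by
    intro c hc hc'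
    have h1 : Tendsto (fun φ => Real.sin φ / Real.cos φ * √(Real.sin φ) ^ n) (𝓝 c) (𝓝 0) := by
      have : ContinuousAt (fun φ => Real.sin φ / Real.cos φ * √(Real.sin φ) ^ n) c :=
        (Real.continuous_sin.continuousAt.div Real.continuous_cos.continuousAt hc').mul (by fun_prop)
      simpa [ContinuousAt, hc] using this
    have h2 := h1.zero_mul_isBoundedUnder_le (g := fun φ => (a φ - a (Real.pi / 2)) ^ 2)
      ⟨(2 * C) ^ 2, by
        rw [eventually_map]
        exact .of_forall fun φ => by
          simpa only [Function.comp, Real.norm_of_nonneg (sq_nonneg _)] using hB φ⟩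
    simpa using h2.neg
  -- At π/2 the simple pole of the tangent meets the double zero of (a - a(π/2))²; dividing
  -- numerator and denominator by φ - π/2 expresses the quotient through slopes.
  have hmid : Tendsto (fun φ =>
      -(Real.sin φ / Real.cos φ * √(Real.sin φ) ^ n * (a φ - a (Real.pi / 2)) ^ 2))
      (𝓝[≠] (Real.pi / 2)) (𝓝 0) := by
    have hm : Real.pi / 2 ∈ Ioo 0 Real.pi := ⟨by linarith, by linarith⟩
    have h1 := (hasDerivAt_iff_tendsto_slope.1 (hd _ hm))
    have h2 := (hasDerivAt_iff_tendsto_slope.1 (Real.hasDerivAt_cos (Real.pi / 2)))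
    have h3 : Tendsto (fun φ => a φ - a (Real.pi / 2)) (𝓝[≠] (Real.pi / 2)) (𝓝 0) := by
      have := (((hd _ hm).continuousAt.sub continuousAt_const).tendsto (f := fun φ =>
        a φ - a (Real.pi / 2)))
      simp only [sub_self] at this
      exact this.mono_left nhdsWithin_le_nhds
    have h4 : Tendsto (fun φ => Real.sin φ * √(Real.sin φ) ^ n) (𝓝[≠] (Real.pi / 2))
        (𝓝 (Real.sin (Real.pi / 2) * √(Real.sin (Real.pi / 2)) ^ n)) :=
      (Continuous.tendsto (by fun_prop) _).mono_left nhdsWithin_le_nhds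
    have h5 := (h4.mul ((h2.inv₀ (by simp)).mul (h1.mul h3))).neg
    simp only [mul_zero, neg_zero] at h5
    refine h5.congr' ?_
    filter_upwards [self_mem_nhdsWithin] with φ hφ
    have hne : φ - Real.pi / 2 ≠ 0 := sub_ne_zero.2 hφ
    rw [slope_def_field, slope_def_field, Real.cos_pi_div_two, sub_zero]
    by_cases hc : Real.cos φ = 0
    · simp [hc]
    · generalize φ - Real.pi / 2 = d at hne ⊢
      field_simp
  refine ⟨hint, ?_⟩
  have hs1 : Ioo 0 (Real.pi / 2) ⊆ Ioo 0 Real.pi := Ioo_subset_Ioo_right (by linarith)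
  have hs2 : Ioo (Real.pi / 2) Real.pi ⊆ Ioo 0 Real.pi := Ioo_subset_Ioo_left (by linarith)
  have hl : 𝓝[<] (Real.pi / 2) ≤ 𝓝[≠] (Real.pi / 2) := nhdsWithin_mono _ fun x hx => ne_of_lt hx
  have hr : 𝓝[>] (Real.pi / 2) ≤ 𝓝[≠] (Real.pi / 2) := nhdsWithin_mono _ fun x hx => ne_of_gt hx
  have k1 := weighted_poincare_sqrt_sin_half hn (by linarith) hs1 (fun φ hφ =>
    (Real.cos_pos_of_mem_Ioo ⟨by linarith [hφ.1], hφ.2⟩).ne') hd (hint.mono_set hs1)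
    ((hend 0 (by simp) (by simp)).mono_left nhdsWithin_le_nhds) (hmid.mono_left hl)
  have k2 := weighted_poincare_sqrt_sin_half hn (by linarith) hs2 (fun φ hφ =>
    (Real.cos_neg_of_pi_div_two_lt_of_lt hφ.1 (by linarith [hφ.2])).ne) hd (hint.mono_set hs2)
    (hmid.mono_left hr) ((hend _ (by simp) (by simp)).mono_left nhdsWithin_le_nhds)
  rw [← Ioc_union_Ioo_eq_Ioo (b := Real.pi / 2) (by linarith) (by linarith), setIntegral_union
    (Set.disjoint_left.2 fun x hx hy => absurd hx.2 (not_le.2 hy.1)) measurableSet_Ioo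
    (hint.mono_set fun x hx => ⟨hx.1, by linarith [hx.2]⟩) (hint.mono_set hs2),
    integral_Ioc_eq_integral_Ioo]
  exact add_nonneg k1 k2

end WeightedInterval

end

section

open MeasureTheory ProbabilityTheory Set Filter Topology

/-! ### Averages over ω combined with the polar angle -/

section AveragedInequality

variable {Ω : Type*} [MeasurableSpace Ω] {σ : Measure Ω} [IsFiniteMeasure σ] {n : ℕ}

theorem abs_average_le {f : Ω → ℝ} {C : ℝ} (hC : 0 ≤ C) (hf : ∀ ω, ‖f ω‖ ≤ C) :
    |⨍ ω, f ω ∂σ| ≤ C := by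
  have h := norm_integral_le_of_norm_le_const (μ := σ) (.of_forall hf)
  rw [average_eq, smul_eq_mul, abs_mul, abs_of_nonneg (by positivity)]
  calc (σ.real univ)⁻¹ * |∫ ω, f ω ∂σ| ≤ (σ.real univ)⁻¹ * (C * σ.real univ) := by gcongr; exact h
    _ = C * ((σ.real univ)⁻¹ * σ.real univ) := by ring
    _ ≤ C * 1 := by gcongr; exact inv_mul_le_one
    _ = C := mul_one C

theorem integral_sub_const_sq {f : Ω → ℝ} {C : ℝ} (hm : Measurable f) (hf : ∀ ω, |f ω| ≤ C)
    (c : ℝ) : ∫ ω, (f ω - c) ^ 2 ∂σ =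
      ∫ ω, (f ω - ⨍ ω', f ω' ∂σ) ^ 2 ∂σ + σ.real univ * ((⨍ ω', f ω' ∂σ) - c) ^ 2 := by
  set A := ⨍ ω', f ω' ∂σ with hA
  have hi : Integrable (fun ω => f ω - A) σ :=
    (Integrable.of_bound hm.aestronglyMeasurable C (.of_forall hf)).sub (integrable_const A)
  have hi2 : Integrable (fun ω => (f ω - A) ^ 2) σ := by
    refine .of_bound (C := (C + |A|) ^ 2) (by fun_prop) (.of_forall fun ω => ?_)
    rw [Real.norm_eq_abs, abs_pow]
    exact pow_le_pow_left₀ (abs_nonneg _) ((abs_sub _ _).trans (by linarith [hf ω])) 2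
  have h0 := integral_sub_average σ f
  rw [← hA] at h0
  have : ∀ ω, (f ω - c) ^ 2 = (f ω - A) ^ 2 + (2 * (A - c) * (f ω - A) + (A - c) ^ 2) :=
    fun ω => by ring
  simp_rw [this]
  rw [integral_add hi2 ((hi.const_mul _).fun_add (integrable_const _)),
    integral_add (hi.const_mul _) (integrable_const _), integral_const_mul, h0]
  simp

/-- Measurable functions of `(ω, φ)` that are bounded for `φ ∈ (0, π)`. -/
def BddOnAngle (F : Ω × ℝ → ℝ) : Prop :=
  Measurable F ∧ ∃ C, ∀ p, p.2 ∈ Ioo 0 Real.pi → |F p| ≤ C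

namespace BddOnAngle

variable {F G : Ω × ℝ → ℝ}

theorem const (c : ℝ) : BddOnAngle fun _ : Ω × ℝ => c := ⟨measurable_const, |c|, fun _ _ => le_rfl⟩

theorem sqrt_sin : BddOnAngle fun p : Ω × ℝ => √(Real.sin p.2) :=
  ⟨by fun_prop, 1, fun p _ => by
    rw [abs_of_nonneg (Real.sqrt_nonneg _)]; exact sqrt_sin_le_one _⟩

theorem add (hF : BddOnAngle F) (hG : BddOnAngle G) : BddOnAngle fun p => F p + G p := by
  obtain ⟨hF, C, hC⟩ := hF
  obtain ⟨hG, D, hD⟩ := hG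
  exact ⟨hF.add hG, C + D, fun p hp => (abs_add_le _ _).trans (add_le_add (hC p hp) (hD p hp))⟩

theorem sub (hF : BddOnAngle F) (hG : BddOnAngle G) : BddOnAngle fun p => F p - G p := by
  obtain ⟨hF, C, hC⟩ := hF
  obtain ⟨hG, D, hD⟩ := hG
  exact ⟨hF.sub hG, C + D, fun p hp => (abs_sub _ _).trans (add_le_add (hC p hp) (hD p hp))⟩

theorem mul (hF : BddOnAngle F) (hG : BddOnAngle G) : BddOnAngle fun p => F p * G p := by
  obtain ⟨hF, C, hC⟩ := hF
  obtain ⟨hG, D, hD⟩ := hG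
  refine ⟨hF.mul hG, C * D, fun p hp => ?_⟩
  rw [abs_mul]
  exact mul_le_mul (hC p hp) (hD p hp) (abs_nonneg _) ((abs_nonneg _).trans (hC p hp))

theorem pow (hF : BddOnAngle F) (k : ℕ) : BddOnAngle fun p => F p ^ k := by
  obtain ⟨hF, C, hC⟩ := hF
  refine ⟨hF.pow_const k, C ^ k, fun p hp => ?_⟩
  rw [abs_pow]
  exact pow_le_pow_left₀ (abs_nonneg _) (hC p hp) k

theorem integrable (hF : BddOnAngle F) :
    Integrable F (σ.prod (volume.restrict (Ioo 0 Real.pi))) := by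
  obtain ⟨hF, C, hC⟩ := hF
  refine .of_bound hF.aestronglyMeasurable C ?_
  have : ∀ᵐ p ∂σ.prod (volume.restrict (Ioo 0 Real.pi)), p.2 ∈ Ioo 0 Real.pi :=
    Measure.quasiMeasurePreserving_snd.ae (ae_restrict_mem measurableSet_Ioo)
  filter_upwards [this] with p hp using hC p hp

theorem integrable_left (hF : BddOnAngle F) {φ : ℝ} (hφ : φ ∈ Ioo 0 Real.pi) :
    Integrable (fun ω => F (ω, φ)) σ := by
  obtain ⟨hF, C, hC⟩ := hF
  exact .of_bound (hF.comp (by fun_prop)).aestronglyMeasurable C (.of_forall fun ω => hC _ hφ)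

end BddOnAngle

theorem measurable_average {F : Ω × ℝ → ℝ} (hF : Measurable F) :
    Measurable fun φ => ⨍ ω, F (ω, φ) ∂σ := by
  simp_rw [average_eq, smul_eq_mul]
  exact (hF.stronglyMeasurable.integral_prod_left' (μ := σ)).measurable.const_mul _

theorem hasDerivAt_average {V V' : Ω × ℝ → ℝ} {C : ℝ} (hV : Measurable V) (hV' : Measurable V')
    (hC : ∀ p, |V p| ≤ C) (hC' : ∀ p, p.2 ∈ Ioo 0 Real.pi → |√(Real.sin p.2) * V' p| ≤ C)
    (hd : ∀ ω, ∀ φ ∈ Ioo 0 Real.pi, HasDerivAt (fun φ => V (ω, φ)) (V' (ω, φ)) φ)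
    {φ : ℝ} (hφ : φ ∈ Ioo 0 Real.pi) :
    HasDerivAt (fun φ => ⨍ ω, V (ω, φ) ∂σ) (⨍ ω, V' (ω, φ) ∂σ) φ := by
  simp_rw [average_eq, smul_eq_mul]
  refine HasDerivAt.const_mul _ ?_
  have hS := sqrt_sin_pos hφ
  -- The derivative may blow up like 1/√(sin φ) at the poles. It has a uniform bound where √(sin x)
  -- exceeds half its value at φ.
  have hmem : {x | x ∈ Ioo 0 Real.pi ∧ √(Real.sin φ) / 2 < √(Real.sin x)} ∈ 𝓝 φ := by
    refine inter_mem (isOpen_Ioo.mem_nhds hφ) ?_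
    have : Continuous fun x => √(Real.sin x) := by fun_prop
    exact (isOpen_lt continuous_const this).mem_nhds (by simpa using hS)
  refine (hasDerivAt_integral_of_dominated_loc_of_deriv_le (F := fun φ ω => V (ω, φ))
    (F' := fun φ ω => V' (ω, φ)) (bound := fun _ => C / (√(Real.sin φ) / 2)) hmem
    (.of_forall fun x => (hV.comp (by fun_prop)).aestronglyMeasurable)
    (.of_bound (hV.comp (by fun_prop)).aestronglyMeasurable C (.of_forall fun ω => hC _))
    (hV'.comp (by fun_prop)).aestronglyMeasurable (.of_forall fun ω x hx => ?_)
    (integrable_const _) (.of_forall fun ω x hx => hd ω x hx.1)).2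
  have h1 := hC' (ω, x) hx.1
  rw [abs_mul, abs_of_nonneg (Real.sqrt_nonneg _)] at h1
  rw [le_div_iff₀ (by positivity), Real.norm_eq_abs, mul_comm]
  exact (mul_le_mul_of_nonneg_right hx.2.le (abs_nonneg _)).trans h1

/-- Let a(φ) be the average of V over ω. Cross terms between a and V - a integrate to zero. For V -
a, `hVK` converts K into the singular potential (n-1)/sin φ required by `weighted_hardy_sqrt_sin`;
for a, `weighted_poincare_sqrt_sin` applies. The hypothesis `hv` forces V - a = O(√(sin φ)), so that
this potential term stays bounded. -/
theorem averaged_angular_poincare (hn : 2 ≤ n) (hσ : σ ≠ 0) {V V' K : Ω × ℝ → ℝ} {v : ℝ → ℝ}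
    {C : ℝ} (hV : Measurable V) (hV' : Measurable V') (hK : BddOnAngle K) (hC : ∀ p, |V p| ≤ C)
    (hC' : ∀ p, p.2 ∈ Ioo 0 Real.pi → |√(Real.sin p.2) * V' p| ≤ C)
    (hv : ∀ p, |V p - v p.2| ≤ C * √(Real.sin p.2))
    (hd : ∀ ω, ∀ φ ∈ Ioo 0 Real.pi, HasDerivAt (fun φ => V (ω, φ)) (V' (ω, φ)) φ)
    (hVK : ∀ φ ∈ Ioo 0 Real.pi, ((n : ℝ) - 1) * ∫ ω, (V (ω, φ) - ⨍ ω', V (ω', φ) ∂σ) ^ 2 ∂σ ≤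
      √(Real.sin φ) ^ 2 * ∫ ω, K (ω, φ) ∂σ) :
    0 ≤ ∫ φ in Ioo 0 Real.pi, √(Real.sin φ) ^ (n - 2) / 2 *
      ∫ ω, (4 * (√(Real.sin φ) * V' (ω, φ)) ^ 2 + K (ω, φ) -
        (n + 1) * (√(Real.sin φ) ^ 2 * (V (ω, φ) - ⨍ ω', V (ω', Real.pi / 2) ∂σ) ^ 2)) ∂σ := by
  have hC0 : 0 ≤ C := by
    obtain ⟨ω⟩ : Nonempty Ω := by
      by_contra h
      rw [not_nonempty_iff] at h
      exact hσ (Measure.eq_zero_of_isEmpty σ)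
    exact (abs_nonneg _).trans (hC (ω, 0))
  set a : ℝ → ℝ := fun φ => ⨍ ω, V (ω, φ) ∂σ with ha
  set a' : ℝ → ℝ := fun φ => ⨍ ω, V' (ω, φ) ∂σ with ha'
  set m := σ.real univ with hm
  have hm0 : m ≠ 0 := by
    rw [hm, measureReal_def]
    exact (ENNReal.toReal_pos (by simpa using hσ) (measure_ne_top _ _)).ne'
  have hma : Measurable a := measurable_average hV
  have hma' : Measurable a' := measurable_average hV'
  have hda : ∀ φ ∈ Ioo 0 Real.pi, HasDerivAt a (a' φ) φ := fun φ hφ =>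
    hasDerivAt_average hV hV' hC hC' hd hφ
  have haC : ∀ φ, |a φ| ≤ C := fun φ => abs_average_le hC0 fun ω => hC _
  have haC' : ∀ φ ∈ Ioo 0 Real.pi, |√(Real.sin φ) * a' φ| ≤ C := fun φ hφ => by
    have h1 : √(Real.sin φ) * a' φ = ⨍ ω, √(Real.sin φ) * V' (ω, φ) ∂σ := by
      simp only [ha', average_eq, integral_const_mul, smul_eq_mul]; ring
    rw [h1]
    exact abs_average_le hC0 fun ω => hC' (ω, φ) hφ
  have hav : ∀ φ, |a φ - v φ| ≤ C * √(Real.sin φ) := fun φ => by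
    have hi : Integrable (fun ω => V (ω, φ)) σ :=
      .of_bound (hV.comp (by fun_prop)).aestronglyMeasurable C (.of_forall fun ω => hC _)
    have h1 : a φ - v φ = ⨍ ω, (V (ω, φ) - v φ) ∂σ := by
      simp only [ha, average_eq, smul_eq_mul]
      rw [integral_sub hi (integrable_const _), integral_const, smul_eq_mul, ← hm]
      field_simp
    rw [h1]
    exact abs_average_le (by positivity) fun ω => hv (ω, φ)
  have hVa : ∀ ω φ, |V (ω, φ) - a φ| ≤ 2 * C * √(Real.sin φ) := fun ω φ => by
    have h1 := abs_sub_le (V (ω, φ)) (v φ) (a φ)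
    rw [abs_sub_comm (v φ)] at h1
    linarith [hv (ω, φ), hav φ]
  have hVa' : ∀ ω, ∀ φ ∈ Ioo 0 Real.pi, |√(Real.sin φ) * (V' (ω, φ) - a' φ)| ≤ 2 * C := by
    intro ω φ hφ
    rw [mul_sub]
    exact (abs_sub _ _).trans (by linarith [hC' (ω, φ) hφ, haC' φ hφ])
  set J0 : ℝ → ℝ := fun φ => √(Real.sin φ) ^ (n - 2) * (√(Real.sin φ) * a' φ) ^ 2 -
      ((n : ℝ) + 1) / 4 * (√(Real.sin φ) ^ n * (a φ - a (Real.pi / 2)) ^ 2) with hJ0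
  obtain ⟨hJ0i, hJ0p⟩ := weighted_poincare_sqrt_sin hn hma hma' hda haC haC'
  set J1 : Ω × ℝ → ℝ := fun p => √(Real.sin p.2) ^ (n - 2) *
      (√(Real.sin p.2) * (V' p - a' p.2)) ^ 2 +
      ((n : ℝ) - 1) / 4 * (√(Real.sin p.2) ^ (n - 2) * ((V p - a p.2) / √(Real.sin p.2)) ^ 2) -
      ((n : ℝ) + 1) / 4 * (√(Real.sin p.2) ^ n * (V p - a p.2) ^ 2) with hJ1
  have bV : BddOnAngle V := ⟨hV, C, fun p _ => hC p⟩
  have ba : BddOnAngle fun p : Ω × ℝ => a p.2 := ⟨by fun_prop, C, fun p _ => haC p.2⟩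
  have bV' : BddOnAngle fun p => √(Real.sin p.2) * V' p := ⟨by fun_prop, C, hC'⟩
  have bd : BddOnAngle fun p => √(Real.sin p.2) * (V' p - a' p.2) :=
    ⟨by fun_prop, 2 * C, fun p hp => hVa' p.1 p.2 hp⟩
  have bq : BddOnAngle fun p => (V p - a p.2) / √(Real.sin p.2) :=
    ⟨by fun_prop, 2 * C, fun p hp => by
      have := sqrt_sin_pos hp
      rw [abs_div, abs_of_pos this, div_le_iff₀ this]; exact hVa p.1 p.2⟩
  have bJ1 : BddOnAngle J1 := ((((BddOnAngle.sqrt_sin.pow _).mul (bd.pow 2)).add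
    ((BddOnAngle.const _).mul ((BddOnAngle.sqrt_sin.pow _).mul (bq.pow 2)))).sub
    ((BddOnAngle.const _).mul ((BddOnAngle.sqrt_sin.pow _).mul ((bV.sub ba).pow 2))))
  have bF : BddOnAngle fun p => √(Real.sin p.2) ^ (n - 2) * 2⁻¹ *
      (4 * (√(Real.sin p.2) * V' p) ^ 2 + K p -
        (n + 1) * (√(Real.sin p.2) ^ 2 * (V p - a (Real.pi / 2)) ^ 2)) :=
    ((BddOnAngle.sqrt_sin.pow _).mul (.const _)).mul ((((BddOnAngle.const 4).mul
      (bV'.pow 2)).add hK).sub ((BddOnAngle.const _).mul ((BddOnAngle.sqrt_sin.pow 2).mul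
        ((bV.sub (.const _)).pow 2))))
  have hJ1p : 0 ≤ ∫ φ in Ioo 0 Real.pi, ∫ ω, J1 (ω, φ) ∂σ := by
    rw [← integral_integral_swap (f := fun ω φ => J1 (ω, φ)) bJ1.integrable]
    refine integral_nonneg fun ω => ?_
    exact weighted_hardy_sqrt_sin hn (g := fun φ => V (ω, φ) - a φ)
      (g' := fun φ => V' (ω, φ) - a' φ) (C := 2 * C) ((hV.comp (by fun_prop)).sub hma)
      ((hV'.comp (by fun_prop)).sub hma') (fun φ hφ => (hd ω φ hφ).sub (hda φ hφ))
      (fun φ _ => hVa ω φ) (fun φ hφ => hVa' ω φ hφ)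
  have hi1 : IntegrableOn (fun φ => 2 * ∫ ω, J1 (ω, φ) ∂σ) (Ioo 0 Real.pi) :=
    bJ1.integrable.integral_prod_right.const_mul 2
  have hi0 : IntegrableOn (fun φ => 2 * m * J0 φ) (Ioo 0 Real.pi) := hJ0i.const_mul _
  -- The factor 2 is the 4 in front of the polar derivative times the 1/2 in the density.
  have hnn : 0 ≤ ∫ φ in Ioo 0 Real.pi, (2 * ∫ ω, J1 (ω, φ) ∂σ) + 2 * m * J0 φ := by
    rw [integral_add hi1 hi0, integral_const_mul, integral_const_mul]
    have : 0 ≤ m := measureReal_nonneg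
    positivity
  refine hnn.trans (setIntegral_mono_on (hi1.add hi0) ?_ measurableSet_Ioo fun φ hφ => ?_)
  · have := bF.integrable.integral_prod_right (μ := σ)
    simp only [integral_const_mul] at this
    exact this
  · have hS := sqrt_sin_pos hφ
    set S := √(Real.sin φ) with hSd
    have hP : 0 ≤ S ^ (n - 2) := by positivity
    have hsplit : S ^ n = S ^ (n - 2) * S ^ 2 := by rw [← pow_add, Nat.sub_add_cancel hn]
    have iV' : Integrable (fun ω => (S * V' (ω, φ)) ^ 2) σ := (bV'.pow 2).integrable_left hφ
    have iK : Integrable (fun ω => K (ω, φ)) σ := hK.integrable_left hφ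
    have iVc : Integrable (fun ω => (V (ω, φ) - a (Real.pi / 2)) ^ 2) σ :=
      ((bV.sub (.const _)).pow 2).integrable_left hφ
    have iVa : Integrable (fun ω => (V (ω, φ) - a φ) ^ 2) σ :=
      ((bV.sub ba).pow 2).integrable_left hφ
    have iD : Integrable (fun ω => (S * (V' (ω, φ) - a' φ)) ^ 2) σ :=
      (bd.pow 2).integrable_left hφ
    have e1 : ∫ ω, (4 * (S * V' (ω, φ)) ^ 2 + K (ω, φ) -
        (n + 1) * (S ^ 2 * (V (ω, φ) - a (Real.pi / 2)) ^ 2)) ∂σ =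
        4 * (∫ ω, (S * V' (ω, φ)) ^ 2 ∂σ) + (∫ ω, K (ω, φ) ∂σ) -
        (n + 1) * (S ^ 2 * ∫ ω, (V (ω, φ) - a (Real.pi / 2)) ^ 2 ∂σ) := by
      rw [integral_sub ((iV'.const_mul 4).fun_add iK) ((iVc.const_mul _).const_mul _),
        integral_add (iV'.const_mul 4) iK, integral_const_mul, integral_const_mul,
        integral_const_mul]
    have e2 : ∫ ω, (S * V' (ω, φ)) ^ 2 ∂σ =
        ∫ ω, (S * (V' (ω, φ) - a' φ)) ^ 2 ∂σ + m * (S * a' φ) ^ 2 := by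
      have := integral_sub_const_sq (σ := σ) (f := fun ω => S * V' (ω, φ))
        ((hV'.comp (by fun_prop)).const_mul S) (fun ω => hC' (ω, φ) hφ) 0
      have h2 : ⨍ ω, S * V' (ω, φ) ∂σ = S * a' φ := by
        simp only [ha', average_eq, integral_const_mul, smul_eq_mul]; ring
      rw [h2] at this
      simpa only [sub_zero, mul_sub] using this
    have e3 : ∫ ω, (V (ω, φ) - a (Real.pi / 2)) ^ 2 ∂σ =
        ∫ ω, (V (ω, φ) - a φ) ^ 2 ∂σ + m * (a φ - a (Real.pi / 2)) ^ 2 :=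
      integral_sub_const_sq (hV.comp (by fun_prop)) (fun ω => hC (ω, φ)) _
    have e4 : ∫ ω, J1 (ω, φ) ∂σ = S ^ (n - 2) * (∫ ω, (S * (V' (ω, φ) - a' φ)) ^ 2 ∂σ) +
        ((n : ℝ) - 1) / 4 * (S ^ (n - 2) * ((∫ ω, (V (ω, φ) - a φ) ^ 2 ∂σ) / S ^ 2)) -
        ((n : ℝ) + 1) / 4 * (S ^ n * ∫ ω, (V (ω, φ) - a φ) ^ 2 ∂σ) := by
      simp only [hJ1, div_pow, ← hSd]
      rw [integral_sub ((iD.const_mul _).fun_add (((iVa.div_const _).const_mul _).const_mul _))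
        ((iVa.const_mul _).const_mul _), integral_add (iD.const_mul _)
        (((iVa.div_const _).const_mul _).const_mul _), integral_const_mul, integral_const_mul,
        integral_const_mul, integral_const_mul, integral_const_mul, integral_div]
    have hk := hVK φ hφ
    simp only [hJ0, ← hSd]
    rw [e1, e2, e3, e4, hsplit]
    change ((n : ℝ) - 1) * ∫ ω, (V (ω, φ) - a φ) ^ 2 ∂σ ≤ _ at hk
    generalize (∫ ω, (V (ω, φ) - a φ) ^ 2 ∂σ) = X at hk ⊢
    generalize (∫ ω, (S * (V' (ω, φ) - a' φ)) ^ 2 ∂σ) = Y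
    generalize (∫ ω, K (ω, φ) ∂σ) = Z at hk ⊢
    have hk' : ((n : ℝ) - 1) * (X / S ^ 2) ≤ Z := by
      rw [← mul_div_assoc, div_le_iff₀ (by positivity)]; linarith
    have := mul_le_mul_of_nonneg_left hk' hP
    linarith

end AveragedInequality

end

section

open MeasureTheory ProbabilityTheory Set Filter Topology

namespace Grushin

/-! ### Spectral gap of the gauge sphere -/

section GaugeSphere

variable {n : ℕ}

theorem continuous_pol : Continuous (pol : Ang n → Space n) := by
  unfold pol
  fun_prop

theorem norm_pol_fst (θ : Ang n) : ‖(pol θ).1‖ = √(Real.sin θ.2) := by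
  simp [pol, norm_smul]

theorem rho_pol {θ : Ang n} (h : θ.2 ∈ Ioo 0 Real.pi) : rho (pol θ) = 1 := by
  refine rho_eq_of_pow_four zero_le_one ?_
  have h1 := Real.sq_sqrt (sin_pos_of_mem h).le
  have h2 := Real.sin_sq_add_cos_sq θ.2
  rw [norm_pol_fst]
  simp only [pol]
  calc √(Real.sin θ.2) ^ 4 + 4 * (Real.cos θ.2 / 2) ^ 2
      = (√(Real.sin θ.2) ^ 2) ^ 2 + Real.cos θ.2 ^ 2 := by ring
    _ = 1 ^ 4 := by rw [h1, h2]; norm_num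

theorem kap_pol {θ : Ang n} (h : θ.2 ∈ Ioo 0 Real.pi) :
    kap (pol θ) = √(Real.sin θ.2) ^ 2 := by
  rw [kap, rho_pol h, norm_pol_fst]; simp

theorem pol_ne_zero {θ : Ang n} (h : θ.2 ∈ Ioo 0 Real.pi) : pol θ ≠ 0 := by
  intro h0
  have := rho_pol h
  rw [h0, rho_zero] at this
  norm_num at this

theorem toSphere_ne_zero (hn : 2 ≤ n) :
    (volume : Measure (EuclideanSpace ℝ (Fin n))).toSphere ≠ 0 := by
  have : Nonempty (Fin n) := ⟨⟨0, by omega⟩⟩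
  exact Measure.toSphere_ne_zero volume

theorem ae_angMeasure_mem : ∀ᵐ θ ∂angMeasure n, θ.2 ∈ Ioo 0 Real.pi :=
  Measure.quasiMeasurePreserving_snd.ae ae_polarAngle_mem

theorem _root_.BddOnAngle.integrable_angMeasure {F : Ang n → ℝ} (hF : BddOnAngle F) :
    Integrable F (angMeasure n) := by
  obtain ⟨hF, C, hC⟩ := hF
  refine .of_bound hF.aestronglyMeasurable C ?_
  filter_upwards [ae_angMeasure_mem] with p hp using hC p hp

/-- The derivative of `w ∘ pol` with respect to the polar angle. -/
noncomputable def polDeriv (w : Space n → ℝ) (θ : Ang n) : ℝ :=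
  Real.cos θ.2 / (2 * √(Real.sin θ.2)) * fderiv ℝ w (pol θ) (θ.1, 0) -
    Real.sin θ.2 / 2 * fderiv ℝ w (pol θ) (0, 1)

/-- The squared norm of the tangential part of the `x`-gradient. -/
noncomputable def sphereGradSq (w : Space n → ℝ) (θ : Ang n) : ℝ :=
  ∑ i, fderiv ℝ w (pol θ) (EuclideanSpace.single i 1, 0) ^ 2 - fderiv ℝ w (pol θ) (θ.1, 0) ^ 2

/-- In the plane spanned by the directions x/|x| and t, removing the Euler direction leaves only the
polar angle; the directions tangent to the x-sphere are untouched. -/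
theorem gam_pol {w : Space n → ℝ} {θ : Ang n} (h : θ.2 ∈ Ioo 0 Real.pi) :
    gam w w (pol θ) = 4 * (√(Real.sin θ.2) * polDeriv w θ) ^ 2 + sphereGradSq w θ := by
  have hS := sqrt_sin_pos h
  have h1 := Real.sq_sqrt (sin_pos_of_mem h).le
  have h2 := Real.sin_sq_add_cos_sq θ.2
  have he : eul (pol θ) = √(Real.sin θ.2) • (((θ.1 : EuclideanSpace ℝ (Fin n)), 0) : Space n) +
      Real.cos θ.2 • ((0, 1) : Space n) := by
    simp only [eul, pol]
    refine Prod.ext ?_ ?_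
    · simp
    · simp; ring
  rw [gam_eq (pol_ne_zero h), euler, he, map_add, map_smul, map_smul, kap_pol h, norm_pol_fst,
    polDeriv, sphereGradSq]
  simp only [dx, dt, smul_eq_mul]
  generalize fderiv ℝ w (pol θ) (θ.1, 0) = X
  generalize fderiv ℝ w (pol θ) (0, 1) = T
  have e1 : √(Real.sin θ.2) * (Real.cos θ.2 / (2 * √(Real.sin θ.2)) * X -
      Real.sin θ.2 / 2 * T) = (Real.cos θ.2 * X - √(Real.sin θ.2) * Real.sin θ.2 * T) / 2 := by
    field_simp
  simp only [← sq]
  rw [e1]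
  generalize √(Real.sin θ.2) = S at h1
  rw [← h1] at h2 ⊢
  have hc : Real.cos θ.2 ^ 2 = 1 - (S ^ 2) ^ 2 := by linarith
  ring_nf
  simp only [hc]
  ring

theorem hasDerivAt_comp_pol {w : Space n → ℝ} (hw : Differentiable ℝ w)
    (ω : Metric.sphere (0 : EuclideanSpace ℝ (Fin n)) 1) {φ : ℝ} (h : φ ∈ Ioo 0 Real.pi) :
    HasDerivAt (fun φ => w (pol (ω, φ))) (polDeriv w (ω, φ)) φ := by
  have h1 := (((Real.hasDerivAt_sin φ).sqrt (sin_pos_of_mem h).ne').smul_const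
    (ω : EuclideanSpace ℝ (Fin n))).prodMk ((Real.hasDerivAt_cos φ).div_const 2)
  refine ((hw _).hasFDerivAt.comp_hasDerivAt φ (f := fun φ => pol (ω, φ)) h1).congr_deriv ?_
  have : ((Real.cos φ / (2 * √(Real.sin φ))) • (ω : EuclideanSpace ℝ (Fin n)),
      -Real.sin φ / 2) = (Real.cos φ / (2 * √(Real.sin φ))) •
        (((ω : EuclideanSpace ℝ (Fin n)), 0) : Space n) + (-Real.sin φ / 2) • (0, 1) := by
    refine Prod.ext ?_ ?_ <;> simp
  rw [this, map_add, map_smul, map_smul, polDeriv]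
  simp only [smul_eq_mul]
  ring

/-- The constant n + 1 = 4λ₁ is attained by the coordinates x_i, equal to √(sin φ) ω_i on the gauge
sphere. Subtracting the equatorial average rather than the mean is harmless later, because every
radial function is orthogonal to the angular operator. -/
theorem gauge_sphere_poincare (hn : 2 ≤ n) {w : Space n → ℝ} (hw : ContDiff ℝ 1 w) {B : ℝ}
    (hB : ∀ p, |w p| ≤ B) (hB' : ∀ p, ‖fderiv ℝ w p‖ ≤ B) :
    (n + 1) * ∫ θ, kap (pol θ) * (w (pol θ) -
      ⨍ ω : Metric.sphere (0 : EuclideanSpace ℝ (Fin n)) 1, w (ω, 0)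
        ∂(volume : Measure (EuclideanSpace ℝ (Fin n))).toSphere) ^ 2 ∂angMeasure n ≤
      ∫ θ, gam w w (pol θ) ∂angMeasure n := by
  set σ := (volume : Measure (EuclideanSpace ℝ (Fin n))).toSphere with hσ
  have hB0 : 0 ≤ B := (abs_nonneg _).trans (hB 0)
  have hdiff := hw.differentiable one_ne_zero
  have hD : Continuous fun θ : Ang n => fderiv ℝ w (pol θ) :=
    (hw.continuous_fderiv one_ne_zero).comp continuous_pol
  have hap : ∀ (θ : Ang n) (v : Space n), ‖v‖ ≤ 1 → |fderiv ℝ w (pol θ) v| ≤ B := fun θ v hv =>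
    ((fderiv ℝ w (pol θ)).le_opNorm v).trans (by
      nlinarith [hB' (pol θ), norm_nonneg (fderiv ℝ w (pol θ)), norm_nonneg v])
  have n1 : ∀ i, ‖((EuclideanSpace.single i 1, 0) : Space n)‖ ≤ 1 := fun i => by
    simp [Prod.norm_def]
  have n2 : ∀ ω : Metric.sphere (0 : EuclideanSpace ℝ (Fin n)) 1,
      ‖((ω, 0) : Space n)‖ ≤ 1 := fun ω => by simp [Prod.norm_def]
  have n3 : ‖((0, 1) : Space n)‖ ≤ 1 := by simp [Prod.norm_def]
  have b1 : ∀ i, BddOnAngle fun θ : Ang n => fderiv ℝ w (pol θ) (EuclideanSpace.single i 1, 0) :=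
    fun i => ⟨(hD.clm_apply continuous_const).measurable, B, fun θ _ => hap θ _ (n1 i)⟩
  have b2 : BddOnAngle fun θ : Ang n => fderiv ℝ w (pol θ) (θ.1, 0) :=
    ⟨(hD.clm_apply (by fun_prop)).measurable, B, fun θ _ => hap θ _ (n2 _)⟩
  have m3 : Measurable fun θ : Ang n => fderiv ℝ w (pol θ) (0, 1) :=
    (hD.clm_apply continuous_const).measurable
  have bs : ∀ s : Finset (Fin n), BddOnAngle fun θ : Ang n =>
      ∑ i ∈ s, fderiv ℝ w (pol θ) (EuclideanSpace.single i 1, 0) ^ 2 := by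
    intro s
    classical
    induction s using Finset.induction_on with
    | empty => simpa using BddOnAngle.const 0
    | insert i s hi ih =>
      simp only [Finset.sum_insert hi]
      exact ((b1 i).pow 2).add ih
  have bK : BddOnAngle (sphereGradSq w) := (bs _).sub (b2.pow 2)
  have mV' : Measurable (polDeriv w) := by
    have := b2.1
    unfold polDeriv
    fun_prop
  have hV' : ∀ θ : Ang n, θ.2 ∈ Ioo 0 Real.pi → |√(Real.sin θ.2) * polDeriv w θ| ≤ B := by
    intro θ hθ
    have hS := sqrt_sin_pos hθ
    have e1 : √(Real.sin θ.2) * polDeriv w θ = Real.cos θ.2 / 2 * fderiv ℝ w (pol θ) (θ.1, 0) -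
      √(Real.sin θ.2) * (Real.sin θ.2 / 2) * fderiv ℝ w (pol θ) (0, 1) := by
      rw [polDeriv]; field_simp
    rw [e1]
    refine (abs_sub _ _).trans ?_
    rw [abs_mul, abs_mul, abs_mul, abs_div, abs_div, abs_two, abs_of_pos hS]
    have := Real.abs_cos_le_one θ.2
    have := Real.abs_sin_le_one θ.2
    calc _ ≤ 1 / 2 * B + 1 * (1 / 2) * B := by
          gcongr
          · exact hap θ _ (n2 _)
          · exact sqrt_sin_le_one _
          · exact hap θ _ n3
      _ = B := by ring
  have bV' : BddOnAngle fun θ : Ang n => √(Real.sin θ.2) * polDeriv w θ := ⟨by fun_prop, B, hV'⟩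
  have mV : Measurable fun θ : Ang n => w (pol θ) := (hw.continuous.comp continuous_pol).measurable
  have bV : BddOnAngle fun θ : Ang n => w (pol θ) := ⟨mV, B, fun θ _ => hB _⟩
  -- Mean value inequality between a point and its projection to the axis x = 0, at distance √(sin
  -- φ).
  have hv : ∀ θ : Ang n, |w (pol θ) - w (0, Real.cos θ.2 / 2)| ≤ B * √(Real.sin θ.2) := by
    intro θ
    have := convex_univ.norm_image_sub_le_of_norm_fderiv_le (𝕜 := ℝ) (f := w)
      (fun x _ => hdiff x) (fun x _ => hB' x) (mem_univ ((0, Real.cos θ.2 / 2) : Space n))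
      (mem_univ (pol θ))
    refine this.trans_eq ?_
    congr 1
    have : pol θ - (0, Real.cos θ.2 / 2) = (√(Real.sin θ.2) • (θ.1 : EuclideanSpace ℝ (Fin n)), 0) := by
      refine Prod.ext ?_ ?_ <;> simp [pol]
    rw [this, Prod.norm_def]
    simp [norm_smul]
  have hVK : ∀ φ ∈ Ioo 0 Real.pi, ((n : ℝ) - 1) *
      ∫ ω, (w (pol (ω, φ)) - ⨍ ω', w (pol (ω', φ)) ∂σ) ^ 2 ∂σ ≤
      √(Real.sin φ) ^ 2 * ∫ ω, sphereGradSq w (ω, φ) ∂σ := by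
    intro φ hφ
    set h : EuclideanSpace ℝ (Fin n) → ℝ := fun y => w (√(Real.sin φ) • y, Real.cos φ / 2) with hh
    have hcd : ContDiff ℝ 1 h := hw.comp (by fun_prop)
    have hfd : ∀ y v, fderiv ℝ h y v =
        √(Real.sin φ) * fderiv ℝ w (√(Real.sin φ) • y, Real.cos φ / 2) (v, 0) := by
      intro y v
      have h1 := (((hasFDerivAt_id (𝕜 := ℝ) y).const_smul (√(Real.sin φ))).prodMk (hasFDerivAt_const (Real.cos φ / 2) y))
      have h2 := (hdiff _).hasFDerivAt.comp y h1
      rw [show fderiv ℝ h y = _ from h2.fderiv]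
      simp only [ContinuousLinearMap.comp_apply, ContinuousLinearMap.prod_apply]
      rw [← smul_eq_mul, ← map_smul]
      simp
    have := sphere_poincare hn hcd (A := ⨍ ω', h ω' ∂σ) (integral_sub_average σ _)
    refine this.trans_eq ?_
    rw [← integral_const_mul]
    refine integral_congr_ae (.of_forall fun ω => ?_)
    simp only [hfd, sphereGradSq, pol, mul_pow, ← Finset.mul_sum, mul_sub]
  have main := averaged_angular_poincare hn (toSphere_ne_zero hn) mV mV' bK (fun p => hB _) hV'
    (v := fun φ => w (0, Real.cos φ / 2)) hv
    (fun ω φ hφ => hasDerivAt_comp_pol hdiff ω hφ) hVK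
  have hc : ⨍ ω, w (pol (ω, Real.pi / 2)) ∂σ =
      ⨍ ω : Metric.sphere (0 : EuclideanSpace ℝ (Fin n)) 1, w (ω, 0) ∂σ := by
    simp [pol]
  rw [← hσ, hc] at main
  set c := ⨍ ω : Metric.sphere (0 : EuclideanSpace ℝ (Fin n)) 1, w (ω, 0) ∂σ
  have bG : BddOnAngle fun θ : Ang n => 4 * (√(Real.sin θ.2) * polDeriv w θ) ^ 2 +
      sphereGradSq w θ := ((BddOnAngle.const 4).mul (bV'.pow 2)).add bK
  have bH : BddOnAngle fun θ : Ang n => (n + 1) * (√(Real.sin θ.2) ^ 2 * (w (pol θ) - c) ^ 2) :=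
    (BddOnAngle.const _).mul ((BddOnAngle.sqrt_sin.pow 2).mul ((bV.sub (.const _)).pow 2))
  have e1 : ∫ θ, gam w w (pol θ) ∂angMeasure n = ∫ θ : Ang n,
      (4 * (√(Real.sin θ.2) * polDeriv w θ) ^ 2 + sphereGradSq w θ) ∂angMeasure n :=
    integral_congr_ae (ae_angMeasure_mem.mono fun θ hθ => gam_pol hθ)
  have e2 : (n + 1) * ∫ θ, kap (pol θ) * (w (pol θ) - c) ^ 2 ∂angMeasure n =
      ∫ θ, (n + 1) * (√(Real.sin θ.2) ^ 2 * (w (pol θ) - c) ^ 2) ∂angMeasure n := by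
    rw [← integral_const_mul]
    refine integral_congr_ae (ae_angMeasure_mem.mono fun θ hθ => ?_)
    simp only [kap_pol hθ]
  rw [e1, e2, ← sub_nonneg, ← integral_sub bG.integrable_angMeasure bH.integrable_angMeasure]
  have e3 := integral_prod_symm _ (bG.sub bH).integrable_angMeasure
  rw [← angMeasure, integral_polarAngle] at e3
  rw [e3]
  exact main

end GaugeSphere

end Grushin

end

section

open MeasureTheory ProbabilityTheory Set Filter Topology

namespace Grushin

/-! ### The angular gap on the whole space -/

section AngularKey

variable {n : ℕ} {u : Space n → ℝ}

theorem rho_eq_zero {p : Space n} : rho p = 0 ↔ p = 0 :=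
  ⟨fun h => by_contra fun hp => (rho_pos hp).ne' h, fun h => h ▸ rho_zero⟩

theorem norm_le_rho (p : Space n) : ‖p‖ ≤ rho p + rho p ^ 2 := by
  have h4 := rho_pow_four p
  have h0 := rho_nonneg p
  have h1 : ‖p.1‖ ≤ rho p := by
    refine le_of_pow_le_pow_left₀ (n := 4) (by norm_num) h0 ?_
    nlinarith [sq_nonneg p.2]
  have h2 : ‖p.2‖ ≤ rho p ^ 2 := by
    rw [Real.norm_eq_abs]
    refine abs_le_of_sq_le_sq ?_ (by positivity)
    have : 0 ≤ ‖p.1‖ ^ 4 := by positivity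
    nlinarith [sq_nonneg p.2]
  rw [Prod.norm_def]
  exact max_le (by nlinarith) (by linarith)

theorem differentiableAt_inv_sq {s : ℝ} (hs : s ≠ 0) :
    DifferentiableAt ℝ (fun s : ℝ => (s ^ 2)⁻¹) s :=
  (differentiableAt_fun_id.fun_pow 2).fun_inv (pow_ne_zero 2 hs)

theorem isCompact_preimage_rho {K : Set ℝ} (hK : IsCompact K) :
    IsCompact (rho (n := n) ⁻¹' K) := by
  obtain ⟨M, hM⟩ := hK.isBounded.subset_closedBall 0
  refine (isCompact_closedBall (0 : Space n) (M + M ^ 2)).of_isClosed_subset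
    (hK.isClosed.preimage continuous_rho) fun p hp => ?_
  have h1 := hM hp
  rw [mem_closedBall_zero_iff, Real.norm_of_nonneg (rho_nonneg p)] at h1
  rw [mem_closedBall_zero_iff]
  have h0 := rho_nonneg p
  exact (norm_le_rho p).trans (by gcongr)

theorem isTest_comp_rho {V : Set ℝ} (hV : 0 ∉ V) {g : ℝ → ℝ} (hg : IsTest V g) :
    IsTest (rho (n := n) ⁻¹' V) fun p => g (rho p) := by
  have hsub : tsupport (fun p : Space n => g (rho p)) ⊆ rho ⁻¹' tsupport g :=
    tsupport_comp_subset_preimage g continuous_rho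
  refine ⟨contDiff_iff_contDiffAt.2 fun p => ?_,
    (isCompact_preimage_rho hg.2.1).of_isClosed_subset (isClosed_tsupport _) hsub,
    hsub.trans (preimage_mono hg.2.2)⟩
  by_cases hp : p = 0
  · have : p ∉ tsupport fun p : Space n => g (rho p) := fun h => by
      have := hg.2.2 (hsub h)
      rw [hp, rho_zero] at this
      exact hV this
    exact contDiffAt_const.congr_of_eventuallyEq (notMem_tsupport_iff_eventuallyEq.1 this)
  · exact hg.1.contDiffAt.comp p (contDiffAt_rho hp)

theorem IsTest.exists_shell (hu : IsTest {0}ᶜ u) :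
    ∃ ε M, 0 < ε ∧ ∀ p, u p ≠ 0 → ε ≤ rho p ∧ rho p ≤ M := by
  rcases (tsupport u).eq_empty_or_nonempty with h | h
  · exact ⟨1, 0, one_pos, fun p hp => absurd (subset_tsupport u hp) (by simp [h])⟩
  · obtain ⟨p, hp, hmin⟩ := hu.2.1.isCompact.exists_isMinOn h continuous_rho.continuousOn
    obtain ⟨q, hq, hmax⟩ := hu.2.1.isCompact.exists_isMaxOn h continuous_rho.continuousOn
    exact ⟨rho p, rho q, rho_pos (hu.2.2 hp), fun s hs =>
      ⟨hmin (subset_tsupport u hs), hmax (subset_tsupport u hs)⟩⟩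

theorem integrable_of_shell {F : Space n → ℝ} {ε M : ℝ} (hε : 0 < ε)
    (hc : ContinuousOn F {0}ᶜ) (hs : ∀ p, F p ≠ 0 → ε ≤ rho p ∧ rho p ≤ M) : Integrable F := by
  have hK : IsCompact (rho (n := n) ⁻¹' Icc ε M) := isCompact_preimage_rho isCompact_Icc
  refine (integrableOn_iff_integrable_of_support_subset (s := rho ⁻¹' Icc ε M) fun p hp =>
    hs p hp).1 (ContinuousOn.integrableOn_compact hK (hc.mono fun p hp => ?_))
  rintro rfl
  have := hp.1
  rw [rho_zero] at this
  linarith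

theorem integrable_comp_dil_pol (hn : 2 ≤ n) {F : Space n → ℝ} (hF : Integrable F) :
    Integrable (fun q : Ang n × ℝ => F (dil q.2 (pol q.1)))
      ((angMeasure n).prod (radPow (n + 1))) :=
  ((measurePreserving_dil_pol hn).integrable_comp hF.aestronglyMeasurable).2 hF

theorem integral_polar (hn : 2 ≤ n) {F : Space n → ℝ} (hF : Integrable F) :
    ∫ p, F p = ∫ r, (∫ θ, F (dil r (pol θ)) ∂angMeasure n) ∂radPow (n + 1) := by
  have hmp := measurePreserving_dil_pol hn
  rw [← integral_prod_symm _ (integrable_comp_dil_pol hn hF)]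
  rw [← hmp.map_eq, integral_map hmp.aemeasurable]
  rw [hmp.map_eq]
  exact hF.aestronglyMeasurable

theorem fderiv_comp_dil (hu : Differentiable ℝ u) (r : ℝ) (p v : Space n) :
    fderiv ℝ (fun p => u (dil r p)) p v = fderiv ℝ u (dil r p) (dil r v) := by
  have h1 := ((hasFDerivAt_fst (𝕜 := ℝ) (p := p)).const_smul r).prodMk
    ((hasFDerivAt_snd (𝕜 := ℝ) (p := p)).const_smul (r ^ 2))
  have h2 := (hu _).hasFDerivAt.comp p h1
  rw [show fderiv ℝ (fun p => u (dil r p)) p = _ from h2.fderiv]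
  rfl

theorem gam_comp_dil (hu : Differentiable ℝ u) {r : ℝ} (hr : 0 < r) (p : Space n) :
    gam (fun p => u (dil r p)) (fun p => u (dil r p)) p = r ^ 2 * gam u u (dil r p) := by
  rw [gam_dil _ _ hr, ← mul_assoc, mul_inv_cancel₀ (by positivity), one_mul]
  simp only [gam, fderiv_comp_dil hu]

/-- The average of `u` over the equator of the gauge sphere of radius `r`. -/
noncomputable def equatorAvg (u : Space n → ℝ) (r : ℝ) : ℝ :=
  ⨍ ω : Metric.sphere (0 : EuclideanSpace ℝ (Fin n)) 1, u (r • (ω : EuclideanSpace ℝ (Fin n)), 0)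
    ∂(volume : Measure (EuclideanSpace ℝ (Fin n))).toSphere

theorem continuous_equatorAvg (hu : Continuous u) : Continuous (equatorAvg u) := by
  have h := continuous_parametric_integral_of_continuous (X := ℝ)
    (μ := (volume : Measure (EuclideanSpace ℝ (Fin n))).toSphere) (f := fun (r : ℝ)
    (ω : Metric.sphere (0 : EuclideanSpace ℝ (Fin n)) 1) =>
      u (r • (ω : EuclideanSpace ℝ (Fin n)), 0)) (hu.comp (by fun_prop)) isCompact_univ
  simp only [Measure.restrict_univ] at h
  unfold equatorAvg
  simp_rw [average_eq, smul_eq_mul]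
  exact continuous_const.mul h

theorem rho_equator {r : ℝ} (hr : 0 ≤ r) (ω : Metric.sphere (0 : EuclideanSpace ℝ (Fin n)) 1) :
    rho ((r • (ω : EuclideanSpace ℝ (Fin n)), 0) : Space n) = r :=
  rho_eq_of_pow_four hr (by simp [norm_smul, abs_of_nonneg hr])

theorem equatorAvg_shell {ε M : ℝ} (h : ∀ p, u p ≠ 0 → ε ≤ rho p ∧ rho p ≤ M) {r : ℝ} (hr : 0 ≤ r)
    (hne : equatorAvg u r ≠ 0) : ε ≤ r ∧ r ≤ M := by
  by_contra hcon
  refine hne ?_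
  have : ∀ ω : Metric.sphere (0 : EuclideanSpace ℝ (Fin n)) 1,
      u (r • (ω : EuclideanSpace ℝ (Fin n)), 0) = 0 := fun ω => by
    by_contra h0
    have := h _ h0
    rw [rho_equator hr] at this
    exact hcon this
  simp [equatorAvg, this, average_eq]

theorem isTest_equator (hu : IsTest {0}ᶜ u) (ω : Metric.sphere (0 : EuclideanSpace ℝ (Fin n)) 1) :
    IsTest {0}ᶜ fun r : ℝ => u (r • (ω : EuclideanSpace ℝ (Fin n)), 0) := by
  have hc : Continuous fun r : ℝ => ((r • (ω : EuclideanSpace ℝ (Fin n)), 0) : Space n) := by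
    fun_prop
  have hiso : Isometry fun r : ℝ => ((r • (ω : EuclideanSpace ℝ (Fin n)), 0) : Space n) := by
    refine Isometry.of_dist_eq fun r s => ?_
    simp [dist_eq_norm, ← sub_smul, norm_smul]
  refine ⟨hu.1.comp (by fun_prop), hu.2.1.comp_isClosedEmbedding hiso.isClosedEmbedding,
    (tsupport_comp_subset_preimage u hc).trans fun r hr => ?_⟩
  rintro rfl
  exact hu.2.2 hr (by simp)

theorem integrable_equatorAvg_sq (hu : IsTest {0}ᶜ u) :
    Integrable fun p => (rho p ^ 2)⁻¹ * (kap p * (u p - equatorAvg u (rho p)) ^ 2) := by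
  obtain ⟨ε, M, hε, h⟩ := hu.exists_shell
  refine integrable_of_shell (M := M) hε ?_ fun p hp => ?_
  · have h1 : Continuous fun p => u p - equatorAvg u (rho p) :=
      hu.continuous.sub ((continuous_equatorAvg hu.continuous).comp continuous_rho)
    refine fun p hp => ContinuousAt.continuousWithinAt ?_
    exact (contDiffAt_inv_rho_sq hp).continuousAt.mul
      ((contDiffAt_kap hp).continuousAt.mul (h1.pow 2).continuousAt)
  · by_contra hcon
    have h1 : u p = 0 := by_contra fun h1 => hcon (h p h1)
    have h2 : equatorAvg u (rho p) = 0 := by_contra fun h2 =>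
      hcon (equatorAvg_shell h (rho_nonneg p) h2)
    exact hp (by simp [h1, h2])

/-- The gap on the unit gauge sphere, applied to u(dil r ·) for each r and integrated. Both
integrands scale by the same factor r⁻⁴. -/
theorem integral_gam_div_ge (hn : 2 ≤ n) (hu : IsTest {0}ᶜ u) :
    (n + 1) * ∫ p, (rho p ^ 2)⁻¹ * (kap p * (u p - equatorAvg u (rho p)) ^ 2) ≤
      ∫ p, (rho p ^ 2)⁻¹ * gam u u p := by
  have i1 := integrable_equatorAvg_sq hu
  have i2 := (isTest_gam_div hu hu).integrable (μ := volume)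
  rw [integral_polar hn i1, integral_polar hn i2, ← integral_const_mul]
  refine integral_mono_ae ((integrable_comp_dil_pol hn i1).integral_prod_right.const_mul _)
    (integrable_comp_dil_pol hn i2).integral_prod_right ?_
  filter_upwards [ae_radPow_pos (n + 1)] with r hr
  obtain ⟨ε, M, hε, h⟩ := hu.exists_shell
  set w : Space n → ℝ := fun p => u (dil r p) with hw
  have hcd : ContDiff ℝ 1 w := (hu.1.of_le (by exact_mod_cast le_top)).comp (by
    unfold dil; fun_prop)
  have hcs : HasCompactSupport w := by
    refine HasCompactSupport.intro (isCompact_preimage_rho (isCompact_Icc (a := 0) (b := M / r)))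
      fun p hp => ?_
    by_contra h0
    have := (h _ h0).2
    rw [rho_dil hr.le] at this
    exact hp ⟨rho_nonneg p, by rw [le_div_iff₀ hr]; linarith⟩
  obtain ⟨B₁, hB₁⟩ := hcs.exists_bound_of_continuous hcd.continuous
  obtain ⟨B₂, hB₂⟩ := (hcs.fderiv (𝕜 := ℝ)).exists_bound_of_continuous
    (hcd.continuous_fderiv one_ne_zero)
  have key := gauge_sphere_poincare hn hcd (B := max B₁ B₂)
    (fun p => (hB₁ p).trans (le_max_left _ _)) (fun p => (hB₂ p).trans (le_max_right _ _))
  have hc : (⨍ ω : Metric.sphere (0 : EuclideanSpace ℝ (Fin n)) 1, w (ω, 0)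
        ∂(volume : Measure (EuclideanSpace ℝ (Fin n))).toSphere) = equatorAvg u r := by
    simp [hw, equatorAvg, dil]
  rw [hc] at key
  have e1 : ∫ θ, (rho (dil r (pol θ)) ^ 2)⁻¹ * (kap (dil r (pol θ)) *
      (u (dil r (pol θ)) - equatorAvg u (rho (dil r (pol θ)))) ^ 2) ∂angMeasure n =
      (r ^ 4)⁻¹ * ∫ θ, kap (pol θ) * (w (pol θ) - equatorAvg u r) ^ 2 ∂angMeasure n := by
    rw [← integral_const_mul]
    refine integral_congr_ae (ae_angMeasure_mem.mono fun θ hθ => ?_)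
    simp only [rho_dil hr.le, rho_pol hθ, kap_dil hr, mul_one, hw]
    field_simp
  have e2 : ∫ θ, (rho (dil r (pol θ)) ^ 2)⁻¹ * gam u u (dil r (pol θ)) ∂angMeasure n =
      (r ^ 4)⁻¹ * ∫ θ, gam w w (pol θ) ∂angMeasure n := by
    rw [← integral_const_mul]
    refine integral_congr_ae (ae_angMeasure_mem.mono fun θ hθ => ?_)
    simp only [rho_dil hr.le, rho_pol hθ, mul_one, hw, gam_comp_dil hu.differentiable hr]
    field_simp
  rw [e1, e2, mul_left_comm]
  exact mul_le_mul_of_nonneg_left key (by positivity)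

theorem integral_inv_rho_sq_mul_angLap {f : ℝ → ℝ} (hf : IsTest {0}ᶜ f) (hu : IsTest {0}ᶜ u) :
    ∫ p, (rho p ^ 2)⁻¹ * f (rho p) * angLap u p = 0 := by
  have h1 : IsTest {0}ᶜ fun p : Space n => f (rho p) :=
    (isTest_comp_rho (by simp) hf).mono fun p hp => by
      rintro rfl
      exact hp rho_zero
  have h2 := h1.mul_left fun _ hp => contDiffAt_inv_rho_sq hp
  rw [integral_mul_angLap h2 hu, integral_eq_zero_of_ae, neg_zero]
  filter_upwards [ae_ne_zero] with p hp
  have hr := (rho_pos hp).ne'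
  exact gam_comp_rho hp (c := fun s => (s ^ 2)⁻¹ * f s)
    ((differentiableAt_inv_sq hr).fun_mul (hf.differentiable _)) u

/-- Smooth radial functions are orthogonal to `angLap u`, being constants for `gam`. The smoothness
of `equatorAvg u` is never needed: Fubini in ω reduces to the test functions r ↦ u(r ω, 0). -/
theorem integral_equatorAvg_mul_angLap (hu : IsTest {0}ᶜ u) :
    Integrable (fun p => (rho p ^ 2)⁻¹ * equatorAvg u (rho p) * angLap u p) ∧
    ∫ p, (rho p ^ 2)⁻¹ * equatorAvg u (rho p) * angLap u p = 0 := by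
  set σ := (volume : Measure (EuclideanSpace ℝ (Fin n))).toSphere with hσ
  have hH := (hu.angLap.mul_left fun _ hp => contDiffAt_inv_rho_sq hp).integrable (μ := volume)
  obtain ⟨B, hB⟩ := hu.2.1.exists_bound_of_continuous hu.continuous
  have hi : Integrable (fun q : Space n × Metric.sphere (0 : EuclideanSpace ℝ (Fin n)) 1 =>
      (rho q.1 ^ 2)⁻¹ * angLap u q.1 * u (rho q.1 • (q.2 : EuclideanSpace ℝ (Fin n)), 0))
      (volume.prod σ) := by
    refine (hH.comp_fst σ).mul_bdd (c := B) ?_ (.of_forall fun q => hB _)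
    have : Continuous fun q : Space n × Metric.sphere (0 : EuclideanSpace ℝ (Fin n)) 1 =>
        u (rho q.1 • (q.2 : EuclideanSpace ℝ (Fin n)), 0) :=
      hu.continuous.comp ((((continuous_rho.comp continuous_fst).smul
        (continuous_subtype_val.comp continuous_snd))).prodMk continuous_const)
    exact this.aestronglyMeasurable
  have e : ∀ p, (rho p ^ 2)⁻¹ * equatorAvg u (rho p) * angLap u p = (σ.real univ)⁻¹ *
      ∫ ω : Metric.sphere (0 : EuclideanSpace ℝ (Fin n)) 1, (rho p ^ 2)⁻¹ * angLap u p *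
        u (rho p • (ω : EuclideanSpace ℝ (Fin n)), 0) ∂σ := fun p => by
    rw [integral_const_mul, equatorAvg, average_eq, smul_eq_mul]; ring
  simp_rw [e]
  refine ⟨hi.integral_prod_left.const_mul _, ?_⟩
  rw [integral_const_mul, integral_integral_swap (f := fun p
    (ω : Metric.sphere (0 : EuclideanSpace ℝ (Fin n)) 1) => (rho p ^ 2)⁻¹ * angLap u p *
      u (rho p • (ω : EuclideanSpace ℝ (Fin n)), 0)) hi, integral_eq_zero_of_ae, mul_zero]
  refine .of_forall fun ω => ?_
  have := integral_inv_rho_sq_mul_angLap (isTest_equator hu ω) hu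
  simpa only [mul_right_comm, Pi.zero_apply] using this

theorem ae_fst_ne_zero (hn : 2 ≤ n) : ∀ᵐ p : Space n, p.1 ≠ 0 := by
  have : Nonempty (Fin n) := ⟨⟨0, by omega⟩⟩
  have : NullSingletonClass (volume : Measure (EuclideanSpace ℝ (Fin n))) := inferInstance
  refine Measure.quasiMeasurePreserving_fst.ae (p := fun x : EuclideanSpace ℝ (Fin n) => x ≠ 0) ?_
  rw [ae_iff]
  simp only [ne_eq, not_not, Set.ofPred_eq_eq_singleton]
  exact measure_singleton 0

/-- Dual form of the gap. Let J and L be the two integrals and c = `equatorAvg u`. Then J = -∫ ϱ⁻²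
(u - c(ϱ)) Λu, since subtracting c(ϱ) costs nothing. Young's inequality with weight n+1 gives J ≤
(n+1)/2 · I + L/(2(n+1)), where I = ∫ ϱ⁻² κ (u - c(ϱ))², and `integral_gam_div_ge` says (n+1) I ≤ J.
-/
theorem integral_gam_div_le_angLap (hn : 2 ≤ n) (hu : IsTest {0}ᶜ u)
    (hi : Integrable fun p => angLap u p ^ 2 / (rho p ^ 2 * kap p)) :
    (n + 1) * ∫ p, (rho p ^ 2)⁻¹ * gam u u p ≤ ∫ p, angLap u p ^ 2 / (rho p ^ 2 * kap p) := by
  have hpoin := integral_gam_div_ge hn hu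
  obtain ⟨ic, hc⟩ := integral_equatorAvg_mul_angLap hu
  have i1 := integrable_equatorAvg_sq hu
  have ht := hu.mul_left fun _ hp => contDiffAt_inv_rho_sq hp
  have iu : Integrable fun p => (rho p ^ 2)⁻¹ * u p * angLap u p := (ht.mul hu.angLap).integrable
  have e1 : ∫ p, (rho p ^ 2)⁻¹ * gam u u p = -∫ p, (rho p ^ 2)⁻¹ * u p * angLap u p := by
    rw [integral_mul_angLap ht hu, neg_neg]
    refine integral_congr_ae (ae_ne_zero.mono fun p hp => ?_)
    exact (gam_comp_rho_mul hp (c := fun s => (s ^ 2)⁻¹)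
      (differentiableAt_inv_sq (rho_pos hp).ne')
      (hu.differentiable _) u).symm
  have e2 : ∫ p, (rho p ^ 2)⁻¹ * gam u u p =
      ∫ p, -((rho p ^ 2)⁻¹ * (u p - equatorAvg u (rho p)) * angLap u p) := by
    rw [e1, integral_neg]
    congr 1
    have : ∀ p, (rho p ^ 2)⁻¹ * (u p - equatorAvg u (rho p)) * angLap u p =
      (rho p ^ 2)⁻¹ * u p * angLap u p - (rho p ^ 2)⁻¹ * equatorAvg u (rho p) * angLap u p :=
      fun p => by ring
    simp_rw [this]
    rw [integral_sub iu ic, hc, sub_zero]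
  have hle : ∫ p, -((rho p ^ 2)⁻¹ * (u p - equatorAvg u (rho p)) * angLap u p) ≤
      ∫ p, ((n + 1) / 2 * ((rho p ^ 2)⁻¹ * (kap p * (u p - equatorAvg u (rho p)) ^ 2)) +
        (2 * ((n : ℝ) + 1))⁻¹ * (angLap u p ^ 2 / (rho p ^ 2 * kap p))) := by
    refine integral_mono_ae ?_ ((i1.const_mul _).add (hi.const_mul _)) ?_
    · refine ((iu.sub ic).neg).congr (.of_forall fun p => ?_)
      simp only [Pi.neg_apply, Pi.sub_apply]; ring
    · filter_upwards [ae_fst_ne_zero hn] with p hp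
      have hr : 0 < rho p := rho_pos fun h => hp (by rw [h]; rfl)
      have hk : 0 < kap p := div_pos (by positivity) (by positivity)
      have hnp : (0 : ℝ) < n + 1 := by positivity
      generalize u p - equatorAvg u (rho p) = d
      generalize angLap u p = l
      have : (n + 1) / 2 * ((rho p ^ 2)⁻¹ * (kap p * d ^ 2)) +
          (2 * ((n : ℝ) + 1))⁻¹ * (l ^ 2 / (rho p ^ 2 * kap p)) - -((rho p ^ 2)⁻¹ * d * l) =
          (2 * ((n : ℝ) + 1) * kap p * rho p ^ 2)⁻¹ * ((n + 1) * kap p * d + l) ^ 2 := by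
        field_simp
        ring
      have h2 : 0 ≤ (2 * ((n : ℝ) + 1) * kap p * rho p ^ 2)⁻¹ * ((n + 1) * kap p * d + l) ^ 2 := by
        positivity
      linarith
  rw [← e2, integral_add (i1.const_mul _) (hi.const_mul _), integral_const_mul,
    integral_const_mul] at hle
  generalize (∫ p, (rho p ^ 2)⁻¹ * gam u u p) = J at *
  generalize (∫ p, (rho p ^ 2)⁻¹ * (kap p * (u p - equatorAvg u (rho p)) ^ 2)) = I at *
  generalize (∫ p, angLap u p ^ 2 / (rho p ^ 2 * kap p)) = L at *
  have hnp : (0 : ℝ) < n + 1 := by positivity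
  have : J ≤ J / 2 + (2 * ((n : ℝ) + 1))⁻¹ * L := by linarith
  have h3 := mul_le_mul_of_nonneg_left this (by positivity : (0 : ℝ) ≤ 2 * (n + 1))
  have h4 : 2 * ((n : ℝ) + 1) * (J / 2 + (2 * ((n : ℝ) + 1))⁻¹ * L) = (n + 1) * J + L := by
    field_simp
  linarith

end AngularKey

end Grushin

end

section

open MeasureTheory ProbabilityTheory Set Filter Topology

/-! ### Comparison of extended integrals -/

section Dominates

variable {α : Type*} [MeasurableSpace α] {μ : Measure α} {a a' b b' : α → ℝ}

/-- `∫ b ≤ ∫ a` for `a ≥ 0`, where `∫ b` counts as `-∞` if `b⁻` is not integrable. -/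
def IntegralDominates (μ : Measure α) (a b : α → ℝ) : Prop :=
  ∫⁻ x, ENNReal.ofReal (-b x) ∂μ ≠ ⊤ →
    ∫⁻ x, ENNReal.ofReal (b x) ∂μ ≤ ∫⁻ x, ENNReal.ofReal (a x) ∂μ + ∫⁻ x, ENNReal.ofReal (-b x) ∂μ

namespace IntegralDominates

theorem congr_ae (h : IntegralDominates μ a b) (ha : a =ᵐ[μ] a') (hb : b =ᵐ[μ] b') :
    IntegralDominates μ a' b' := by
  have e1 : ∫⁻ x, ENNReal.ofReal (a x) ∂μ = ∫⁻ x, ENNReal.ofReal (a' x) ∂μ :=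
    lintegral_congr_ae (ha.mono fun x hx => by simp only [hx])
  have e2 : ∫⁻ x, ENNReal.ofReal (b x) ∂μ = ∫⁻ x, ENNReal.ofReal (b' x) ∂μ :=
    lintegral_congr_ae (hb.mono fun x hx => by simp only [hx])
  have e3 : ∫⁻ x, ENNReal.ofReal (-b x) ∂μ = ∫⁻ x, ENNReal.ofReal (-b' x) ∂μ :=
    lintegral_congr_ae (hb.mono fun x hx => by simp only [hx])
  rwa [IntegralDominates, e1, e2, e3] at h

theorem congr_ae_iff (ha : a =ᵐ[μ] a') (hb : b =ᵐ[μ] b') :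
    IntegralDominates μ a b ↔ IntegralDominates μ a' b' :=
  ⟨fun h => h.congr_ae ha hb, fun h => h.congr_ae ha.symm hb.symm⟩

theorem mono_lintegral (h : IntegralDominates μ a b)
    (ha : ∫⁻ x, ENNReal.ofReal (a x) ∂μ ≤ ∫⁻ x, ENNReal.ofReal (a' x) ∂μ) :
    IntegralDominates μ a' b := fun hN => (h hN).trans (by gcongr)

theorem const_mul (h : IntegralDominates μ a b) {c : ℝ} (hc : 0 ≤ c) :
    IntegralDominates μ (fun x => c * a x) (fun x => c * b x) := by
  have e : ∀ f : α → ℝ, ∫⁻ x, ENNReal.ofReal (c * f x) ∂μ =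
      ENNReal.ofReal c * ∫⁻ x, ENNReal.ofReal (f x) ∂μ := fun f => by
    rw [← lintegral_const_mul' _ _ ENNReal.ofReal_ne_top]
    simp only [ENNReal.ofReal_mul hc]
  intro hN
  simp only [← mul_neg] at hN ⊢
  rw [e] at hN
  rw [e, e, e, ← mul_add]
  rcases hc.eq_or_lt with rfl | hc
  · simp
  · gcongr
    refine h fun h0 => hN ?_
    rw [h0, ENNReal.mul_top (by simpa using hc)]

/-- Both summands on the right carry the same signed weight `w` and nonnegative factors, so positive
and negative parts add exactly. For arbitrary signed summands they would only be subadditive. -/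
theorem add_weighted {w g₁ g₂ : α → ℝ} (hw : Measurable w) (hg₁ : ∀ x, 0 ≤ g₁ x)
    (hg₂ : ∀ x, 0 ≤ g₂ x) (hm : Measurable g₁) (ha : ∀ x, 0 ≤ a x) (ha' : ∀ x, 0 ≤ a' x)
    (hma : Measurable a) (h : IntegralDominates μ a fun x => w x * g₁ x)
    (h' : IntegralDominates μ a' fun x => w x * g₂ x) :
    IntegralDominates μ (fun x => a x + a' x) fun x => w x * (g₁ x + g₂ x) := by
  have e : ∀ v : α → ℝ, Measurable v → ∫⁻ x, ENNReal.ofReal (v x * (g₁ x + g₂ x)) ∂μ =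
      ∫⁻ x, ENNReal.ofReal (v x * g₁ x) ∂μ + ∫⁻ x, ENNReal.ofReal (v x * g₂ x) ∂μ := by
    intro v hv
    rw [← lintegral_add_left (by fun_prop)]
    refine lintegral_congr fun x => ?_
    rcases le_total 0 (v x) with h0 | h0
    · rw [mul_add, ENNReal.ofReal_add (mul_nonneg h0 (hg₁ x)) (mul_nonneg h0 (hg₂ x))]
    · rw [ENNReal.ofReal_of_nonpos (mul_nonpos_of_nonpos_of_nonneg h0 (add_nonneg (hg₁ x) (hg₂ x))),
        ENNReal.ofReal_of_nonpos (mul_nonpos_of_nonpos_of_nonneg h0 (hg₁ x)),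
        ENNReal.ofReal_of_nonpos (mul_nonpos_of_nonpos_of_nonneg h0 (hg₂ x)), add_zero]
  have ea : ∫⁻ x, ENNReal.ofReal (a x + a' x) ∂μ =
      ∫⁻ x, ENNReal.ofReal (a x) ∂μ + ∫⁻ x, ENNReal.ofReal (a' x) ∂μ := by
    rw [← lintegral_add_left (by fun_prop)]
    exact lintegral_congr fun x => ENNReal.ofReal_add (ha x) (ha' x)
  unfold IntegralDominates at h h' ⊢
  simp only [← neg_mul] at h h' ⊢
  rw [e w hw, e (fun x => -w x) hw.neg, ea]
  intro hN
  rw [ENNReal.add_ne_top] at hN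
  exact (add_le_add (h hN.1) (h' hN.2)).trans_eq (add_add_add_comm _ _ _ _)

theorem sum_weighted {ι : Type*} {s : Finset ι} {w : α → ℝ} {g A : ι → α → ℝ} (hw : Measurable w)
    (hg : ∀ i x, 0 ≤ g i x) (hm : ∀ i, Measurable (g i)) (hA : ∀ i x, 0 ≤ A i x)
    (hmA : ∀ i, Measurable (A i)) (h : ∀ i, IntegralDominates μ (A i) fun x => w x * g i x) :
    IntegralDominates μ (fun x => ∑ i ∈ s, A i x) fun x => w x * ∑ i ∈ s, g i x := by
  classical
  induction s using Finset.induction_on with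
  | empty => intro _; simp
  | insert i s hi ih =>
    simp only [Finset.sum_insert hi]
    exact (h i).add_weighted hw (hg i) (fun x => Finset.sum_nonneg fun j _ => hg j x) (hm i)
      (hA i) (fun x => Finset.sum_nonneg fun j _ => hA j x) (hmA i) ih

end IntegralDominates

theorem EReal.coe_ennreal_sub_le_iff {P N L : ENNReal} :
    (P : EReal) - N ≤ L ↔ (N ≠ ⊤ → P ≤ L + N) := by
  rcases eq_or_ne N ⊤ with rfl | hN
  · simp [EReal.sub_top]
  · have h1 : (N : EReal) ≠ ⊤ := by simpa using hN
    rw [EReal.sub_le_iff_le_add (.inl (by simp)) (.inl h1), ← EReal.coe_ennreal_add,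
      EReal.coe_ennreal_le_coe_ennreal_iff]
    simp [hN]

end Dominates

namespace Grushin

/-! ### Comparisons in gauge polar coordinates -/

section Polar

variable {n : ℕ}

theorem lintegral_polar (hn : 2 ≤ n) {F : Space n → ENNReal} (hF : Measurable F) :
    ∫⁻ p, F p = ∫⁻ θ, ∫⁻ r, F (dil r (pol θ)) ∂radPow (n + 1) ∂angMeasure n := by
  rw [← (measurePreserving_dil_pol hn).lintegral_comp hF]
  exact lintegral_prod _ (hF.comp measurable_dil_pol).aemeasurable

theorem ae_comp_rho (hn : 2 ≤ n) {P : ℝ → Prop} (h : ∀ᵐ r ∂radPow (n + 1), P r) :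
    ∀ᵐ p : Space n, P (rho p) := by
  have hmp := measurePreserving_dil_pol hn
  obtain ⟨Z, hZ, hZm, hZ0⟩ := exists_measurable_superset_of_null h
  have h1 : ∀ᵐ r ∂radPow (n + 1), r ∉ Z := measure_eq_zero_iff_ae_notMem.1 hZ0
  have h2 : ∀ᵐ q ∂(angMeasure n).prod (radPow (n + 1)), q.2 ∉ Z :=
    Measure.quasiMeasurePreserving_snd.ae h1
  have h3 : ∀ᵐ q ∂(angMeasure n).prod (radPow (n + 1)), (0 : ℝ) < q.2 :=
    Measure.quasiMeasurePreserving_snd.ae (ae_radPow_pos _)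
  have h4 : ∀ᵐ q ∂(angMeasure n).prod (radPow (n + 1)), q.1.2 ∈ Ioo 0 Real.pi :=
    Measure.quasiMeasurePreserving_fst.ae ae_angMeasure_mem
  have h5 : ∀ᵐ p : Space n, rho p ∉ Z := by
    rw [← hmp.map_eq, ae_map_iff (p := fun p => rho p ∉ Z) hmp.aemeasurable
      (continuous_rho.measurable hZm).compl]
    filter_upwards [h2, h3, h4] with q q2 q3 q4
    rwa [rho_dil q3.le, rho_pol q4, mul_one]
  filter_upwards [h5] with p hp
  by_contra h0
  exact hp (hZ h0)

/-- If the negative part of b has finite integral, it has finite integral on almost every orbit;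
there the comparison is a genuine inequality and can be integrated over the angles. -/
theorem _root_.IntegralDominates.of_polar (hn : 2 ≤ n) {a b : Space n → ℝ} (ha : Measurable a)
    (hb : Measurable b) (h : ∀ θ : Ang n, θ.2 ∈ Ioo 0 Real.pi → IntegralDominates (radPow (n + 1))
      (fun r => a (dil r (pol θ))) fun r => b (dil r (pol θ))) :
    IntegralDominates volume a b := by
  intro hN
  have hq : Measurable fun q : Ang n × ℝ => dil q.2 (pol q.1) := measurable_dil_pol
  rw [lintegral_polar hn (by fun_prop)] at hN
  rw [lintegral_polar hn (by fun_prop), lintegral_polar hn (by fun_prop),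
    lintegral_polar hn (by fun_prop)]
  have mN : Measurable fun θ : Ang n =>
      ∫⁻ r, ENNReal.ofReal (-b (dil r (pol θ))) ∂radPow (n + 1) :=
    Measurable.lintegral_prod_right' (f := fun q : Ang n × ℝ =>
      ENNReal.ofReal (-b (dil q.2 (pol q.1)))) (hb.neg.comp hq).ennreal_ofReal
  rw [← lintegral_add_right _ mN]
  refine lintegral_mono_ae ?_
  filter_upwards [ae_angMeasure_mem, ae_lt_top mN hN] with θ hθ hfin
  exact h θ hθ hfin.ne

theorem lintegral_sq_sqrt_sin_pos (hn : 2 ≤ n) :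
    ∫⁻ θ : Ang n, ENNReal.ofReal (√(Real.sin θ.2) ^ 2) ∂angMeasure n ≠ 0 ∧
    ∫⁻ θ : Ang n, ENNReal.ofReal (√(Real.sin θ.2) ^ 2) ∂angMeasure n ≠ ⊤ := by
  constructor
  · rw [Ne, lintegral_eq_zero_iff (by fun_prop)]
    intro h
    have h2 : ∀ᵐ _ ∂angMeasure n, False := by
      filter_upwards [h, ae_angMeasure_mem] with θ h1 h2
      have := sqrt_sin_pos h2
      simp only [Pi.zero_apply, ENNReal.ofReal_eq_zero] at h1
      exact absurd h1 (not_le.2 (by positivity))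
    have h3 : angMeasure n = 0 := by simpa using h2
    have h4 := (measurePreserving_dil_pol hn).map_eq
    rw [h3, Measure.zero_prod, Measure.map_zero] at h4
    exact NeZero.ne (volume : Measure (Space n)) h4.symm
  · exact ((BddOnAngle.sqrt_sin.pow 2).integrable_angMeasure (n := n)).lintegral_lt_top.ne

theorem lintegral_radial (hn : 2 ≤ n) {g : ℝ → ℝ} (hg : Measurable g) :
    ∫⁻ p : Space n, ENNReal.ofReal (rho p ^ 2 * kap p * g (rho p)) =
      (∫⁻ θ : Ang n, ENNReal.ofReal (√(Real.sin θ.2) ^ 2) ∂angMeasure n) *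
        ∫⁻ r, ENNReal.ofReal (g r) ∂radPow (n + 1) := by
  have hrho : Measurable (rho (n := n)) := continuous_rho.measurable
  have hkap : Measurable (kap (n := n)) := by unfold kap; fun_prop
  rw [lintegral_polar hn (by fun_prop), ← lintegral_mul_const _ (by fun_prop)]
  refine lintegral_congr_ae (ae_angMeasure_mem.mono fun θ hθ => ?_)
  simp only []
  rw [← lintegral_const_mul _ (by fun_prop)]
  refine lintegral_congr_ae ((ae_radPow_pos _).mono fun r hr => ?_)
  simp only []
  rw [← ENNReal.ofReal_mul (by positivity), rho_dil hr.le, kap_dil hr, rho_pol hθ, kap_pol hθ]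
  congr 1
  field_simp

/-- The weight ϱ² κ depends on the angle only, so its angular integral factors out. That constant is
neither zero nor infinite and cancels. -/
theorem _root_.IntegralDominates.of_radial (hn : 2 ≤ n) {a b : ℝ → ℝ} (ha : Measurable a)
    (hb : Measurable b) (h : IntegralDominates (volume : Measure (Space n))
      (fun p => rho p ^ 2 * kap p * a (rho p)) fun p => rho p ^ 2 * kap p * b (rho p)) :
    IntegralDominates (radPow (n + 1)) a b := by
  obtain ⟨c0, c1⟩ := lintegral_sq_sqrt_sin_pos hn
  unfold IntegralDominates at h
  simp only [← mul_neg] at h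
  rw [lintegral_radial hn ha, lintegral_radial hn hb,
    lintegral_radial hn (g := fun r => -b r) hb.neg, ← mul_add] at h
  intro hN
  exact (ENNReal.mul_le_mul_iff_right c0 c1).1 (h (ENNReal.mul_ne_top c1 hN))

theorem isOpen_ball (R : EReal) : IsOpen (ball n R) :=
  isOpen_lt (continuous_coe_real_ereal.comp continuous_rho) continuous_const

theorem extIntegral_ball_le_iff {R : EReal} {a b a' b' : Space n → ℝ} (ha : ∀ p, 0 ≤ a p)
    (ha0 : ∀ p ∉ ball n R, a p = 0) (hb0 : ∀ p ∉ ball n R, b p = 0) (haa' : a =ᵐ[volume] a')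
    (hbb' : b =ᵐ[volume] b') :
    extIntegral (ball n R) b ≤ extIntegral (ball n R) a ↔ IntegralDominates volume a' b' := by
  have e : ∀ f : Space n → ℝ, (∀ p ∉ ball n R, f p = 0) →
      ∫⁻ p in ball n R, ENNReal.ofReal (f p) = ∫⁻ p, ENNReal.ofReal (f p) := fun f hf => by
    rw [← lintegral_indicator (isOpen_ball R).measurableSet]
    congr 1
    exact indicator_eq_self.2 fun p hp => by_contra fun h => hp (by simp [hf p h])
  have h0 : ∀ p, ENNReal.ofReal (-a p) = 0 := fun p =>
    ENNReal.ofReal_of_nonpos (by simpa using ha p)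
  rw [← IntegralDominates.congr_ae_iff haa' hbb', extIntegral, extIntegral, e a ha0, e b hb0,
    e (fun p => -b p) fun p hp => by simp [hb0 p hp]]
  simp only [h0, lintegral_zero, EReal.coe_ennreal_zero, sub_zero]
  exact EReal.coe_ennreal_sub_le_iff

end Polar

end Grushin

end

section

open MeasureTheory ProbabilityTheory Set Filter Topology

namespace Grushin

/-! ### Lower bound for the second-order energy, and radial functions -/

section Radial

variable {n : ℕ} {u : Space n → ℝ} {R : EReal}

theorem measurable_rho : Measurable (rho (n := n)) := continuous_rho.measurable

theorem measurable_kap : Measurable (kap (n := n)) := by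
  have := measurable_rho (n := n)
  unfold kap
  fun_prop

theorem kap_pos {p : Space n} (hp : p.1 ≠ 0) : 0 < kap p := by
  have : 0 < rho p := rho_pos fun h => hp (by rw [h]; rfl)
  unfold kap
  positivity

/-- With ψ = ϱ² κ, expand the square of ψ `radLap u` + `angLap u`. Twice the mixed term contributes
2Γ(Eu,Eu) + 2(n-2)Γ(u,u), and the squared angular term at least (n+1)Γ(u,u); altogether 3n - 3 times
Γ(u,u). -/
theorem lintegral_lap_sq_ge (hn : 2 ≤ n) (hu : IsTest {0}ᶜ u) :
    ∫⁻ p, ENNReal.ofReal (rho p ^ 2 * kap p * radLap u p ^ 2 +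
      (rho p ^ 2)⁻¹ * (2 * gam (euler u) (euler u) p + (3 * n - 3) * gam u u p)) ≤
      ∫⁻ p, ENNReal.ofReal (lap u p ^ 2 / (rho p ^ 2 * kap p)) := by
  have hn' : (2 : ℝ) ≤ n := by exact_mod_cast hn
  have hψ : ∀ p : Space n, 0 ≤ rho p ^ 2 * kap p := fun p =>
    mul_nonneg (sq_nonneg _) (kap_nonneg p)
  have mrho := measurable_rho (n := n)
  have mkap := measurable_kap (n := n)
  have mlap : Measurable (lap u) := hu.lap.continuous.measurable
  -- The weight ψ vanishes on x = 0, so this integral can diverge. If it does there is nothing to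
  -- prove; otherwise the squared angular term is integrable too, which `integral_gam_div_le_angLap`
  -- requires.
  by_cases htop : ∫⁻ p, ENNReal.ofReal (lap u p ^ 2 / (rho p ^ 2 * kap p)) = ⊤
  · rw [htop]; exact le_top
  have hL0 : 0 ≤ᵐ[volume] fun p => lap u p ^ 2 / (rho p ^ 2 * kap p) :=
    .of_forall fun p => div_nonneg (sq_nonneg _) (hψ p)
  have iL : Integrable fun p => lap u p ^ 2 / (rho p ^ 2 * kap p) :=
    (lintegral_ofReal_ne_top_iff_integrable
      (Measurable.aestronglyMeasurable (by fun_prop)) hL0).1 htop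
  have iA : Integrable fun p => rho p ^ 2 * kap p * radLap u p ^ 2 := by
    have := (hu.radLap.mul hu.radLap).mul_left (k := fun p => rho p ^ 2 * kap p)
      fun p hp => ((contDiffAt_rho hp).pow 2).mul (contDiffAt_kap hp)
    refine (this.integrable (μ := volume)).congr (.of_forall fun p => ?_)
    simp only []; ring
  have iX : Integrable fun p => radLap u p * angLap u p := (hu.radLap.mul hu.angLap).integrable
  have hexp : (fun p => lap u p ^ 2 / (rho p ^ 2 * kap p)) =ᵐ[volume] fun p =>
      rho p ^ 2 * kap p * radLap u p ^ 2 + 2 * (radLap u p * angLap u p) +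
        angLap u p ^ 2 / (rho p ^ 2 * kap p) := by
    filter_upwards [ae_fst_ne_zero hn] with p hp
    have hp0 : p ≠ 0 := fun h => hp (by rw [h]; rfl)
    have := rho_pos hp0
    have := kap_pos hp
    rw [lap_eq hp0]
    field_simp
    ring
  have iM : Integrable fun p => angLap u p ^ 2 / (rho p ^ 2 * kap p) := by
    refine ((iL.sub iA).sub (iX.const_mul 2)).congr (hexp.mono fun p hp => ?_)
    simp only [Pi.sub_apply]
    simp only [] at hp
    rw [hp]; ring
  have iE := (isTest_gam_div hu.euler hu.euler).integrable (μ := volume)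
  have iG := (isTest_gam_div hu hu).integrable (μ := volume)
  have iEG : Integrable fun p => (rho p ^ 2)⁻¹ * (2 * gam (euler u) (euler u) p +
      (3 * n - 3) * gam u u p) := by
    refine ((iE.const_mul 2).add (iG.const_mul (3 * n - 3))).congr (.of_forall fun p => ?_)
    simp only [Pi.add_apply]; ring
  have eEG : ∫ p, (rho p ^ 2)⁻¹ * (2 * gam (euler u) (euler u) p + (3 * n - 3) * gam u u p) =
      2 * (∫ p, (rho p ^ 2)⁻¹ * gam (euler u) (euler u) p) +
        (3 * n - 3) * ∫ p, (rho p ^ 2)⁻¹ * gam u u p := by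
    rw [← integral_const_mul, ← integral_const_mul,
      ← integral_add (iE.const_mul 2) (iG.const_mul (3 * n - 3))]
    exact integral_congr_ae (.of_forall fun p => by simp only []; ring)
  rw [← ofReal_integral_eq_lintegral_ofReal iL hL0,
    ← ofReal_integral_eq_lintegral_ofReal (iA.fun_add iEG) (.of_forall fun p => ?_)]
  · refine ENNReal.ofReal_le_ofReal ?_
    rw [integral_congr_ae hexp, integral_add (iA.fun_add (iX.const_mul 2)) iM,
      integral_add iA (iX.const_mul 2), integral_const_mul, integral_radLap_mul_angLap hu]
    rw [integral_add iA iEG, eEG]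
    have := integral_gam_div_le_angLap hn hu iM
    linarith
  · exact add_nonneg (mul_nonneg (hψ p) (sq_nonneg _)) (mul_nonneg (by positivity)
      (add_nonneg (mul_nonneg zero_le_two (gam_self_nonneg _ _))
        (mul_nonneg (by linarith) (gam_self_nonneg _ _))))

theorem zero_notMem_interval : (0 : ℝ) ∉ interval R := fun h => lt_irrefl _ h.1

theorem isTest_deriv {V : Set ℝ} {g : ℝ → ℝ} (hg : IsTest V g) : IsTest V (deriv g) := by
  have := hg.fderiv_apply (X := fun _ => (1 : ℝ)) contDiff_const
  simpa using this

theorem isTest_radial {g : ℝ → ℝ} (hg : IsTest (interval R) g) :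
    IsTest (ball n R \ {0}) fun p => g (rho p) :=
  (isTest_comp_rho zero_notMem_interval hg).mono fun p hp =>
    ⟨hp.2, fun h => lt_irrefl (0 : ℝ) (by
      have := hp.1
      rwa [mem_singleton_iff.1 h, rho_zero] at this)⟩

theorem IsTest.compl_zero {U : Set (Space n)} (hu : IsTest (U \ {0}) u) :
    IsTest {0}ᶜ u := hu.mono fun _ hp => hp.2

/-- Green's formula tested against `angLap` of the function itself gives ∫ (Λv)² = -∫ Γ(Λv, v) = 0,
since v is a constant for `gam`. -/
theorem angLap_radial {g : ℝ → ℝ} (hg : IsTest (interval R) g) :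
    ∀ᵐ p : Space n, angLap (fun q => g (rho q)) p = 0 := by
  have hv := (isTest_radial (n := n) hg).compl_zero
  have h := integral_mul_angLap hv.angLap hv
  have h0 : ∫ p : Space n, gam (angLap fun q => g (rho q)) (fun q => g (rho q)) p = 0 := by
    refine integral_eq_zero_of_ae (ae_ne_zero.mono fun p hp => ?_)
    rw [gam_comm]
    exact gam_comp_rho hp (hg.differentiable _) _
  rw [h0, neg_zero, integral_eq_zero_iff_of_nonneg_ae
    (.of_forall fun p => mul_self_nonneg _) (hv.angLap.mul hv.angLap).integrable] at h
  exact h.mono fun p hp => mul_self_eq_zero.1 hp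

/-- The radial part of the Grushin operator on functions of `ϱ`, up to the factor `|∇_G ϱ|²`. -/
noncomputable def radialLap (n : ℕ) (g : ℝ → ℝ) (r : ℝ) : ℝ :=
  deriv (deriv g) r + (n + 1) / r * deriv g r

theorem euler_radial {g : ℝ → ℝ} (hg : Differentiable ℝ g) (p : Space n) :
    euler (fun q => g (rho q)) p = rho p * deriv g (rho p) := by
  by_cases hp : p = 0
  · rw [hp, rho_zero, zero_mul, euler]
    have : eul (0 : Space n) = 0 := by simp [eul]
    rw [this, map_zero]
  · exact euler_comp_rho hp (hg _)

theorem radLap_radial {g : ℝ → ℝ} (hg : IsTest (interval R) g) {p : Space n} (hp : p ≠ 0) :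
    radLap (fun q => g (rho q)) p = radialLap n g (rho p) := by
  have hr := rho_pos hp
  have h1 : euler (fun q : Space n => g (rho q)) = fun q => (fun s => s * deriv g s) (rho q) :=
    funext fun q => euler_radial hg.differentiable q
  have hd := (isTest_deriv hg).differentiable
  have h2 : HasDerivAt (fun s => s * deriv g s) (1 * deriv g (rho p) +
      rho p * deriv (deriv g) (rho p)) (rho p) :=
    (hasDerivAt_id' _).fun_mul (hd _).hasDerivAt
  rw [radLap, h1, euler_comp_rho hp h2.differentiableAt, h2.deriv, radialLap]
  field_simp
  ring

variable {W W' : ℝ → ℝ}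

theorem IsTest.gradSq_eq_zero {U : Set (Space n)} (hu : IsTest U u) {p : Space n} (hp : p ∉ U) :
    gradSq u p = 0 := by
  simp [gradSq, (hu.dx _).eq_zero_of_notMem hp, hu.dt.eq_zero_of_notMem hp]

theorem lap_sq_div_ae :
    (fun p : Space n => lap u p ^ 2 / gradSq rho p) =ᵐ[volume]
      fun p => lap u p ^ 2 / (rho p ^ 2 * kap p) :=
  ae_ne_zero.mono fun p hp => by simp only [gradSq_rho hp]

theorem weight_sq_ae (hu : IsTest (ball n R \ {0}) u)
    (hW : ∀ᵐ p : Space n, p ∈ ball n R \ {0} → W (rho p) = W' (rho p)) :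
    (fun p => W (rho p) * u p ^ 2 * gradSq rho p) =ᵐ[volume]
      fun p => rho p ^ 2 * kap p * (W' (rho p) * u p ^ 2) := by
  filter_upwards [hW, ae_ne_zero] with p h1 h2
  by_cases hp : p ∈ ball n R \ {0}
  · rw [h1 hp, gradSq_rho h2]; ring
  · simp [hu.eq_zero_of_notMem hp]

theorem weight_gradSq_ae (hu : IsTest (ball n R \ {0}) u)
    (hW : ∀ᵐ p : Space n, p ∈ ball n R \ {0} → W (rho p) = W' (rho p)) :
    (fun p => W (rho p) * gradSq u p) =ᵐ[volume]
      fun p => W' (rho p) * (gam u u p + kap p * euler u p ^ 2) := by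
  filter_upwards [hW, ae_ne_zero] with p h1 h2
  by_cases hp : p ∈ ball n R \ {0}
  · rw [h1 hp, gradSq_eq h2]
  · rw [← gradSq_eq h2, hu.gradSq_eq_zero hp]; simp

theorem notMem_diff_of_notMem {p : Space n} (hp : p ∉ ball n R) : p ∉ ball n R \ {0} :=
  fun h => hp h.1

theorem gradSq_nonneg (u : Space n → ℝ) (p : Space n) : 0 ≤ gradSq u p := by
  unfold gradSq; positivity

theorem hardyIneq_iff (hu : IsTest (ball n R \ {0}) u)
    (hW : ∀ᵐ p : Space n, p ∈ ball n R \ {0} → W (rho p) = W' (rho p)) :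
    HardyIneq R W u ↔ IntegralDominates volume (fun p => gam u u p + kap p * euler u p ^ 2)
      fun p => rho p ^ 2 * kap p * (W' (rho p) * u p ^ 2) :=
  extIntegral_ball_le_iff (gradSq_nonneg u)
    (fun _ hp => hu.gradSq_eq_zero (notMem_diff_of_notMem hp))
    (fun _ hp => by simp [hu.eq_zero_of_notMem (notMem_diff_of_notMem hp)])
    (ae_ne_zero.mono fun _ hp => gradSq_eq hp u) (weight_sq_ae hu hW)

theorem rellichIneq_iff (hu : IsTest (ball n R \ {0}) u)
    (hW : ∀ᵐ p : Space n, p ∈ ball n R \ {0} → W (rho p) = W' (rho p)) :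
    RellichIneq R W u ↔ IntegralDominates volume (fun p => lap u p ^ 2 / (rho p ^ 2 * kap p))
      fun p => rho p ^ 2 * kap p * (W' (rho p) * u p ^ 2) :=
  extIntegral_ball_le_iff (fun p => div_nonneg (sq_nonneg _) (gradSq_nonneg _ p))
    (fun _ hp => by simp [hu.lap.eq_zero_of_notMem (notMem_diff_of_notMem hp)])
    (fun _ hp => by simp [hu.eq_zero_of_notMem (notMem_diff_of_notMem hp)])
    lap_sq_div_ae (weight_sq_ae hu hW)

theorem hardyRellichIneq_iff (hu : IsTest (ball n R \ {0}) u)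
    (hW : ∀ᵐ p : Space n, p ∈ ball n R \ {0} → W (rho p) = W' (rho p)) :
    HardyRellichIneq R W u ↔
      IntegralDominates volume (fun p => lap u p ^ 2 / (rho p ^ 2 * kap p))
        fun p => W' (rho p) * (gam u u p + kap p * euler u p ^ 2) :=
  extIntegral_ball_le_iff (fun p => div_nonneg (sq_nonneg _) (gradSq_nonneg _ p))
    (fun _ hp => by simp [hu.lap.eq_zero_of_notMem (notMem_diff_of_notMem hp)])
    (fun _ hp => by simp [hu.gradSq_eq_zero (notMem_diff_of_notMem hp)])
    lap_sq_div_ae (weight_gradSq_ae hu hW)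

variable {g : ℝ → ℝ}

theorem gradSq_radial_ae (hg : IsTest (interval R) g) :
    (fun p : Space n => gam (fun q => g (rho q)) (fun q => g (rho q)) p +
      kap p * euler (fun q => g (rho q)) p ^ 2) =ᵐ[volume]
      fun p => rho p ^ 2 * kap p * deriv g (rho p) ^ 2 := by
  filter_upwards [ae_ne_zero] with p hp
  rw [gam_comp_rho hp (hg.differentiable _), euler_radial hg.differentiable]
  ring

theorem lap_sq_radial_ae (hn : 2 ≤ n) (hg : IsTest (interval R) g) :
    (fun p : Space n => lap (fun q => g (rho q)) p ^ 2 / (rho p ^ 2 * kap p)) =ᵐ[volume]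
      fun p => rho p ^ 2 * kap p * radialLap n g (rho p) ^ 2 := by
  filter_upwards [angLap_radial hg, ae_fst_ne_zero hn] with p h1 h2
  have hp0 : p ≠ 0 := fun h => h2 (by rw [h]; rfl)
  have := rho_pos hp0
  have := kap_pos h2
  rw [lap_eq hp0, h1, radLap_radial hg hp0]
  field_simp
  ring

theorem measurable_radialLap (g : ℝ → ℝ) : Measurable (radialLap n g) := by
  unfold radialLap
  have := measurable_deriv g
  have := measurable_deriv (deriv g)
  fun_prop

/-- The radial inequality as a one-dimensional inequality for the profile. It is stated for every
test profile because it will be used with the restriction of a non-radial function to an orbit. -/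
theorem hardy_radial (hn : 2 ≤ n) (hg : IsTest (interval R) g) (hm : Measurable W')
    (hW : ∀ᵐ p : Space n, p ∈ ball n R \ {0} → W (rho p) = W' (rho p))
    (h : HardyIneq R W fun p : Space n => g (rho p)) :
    IntegralDominates (radPow (n + 1)) (fun r => deriv g r ^ 2) fun r => W' r * g r ^ 2 := by
  have := measurable_deriv g
  have := hg.continuous.measurable
  refine .of_radial hn (by fun_prop) (by fun_prop) ?_
  exact ((hardyIneq_iff (isTest_radial hg) hW).1 h).congr_ae (gradSq_radial_ae hg) .rfl

theorem rellich_radial (hn : 2 ≤ n) (hg : IsTest (interval R) g) (hm : Measurable W')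
    (hW : ∀ᵐ p : Space n, p ∈ ball n R \ {0} → W (rho p) = W' (rho p))
    (h : RellichIneq R W fun p : Space n => g (rho p)) :
    IntegralDominates (radPow (n + 1)) (fun r => radialLap n g r ^ 2) fun r => W' r * g r ^ 2 := by
  have := measurable_radialLap (n := n) g
  have := hg.continuous.measurable
  refine .of_radial hn (by fun_prop) (by fun_prop) ?_
  exact ((rellichIneq_iff (isTest_radial hg) hW).1 h).congr_ae (lap_sq_radial_ae hn hg) .rfl

theorem hardyRellich_radial (hn : 2 ≤ n) (hg : IsTest (interval R) g) (hm : Measurable W')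
    (hW : ∀ᵐ p : Space n, p ∈ ball n R \ {0} → W (rho p) = W' (rho p))
    (h : HardyRellichIneq R W fun p : Space n => g (rho p)) :
    IntegralDominates (radPow (n + 1)) (fun r => radialLap n g r ^ 2)
      fun r => W' r * deriv g r ^ 2 := by
  have := measurable_radialLap (n := n) g
  have := measurable_deriv g
  refine .of_radial hn (by fun_prop) (by fun_prop) ?_
  refine ((hardyRellichIneq_iff (isTest_radial hg) hW).1 h).congr_ae (lap_sq_radial_ae hn hg) ?_
  filter_upwards [gradSq_radial_ae (n := n) hg] with p hp
  rw [hp]; ring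

end Radial

end Grushin

end

section

open MeasureTheory ProbabilityTheory Set Filter Topology

namespace Grushin

/-! ### Restriction to dilation orbits -/

section Fiber

variable {n : ℕ} {u : Space n → ℝ} {R : EReal} {θ : Ang n}

theorem contDiff_dil (p : Space n) : ContDiff ℝ (⊤ : ℕ∞) fun r => dil r p := by
  unfold dil; fun_prop

/-- For r < 0 the map `dil r` reflects x, so functions of r have to be cut off to r > 0. The cut is
smooth because the support of u avoids the origin. -/
theorem isTest_indicator_of_dil (hu : IsTest (ball n R \ {0}) u) (hθ : θ.2 ∈ Ioo 0 Real.pi)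
    {F : ℝ → ℝ} (hF : ContDiff ℝ (⊤ : ℕ∞) F) (hs : ∀ r, F r ≠ 0 → dil r (pol θ) ∈ tsupport u) :
    IsTest (interval R) ((Ioi 0).indicator F) := by
  have hcont : Continuous fun r => dil r (pol θ) := (contDiff_dil _).continuous
  set K : Set ℝ := Ici 0 ∩ (fun r => dil r (pol θ)) ⁻¹' tsupport u with hK
  have hKc : IsClosed K := isClosed_Ici.inter ((isClosed_tsupport u).preimage hcont)
  have hrho : ∀ r, 0 ≤ r → rho (dil r (pol θ)) = r := fun r hr => by
    rw [rho_dil hr, rho_pol hθ, mul_one]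
  have hKi : K ⊆ interval R := by
    rintro r ⟨hr, hr'⟩
    have h1 := hu.2.2 hr'
    have h2 := hrho r hr
    refine ⟨lt_of_le_of_ne hr fun h0 => h1.2 ?_, ?_⟩
    · rw [mem_singleton_iff, ← rho_eq_zero, h2, h0]
    · have := h1.1
      rwa [ball, mem_ofPred_eq, h2] at this
  have hKcomp : IsCompact K := by
    obtain ⟨M, hM⟩ := (hu.2.1.isCompact.image continuous_rho).bddAbove
    refine (isCompact_Icc (a := 0) (b := M)).of_isClosed_subset hKc fun r hr => ⟨hr.1, ?_⟩
    rw [← hrho r hr.1]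
    exact hM ⟨_, hr.2, rfl⟩
  have hsupp : tsupport ((Ioi 0).indicator F) ⊆ K := by
    refine closure_minimal (fun r hr => ?_) hKc
    have h0 : r ∈ Ioi (0 : ℝ) := by_contra fun h => hr (indicator_of_notMem h F)
    rw [Function.mem_support, indicator_of_mem h0] at hr
    exact ⟨le_of_lt (mem_Ioi.1 h0), hs r hr⟩
  refine ⟨contDiff_iff_contDiffAt.2 fun r => ?_,
    hKcomp.of_isClosed_subset (isClosed_tsupport _) hsupp, hsupp.trans hKi⟩
  by_cases hr : r ∈ Ioi (0 : ℝ)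
  · refine hF.contDiffAt.congr_of_eventuallyEq ?_
    filter_upwards [isOpen_Ioi.mem_nhds hr] with s hs using indicator_of_mem hs F
  · refine (contDiffAt_const (c := 0)).congr_of_eventuallyEq
      (notMem_tsupport_iff_eventuallyEq.1 fun h => hr (hKi (hsupp h)).1)

/-- The restriction of `u` to the dilation orbit of `pol θ`. -/
noncomputable def fiber (u : Space n → ℝ) (θ : Ang n) : ℝ → ℝ :=
  (Ioi 0).indicator fun r => u (dil r (pol θ))

/-- The rescaled derivative of `u` along the `a`-th angular field on the orbit of `pol θ`. -/
noncomputable def angFiber (u : Space n → ℝ) (θ : Ang n) (a : Option (Fin n)) : ℝ → ℝ :=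
  (Ioi 0).indicator fun r => fderiv ℝ u (dil r (pol θ)) (dil r (angField a (pol θ)))

theorem isTest_fiber (hu : IsTest (ball n R \ {0}) u) (hθ : θ.2 ∈ Ioo 0 Real.pi) :
    IsTest (interval R) (fiber u θ) :=
  isTest_indicator_of_dil hu hθ (hu.1.comp (contDiff_dil _)) fun _ h => subset_tsupport u h

theorem isTest_angFiber (hu : IsTest (ball n R \ {0}) u) (hθ : θ.2 ∈ Ioo 0 Real.pi)
    (a : Option (Fin n)) : IsTest (interval R) (angFiber u θ a) := by
  refine isTest_indicator_of_dil hu hθ ?_ fun r h => ?_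
  · exact ((hu.1.fderiv_right (m := (⊤ : ℕ∞)) (by norm_cast)).comp (contDiff_dil _)).clm_apply
      (contDiff_dil _)
  · refine support_fderiv_subset ℝ fun h0 => h ?_
    rw [h0]; rfl

theorem eventuallyEq_indicator_Ioi {r : ℝ} (hr : 0 < r) (F : ℝ → ℝ) :
    (Ioi 0).indicator F =ᶠ[𝓝 r] F := by
  filter_upwards [isOpen_Ioi.mem_nhds hr] with s hs using indicator_of_mem hs F

variable {r : ℝ}

theorem fiber_apply (hr : 0 < r) : fiber u θ r = u (dil r (pol θ)) :=
  (eventuallyEq_indicator_Ioi hr _).self_of_nhds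

theorem deriv_fiber (hu : Differentiable ℝ u) (hr : 0 < r) :
    deriv (fiber u θ) r = r⁻¹ * euler u (dil r (pol θ)) :=
  ((hasDerivAt_comp_dil hr.ne' (hu _)).congr_of_eventuallyEq
    (eventuallyEq_indicator_Ioi hr _)).deriv

theorem deriv_angFiber (hu : ContDiff ℝ 2 u) (hr : 0 < r) (a : Option (Fin n)) :
    deriv (angFiber u θ a) r =
      r⁻¹ * fderiv ℝ (euler u) (dil r (pol θ)) (dil r (angField a (pol θ))) :=
  ((hasDerivAt_fderiv_dil hu hr.ne' _ _).congr_of_eventuallyEq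
    (eventuallyEq_indicator_Ioi hr _)).deriv

theorem radLap_dil (hu : IsTest {0}ᶜ u) (hθ : θ.2 ∈ Ioo 0 Real.pi) (hr : 0 < r) :
    radLap u (dil r (pol θ)) = radialLap n (fiber u θ) r := by
  have h1 : deriv (fiber u θ) =ᶠ[𝓝 r] fun s => s⁻¹ * euler u (dil s (pol θ)) := by
    filter_upwards [isOpen_Ioi.mem_nhds hr] with s hs using deriv_fiber hu.differentiable hs
  have h2 := (hasDerivAt_inv hr.ne').fun_mul
    (hasDerivAt_comp_dil (u := euler u) (p := pol θ) hr.ne' (hu.euler.differentiable _))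
  rw [radialLap, h1.deriv_eq, h2.deriv, deriv_fiber hu.differentiable hr, radLap, rho_dil hr.le,
    rho_pol hθ]
  field_simp
  ring

theorem gam_dil_pol (hr : 0 < r) :
    gam u u (dil r (pol θ)) = (r ^ 2)⁻¹ * ∑ a, angFiber u θ a r ^ 2 := by
  rw [gam_dil _ _ hr]
  congr 1
  refine Finset.sum_congr rfl fun a _ => ?_
  rw [angFiber, (eventuallyEq_indicator_Ioi hr _).self_of_nhds, sq]

/-- With `gam_dil_pol`, this writes the angular energies of u and Eu on an orbit through finitely
many one-dimensional test functions and their derivatives. These play the role of the coefficients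
of an expansion in spherical harmonics. -/
theorem gam_euler_dil_pol (hu : ContDiff ℝ 2 u) (hr : 0 < r) :
    gam (euler u) (euler u) (dil r (pol θ)) = ∑ a, deriv (angFiber u θ a) r ^ 2 := by
  rw [gam_dil _ _ hr, Finset.mul_sum]
  refine Finset.sum_congr rfl fun a _ => ?_
  rw [deriv_angFiber hu hr]
  field_simp

theorem rho_sq_mul_kap_dil (hθ : θ.2 ∈ Ioo 0 Real.pi) (hr : 0 < r) :
    rho (dil r (pol θ)) ^ 2 * kap (dil r (pol θ)) = √(Real.sin θ.2) ^ 2 := by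
  rw [rho_dil hr.le, kap_dil hr, rho_pol hθ, kap_pol hθ]
  field_simp

theorem kap_mul_euler_sq_dil (hu : Differentiable ℝ u) (hθ : θ.2 ∈ Ioo 0 Real.pi) (hr : 0 < r) :
    kap (dil r (pol θ)) * euler u (dil r (pol θ)) ^ 2 =
      √(Real.sin θ.2) ^ 2 * deriv (fiber u θ) r ^ 2 := by
  rw [deriv_fiber hu hr, kap_dil hr, kap_pol hθ]
  field_simp

end Fiber

/-! ### Reduction to radial functions -/

section Reduction

variable {n : ℕ} {u : Space n → ℝ} {R : EReal} {W W' : ℝ → ℝ}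

theorem measurableSet_interval (R : EReal) : MeasurableSet (interval R) :=
  measurableSet_Ioi.inter (measurableSet_lt measurable_coe_real_ereal measurable_const)

theorem setLIntegral_interval (k : ℕ) {G H : ℝ → ℝ}
    (h : ∀ᵐ t ∂volume.restrict (interval R), G t = t ^ k * H t)
    (h0 : ∀ t ∉ interval R, H t = 0) :
    ∫⁻ t in interval R, ENNReal.ofReal (G t) = ∫⁻ t, ENNReal.ofReal (H t) ∂radPow k := by
  rw [lintegral_radPow]
  have e1 : ∫⁻ t in interval R, ENNReal.ofReal (G t) =
      ∫⁻ t in interval R, ENNReal.ofReal (t ^ k) * ENNReal.ofReal (H t) := by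
    refine lintegral_congr_ae ?_
    filter_upwards [h, ae_restrict_mem (measurableSet_interval R)] with t h1 h2
    rw [h1, ENNReal.ofReal_mul (pow_nonneg h2.1.le _)]
  rw [e1, ← lintegral_indicator (measurableSet_interval R), ← lintegral_indicator measurableSet_Ioi]
  congr 1
  funext t
  by_cases ht : t ∈ interval R
  · rw [indicator_of_mem ht, indicator_of_mem (show t ∈ Ioi (0 : ℝ) from ht.1)]
  · rw [indicator_of_notMem ht, indicator]
    simp [h0 t ht]

/-- Relative to the weight t^{Q-1} = t^{n+1}, the powers t^{Q-3} and t^{Q-5} become t⁻² and t⁻⁴, and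
2(2λ₁ + Q - 4) = 3n - 3 is the coefficient found in `lintegral_lap_sq_ge`. -/
theorem OneDimCondition.integralDominates (hn : 2 ≤ n) (h : OneDimCondition n R W)
    (hW : W =ᵐ[volume.restrict (interval R)] W') {f : ℝ → ℝ} (hf : IsTest (interval R) f) :
    IntegralDominates (radPow (n + 1))
      (fun r => (r ^ 2)⁻¹ * (2 * deriv f r ^ 2 + (3 * n - 3) * ((r ^ 2)⁻¹ * f r ^ 2)))
      fun r => W' r * ((r ^ 2)⁻¹ * f r ^ 2) := by
  have hn' : (2 : ℝ) ≤ n := by exact_mod_cast hn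
  have hz : ∀ t ∉ interval R, f t = 0 := fun t ht => hf.eq_zero_of_notMem ht
  have hz' : ∀ t ∉ interval R, deriv f t = 0 := fun t ht => (isTest_deriv hf).eq_zero_of_notMem ht
  have e3 : ∀ t : ℝ, 0 < t → t ^ ((homDim n : ℤ) - 3) = t ^ (n + 1) * (t ^ 2)⁻¹ := by
    intro t ht
    rw [homDim, ← zpow_natCast, ← zpow_natCast, ← zpow_neg, ← zpow_add₀ ht.ne']
    congr 1
    push_cast
    ring
  have e5 : ∀ t : ℝ, 0 < t → t ^ ((homDim n : ℤ) - 5) = t ^ (n + 1) * ((t ^ 2)⁻¹ * (t ^ 2)⁻¹) := by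
    intro t ht
    rw [homDim, ← zpow_natCast, ← zpow_natCast, ← zpow_neg, ← zpow_add₀ ht.ne',
      ← zpow_add₀ ht.ne']
    congr 1
    push_cast
    ring
  have eW : ∀ᵐ t ∂volume.restrict (interval R), W t * f t ^ 2 * t ^ ((homDim n : ℤ) - 3) =
      t ^ (n + 1) * (W' t * ((t ^ 2)⁻¹ * f t ^ 2)) := by
    filter_upwards [hW, ae_restrict_mem (measurableSet_interval R)] with t h1 h2
    rw [h1, e3 t h2.1]; ring
  have hzpow : ∀ (k : ℤ) {g : ℝ → ℝ}, IsTest (interval R) g →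
      Integrable (fun t => g t ^ 2 * t ^ k) (volume.restrict (interval R)) := by
    intro k g hg
    have := (hg.mul hg).mul_left (k := fun t => t ^ k) fun t ht =>
      (analyticAt_id.zpow ht.1.ne').contDiffAt
    refine ((this.integrable (μ := volume)).restrict).congr (.of_forall fun t => ?_)
    simp only []; ring
  have i1 := hzpow ((homDim n : ℤ) - 3) (isTest_deriv hf)
  have i2 := hzpow ((homDim n : ℤ) - 5) hf
  have hc : 2 * (2 * lambdaOne n + (homDim n : ℝ) - 4) = 3 * n - 3 := by
    simp only [lambdaOne, homDim]; push_cast; ring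
  have key := h f hf
  rw [hc, ← integral_const_mul, ← integral_const_mul,
    ← integral_add (i1.const_mul 2) (i2.const_mul _)] at key
  set G : ℝ → ℝ := fun t => 2 * (deriv f t ^ 2 * t ^ ((homDim n : ℤ) - 3)) +
    (3 * n - 3) * (f t ^ 2 * t ^ ((homDim n : ℤ) - 5)) with hG
  have iG : Integrable G (volume.restrict (interval R)) := (i1.const_mul 2).add (i2.const_mul _)
  have G0 : 0 ≤ᵐ[volume.restrict (interval R)] G := by
    filter_upwards [ae_restrict_mem (measurableSet_interval R)] with t ht
    have h1 := zpow_pos ht.1 ((homDim n : ℤ) - 3)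
    have h2 := zpow_pos ht.1 ((homDim n : ℤ) - 5)
    have : (0 : ℝ) ≤ 3 * n - 3 := by linarith
    simp only [hG, Pi.zero_apply]
    positivity
  have e6 : ((∫ t in interval R, G t : ℝ) : EReal) =
      ((∫⁻ t in interval R, ENNReal.ofReal (G t) : ENNReal) : EReal) := by
    rw [← ofReal_integral_eq_lintegral_ofReal iG G0, EReal.coe_ennreal_ofReal,
      max_eq_left (integral_nonneg_of_ae G0)]
  rw [e6, extIntegral, EReal.coe_ennreal_sub_le_iff] at key
  rw [setLIntegral_interval (n + 1) eW fun t ht => by simp [hz t ht],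
    setLIntegral_interval (n + 1) (H := fun t => -(W' t * ((t ^ 2)⁻¹ * f t ^ 2)))
      (eW.mono fun t ht => by simp only [ht]; ring) fun t ht => by simp [hz t ht],
    setLIntegral_interval (n + 1) (G := G) (H := fun r => (r ^ 2)⁻¹ * (2 * deriv f r ^ 2 +
      (3 * n - 3) * ((r ^ 2)⁻¹ * f r ^ 2))) ?_ fun t ht => by simp [hz t ht, hz' t ht]] at key
  · exact key
  · filter_upwards [ae_restrict_mem (measurableSet_interval R)] with t ht
    simp only [hG, e3 t ht.1, e5 t ht.1]
    ring

theorem ae_weight_eq (hn : 2 ≤ n) (hW : W =ᵐ[volume.restrict (interval R)] W') :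
    ∀ᵐ p : Space n, p ∈ ball n R \ {0} → W (rho p) = W' (rho p) := by
  have h1 : ∀ᵐ r, r ∈ interval R → W r = W' r :=
    (ae_restrict_iff' (measurableSet_interval R)).1 hW
  have h2 : ∀ᵐ r ∂radPow (n + 1), r ∈ interval R → W r = W' r :=
    ((withDensity_absolutelyContinuous _ _).trans Measure.restrict_le_self.absolutelyContinuous).ae_le
      h1
  filter_upwards [ae_comp_rho hn h2] with p hp hmem
  exact hp ⟨rho_pos hmem.2, hmem.1⟩

theorem measurable_gam (hu : IsTest {0}ᶜ u) : Measurable (gam u u) :=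
  (isTest_gam hu hu).continuous.measurable

/-- The angular energy is discarded; on each orbit the rest is the one-dimensional inequality for
`fiber u θ`, multiplied by sin φ. -/
theorem hardyIneq_of_radial (hn : 2 ≤ n) (hm : Measurable W')
    (hW : ∀ᵐ p : Space n, p ∈ ball n R \ {0} → W (rho p) = W' (rho p))
    (h : ∀ u : Space n → ℝ, IsTest (ball n R \ {0}) u → IsRadial u → HardyIneq R W u)
    (hu : IsTest (ball n R \ {0}) u) : HardyIneq R W u := by
  have hu0 := hu.compl_zero
  have mrho := measurable_rho (n := n)
  have mkap := measurable_kap (n := n)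
  have mu := hu.continuous.measurable
  have mE : Measurable (euler u) := hu.euler.continuous.measurable
  refine (hardyIneq_iff hu hW).2 (.mono_lintegral (a := fun p => kap p * euler u p ^ 2)
    (.of_polar hn (by fun_prop) (by fun_prop) fun θ hθ => ?_)
    (lintegral_mono fun p => ENNReal.ofReal_le_ofReal (by linarith [gam_self_nonneg u p])))
  have hf := isTest_fiber hu hθ
  refine ((hardy_radial hn hf hm hW (h _ (isTest_radial hf) ⟨_, fun _ => rfl⟩)).const_mul
    (sq_nonneg √(Real.sin θ.2))).congr_ae ?_ ?_
  · filter_upwards [ae_radPow_pos (n + 1)] with r hr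
    rw [kap_mul_euler_sq_dil hu.differentiable hθ hr]
  · filter_upwards [ae_radPow_pos (n + 1)] with r hr
    rw [rho_sq_mul_kap_dil hθ hr, fiber_apply hr, rho_dil hr.le, rho_pol hθ, mul_one]

/-- All angular terms in `lintegral_lap_sq_ge` are nonnegative and can be discarded, so no condition
on W is needed. -/
theorem rellichIneq_of_radial (hn : 2 ≤ n) (hm : Measurable W')
    (hW : ∀ᵐ p : Space n, p ∈ ball n R \ {0} → W (rho p) = W' (rho p))
    (h : ∀ u : Space n → ℝ, IsTest (ball n R \ {0}) u → IsRadial u → RellichIneq R W u)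
    (hu : IsTest (ball n R \ {0}) u) : RellichIneq R W u := by
  have hn' : (2 : ℝ) ≤ n := by exact_mod_cast hn
  have hu0 := hu.compl_zero
  have mrho := measurable_rho (n := n)
  have mkap := measurable_kap (n := n)
  have mu := hu.continuous.measurable
  have mA : Measurable (radLap u) := hu0.radLap.continuous.measurable
  refine (rellichIneq_iff hu hW).2 (.mono_lintegral (a := fun p => rho p ^ 2 * kap p * radLap u p ^ 2)
    (.of_polar hn (by fun_prop) (by fun_prop) fun θ hθ => ?_)
    ((lintegral_mono fun p => ENNReal.ofReal_le_ofReal ?_).trans (lintegral_lap_sq_ge hn hu0)))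
  · have hf := isTest_fiber hu hθ
    refine ((rellich_radial hn hf hm hW (h _ (isTest_radial hf) ⟨_, fun _ => rfl⟩)).const_mul
      (sq_nonneg √(Real.sin θ.2))).congr_ae ?_ ?_
    · filter_upwards [ae_radPow_pos (n + 1)] with r hr
      rw [rho_sq_mul_kap_dil hθ hr, radLap_dil hu0 hθ hr]
    · filter_upwards [ae_radPow_pos (n + 1)] with r hr
      rw [rho_sq_mul_kap_dil hθ hr, fiber_apply hr, rho_dil hr.le, rho_pol hθ, mul_one]
  · have h1 : 0 ≤ (rho p ^ 2)⁻¹ * (2 * gam (euler u) (euler u) p + (3 * n - 3) * gam u u p) :=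
      mul_nonneg (by positivity) (add_nonneg (mul_nonneg zero_le_two (gam_self_nonneg _ _))
        (mul_nonneg (by linarith) (gam_self_nonneg _ _)))
    linarith

/-- On each orbit |∇_G u|² has a radial part, controlled by the radial inequality for `fiber u θ`,
and an angular part, controlled by the one-dimensional condition for every `angFiber u θ a`. The
left sides add up to the integrand of `lintegral_lap_sq_ge`. -/
theorem hardyRellichIneq_of_radial (hn : 2 ≤ n) (hm : Measurable W')
    (hWW' : W =ᵐ[volume.restrict (interval R)] W') (hcond : OneDimCondition n R W)
    (h : ∀ u : Space n → ℝ, IsTest (ball n R \ {0}) u → IsRadial u → HardyRellichIneq R W u)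
    (hu : IsTest (ball n R \ {0}) u) : HardyRellichIneq R W u := by
  have hn' : (2 : ℝ) ≤ n := by exact_mod_cast hn
  have h3 : (0 : ℝ) ≤ 3 * n - 3 := by linarith
  have hW := ae_weight_eq hn hWW'
  have hu0 := hu.compl_zero
  have hu2 : ContDiff ℝ 2 u := hu.1.of_le (by norm_cast)
  have mrho := measurable_rho (n := n)
  have mkap := measurable_kap (n := n)
  have mA : Measurable (radLap u) := hu0.radLap.continuous.measurable
  have mE : Measurable (euler u) := hu.euler.continuous.measurable
  have mG := measurable_gam hu0
  have mGE := measurable_gam hu0.euler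
  refine (hardyRellichIneq_iff hu hW).2 (.mono_lintegral
    (.of_polar hn (by fun_prop) (by fun_prop) fun θ hθ => ?_) (lintegral_lap_sq_ge hn hu0))
  have hf := isTest_fiber hu hθ
  have ha := fun a => isTest_angFiber hu hθ a
  have mR := measurable_radialLap (n := n) (fiber u θ)
  have mf := measurable_deriv (fiber u θ)
  have ma := fun a => (ha a).continuous.measurable
  have mda := fun a => measurable_deriv (angFiber u θ a)
  have d1 := (hardyRellich_radial hn hf hm hW
    (h _ (isTest_radial hf) ⟨_, fun _ => rfl⟩)).const_mul (sq_nonneg √(Real.sin θ.2))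
  have d2 := IntegralDominates.sum_weighted (s := Finset.univ) hm
    (g := fun a r => (r ^ 2)⁻¹ * angFiber u θ a r ^ 2)
    (A := fun a r => (r ^ 2)⁻¹ * (2 * deriv (angFiber u θ a) r ^ 2 +
      (3 * n - 3) * ((r ^ 2)⁻¹ * angFiber u θ a r ^ 2)))
    (fun a r => by positivity) (fun a => by fun_prop) (fun a r => by positivity)
    (fun a => by fun_prop) (fun a => hcond.integralDominates hn hWW' (ha a))
  refine (IntegralDominates.add_weighted hm
    (g₁ := fun r => √(Real.sin θ.2) ^ 2 * deriv (fiber u θ) r ^ 2)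
    (fun r => by positivity) (fun r => Finset.sum_nonneg fun a _ => by positivity) (by fun_prop)
    (fun r => by positivity) (fun r => Finset.sum_nonneg fun a _ => by positivity) (by fun_prop)
    (d1.congr_ae .rfl (.of_forall fun r => by simp only []; ring)) d2).congr_ae ?_ ?_
  · filter_upwards [ae_radPow_pos (n + 1)] with r hr
    rw [rho_sq_mul_kap_dil hθ hr, radLap_dil hu0 hθ hr, rho_dil hr.le, rho_pol hθ, mul_one,
      gam_euler_dil_pol hu2 hr, gam_dil_pol hr, ← Finset.mul_sum, Finset.sum_add_distrib,
      ← Finset.mul_sum, ← Finset.mul_sum, ← Finset.mul_sum]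
  · filter_upwards [ae_radPow_pos (n + 1)] with r hr
    rw [kap_mul_euler_sq_dil hu.differentiable hθ hr, rho_dil hr.le, rho_pol hθ, mul_one,
      gam_dil_pol hr, ← Finset.mul_sum, add_comm]

end Reduction

end Grushin

end

theorem theorem6p3 (n : ℕ) (hQ : 4 ≤ Grushin.homDim n) (R : EReal) (hR : 0 < R)
    (W : ℝ → ℝ) (hW : AEMeasurable W (volume.restrict (Grushin.interval R))) :
    (Grushin.OneDimCondition n R W →
      ((∀ u : Grushin.Space n → ℝ, Grushin.IsTest (Grushin.ball n R \ {0}) u →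
          Grushin.HardyRellichIneq R W u) ↔
        (∀ u : Grushin.Space n → ℝ, Grushin.IsTest (Grushin.ball n R \ {0}) u →
          Grushin.IsRadial u → Grushin.HardyRellichIneq R W u))) ∧
    ((∀ u : Grushin.Space n → ℝ, Grushin.IsTest (Grushin.ball n R \ {0}) u →
        Grushin.HardyIneq R W u) ↔
      (∀ u : Grushin.Space n → ℝ, Grushin.IsTest (Grushin.ball n R \ {0}) u →
        Grushin.IsRadial u → Grushin.HardyIneq R W u)) ∧
    ((∀ u : Grushin.Space n → ℝ, Grushin.IsTest (Grushin.ball n R \ {0}) u →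
        Grushin.RellichIneq R W u) ↔
      (∀ u : Grushin.Space n → ℝ, Grushin.IsTest (Grushin.ball n R \ {0}) u →
        Grushin.IsRadial u → Grushin.RellichIneq R W u)) := by
  have hn : 2 ≤ n := by
    rw [Grushin.homDim] at hQ
    omega
  -- A Borel version of W replaces W, as Tonelli in polar coordinates requires. The change is
  -- invisible because ϱ pulls null sets back to null sets.
  have hm := hW.measurable_mk
  have hWW := hW.ae_eq_mk
  have hWp := Grushin.ae_weight_eq hn hWW
  exact ⟨fun hcond => ⟨fun h u hu _ => h u hu,
      fun h u hu => Grushin.hardyRellichIneq_of_radial hn hm hWW hcond h hu⟩,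
    ⟨fun h u hu _ => h u hu, fun h u hu => Grushin.hardyIneq_of_radial hn hm hWp h hu⟩,
    ⟨fun h u hu _ => h u hu, fun h u hu => Grushin.rellichIneq_of_radial hn hm hWp h hu⟩⟩
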